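/- Let $S,X,T$ be discrete random variables with joint law $P_{S,X,T}$, where $S$ takes values in a finite set and $X,T$ take values in finite or countably infinite sets. All logarithms are to base $2$, and entropies and mutual informations are in bits. For $r\ge 0$ let $$g^r_0(P_{S,X,T})=\sup\{\,I(Y;T)\ :\ P_{Y|S,X,T},\ Y \text{ discrete},\ I(Y;S)\le 0,\ I(X;Y)\le r\,\}.$$ Put $$L_1^r=H(T|X,S)+r-H(X,S|T),\qquad L_2=H(T|X,S)-\bigl(\log(I(X,S;T)+5.51)+1.06\bigr),$$ $$L_3^r=H(T|X,S)+r-\alpha H(X,S|T)-1.06-\log\bigl((1-\alpha)I(X,S;T)+\alpha\min\{H(T),H(X,S)\}+5.51\bigr),\quad \alpha=\frac{r}{H(X|S)}$$ (with $\alpha=0$ if $r=H(X|S)=0$), and $$U_0=H(T)+\sum_{t\in\mathcal T}\int_0^1 \mathbb P_S\{P_{T|S}(t|S)\ge m\}\,\log\bigl(\mathbb P_S\{P_{T|S}(t|S)\ge m\}\bigr)\,dm ,$$ where $0\log 0=0$; the integrals and the sum over $t$ converge absolutely. (i) For every real $r$ with $0\le r\le H(X|S)$, $$\max\{L_1^r,L_2,L_3^r\}\le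 g^r_0(P_{S,X,T})\le\min\{H(T|X)+r,\ H(T|S),\ U_0\}.$$ (ii) For every real $r$ with $H(X|S)\le r<H(X)$, $$\max\{L_1'^{\,r},L_2\}\le g^r_0(P_{S,X,T})\le\min\{H(T|X)+r,\ H(T|S),\ U_0\},$$ where $L_1'^{\,r}=H(T|S)-H(S|T)=H(T)-H(S)$. Entropies may be infinite; a lower bound in which $\infty-\infty$ occurs is read as $-\infty$, and the bound by $L_3^r$ is claimed only when $H(X|S)<\infty$, so that $\alpha$ is defined. -/

import Mathlib

namespace FairRepresentation

noncomputable section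

/-! Discrete random variables are functions on a discrete probability space `(Ω, P)`, `P : PMF Ω`.
All information measures are in bits and take values in `[0, ∞]`. -/

/-- Shannon entropy `H(A) = -∑ a, P(a) log₂ P(a)`. Every summand is nonnegative. -/
def entropy {Ω α : Type*} (P : PMF Ω) (A : Ω → α) : ENNReal :=
  ∑' a, ENNReal.ofReal (-((P.map A a).toReal * Real.logb 2 (P.map A a).toReal))

/-- Conditional probability `P(A = a | B = b)` (equal to `0` if `P(B = b) = 0`). -/
def condProb {Ω α β : Type*} (P : PMF Ω) (A : Ω → α) (B : Ω → β) (a : α) (b : β) : ENNReal :=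
  P.map (fun w => (A w, B w)) (a, b) / P.map B b

/-- Conditional entropy `H(A|B) = ∑ b, P(b) H(A | B = b)`. -/
def condEntropy {Ω α β : Type*} (P : PMF Ω) (A : Ω → α) (B : Ω → β) : ENNReal :=
  ∑' b, P.map B b * ∑' a, ENNReal.ofReal
    (-((condProb P A B a b).toReal * Real.logb 2 (condProb P A B a b).toReal))

/-- Product of two probability mass functions. -/
def prodPMF {α β : Type*} (p : PMF α) (q : PMF β) : PMF (α × β) :=
  p.bind fun a => q.map fun b => (a, b)

/-- Mutual information `I(A;B) = D(P_{A,B} ‖ P_A × P_B)`, in bits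
(`klDiv` is in nats, whence the factor `log 2`). -/
def mutualInfo {Ω α β : Type*} (P : PMF Ω) (A : Ω → α) (B : Ω → β) : ENNReal :=
  letI : MeasurableSpace (α × β) := ⊤
  InformationTheory.klDiv (P.map fun w => (A w, B w)).toMeasure
    (prodPMF (P.map A) (P.map B)).toMeasure / ENNReal.ofReal (Real.log 2)

/-- Binary logarithm on `[0, ∞]`, with `log₂ 0 = -∞` and `log₂ ∞ = ∞`. -/
def log2 (x : ENNReal) : EReal := ENNReal.log x / ((Real.log 2 : ℝ) : EReal)

section Problem

variable {S X T : Type*}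

/-- The sensitive attribute `S`. -/
def rvS (w : S × X × T) : S := w.1
/-- The useful data `X`. -/
def rvX (w : S × X × T) : X := w.2.1
/-- The task `T`. -/
def rvT (w : S × X × T) : T := w.2.2
/-- The pair `(X, S)`. -/
def rvXS (w : S × X × T) : X × S := (w.2.1, w.1)

/-- The joint law of `((S, X, T), Y)` for a representation `Y` drawn from `P_{Y|S,X,T} = K`. -/
def jointLaw {𝒴 : Type*} (P : PMF (S × X × T)) (K : S × X × T → PMF 𝒴) :
    PMF ((S × X × T) × 𝒴) :=
  P.bind fun w => (K w).map fun y => (w, y)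

/-- `g^r_ε(P_{S,X,T})`: the supremum of `I(Y;T)` over all discrete representations `Y` with
`I(Y;S) ≤ ε` and `I(X;Y) ≤ r`. A discrete alphabet is countable, and mutual information does not
depend on the labels of the values of `Y`, so the alphabet of `Y` is taken inside `ℕ`. -/
def g (ε r : ENNReal) (P : PMF (S × X × T)) : ENNReal :=
  ⨆ (K : S × X × T → PMF ℕ)
    (_ : mutualInfo (jointLaw P K) Prod.snd (rvS ∘ Prod.fst) ≤ ε)
    (_ : mutualInfo (jointLaw P K) (rvX ∘ Prod.fst) Prod.snd ≤ r),
    mutualInfo (jointLaw P K) Prod.snd (rvT ∘ Prod.fst)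

/-! The bounds below are extended reals; in `EReal` an undefined `∞ - ∞` has the value `-∞`. -/

/-- `L₁^r = H(T|X,S) + r - H(X,S|T)`. -/
def L1 (r : NNReal) (P : PMF (S × X × T)) : EReal :=
  (condEntropy P rvT rvXS : EReal) + ((r : ENNReal) : EReal) - (condEntropy P rvXS rvT : EReal)

/-- `L₂ = H(T|X,S) - (log₂(I(X,S;T) + 5.51) + 1.06)`. -/
def L2 (P : PMF (S × X × T)) : EReal :=
  (condEntropy P rvT rvXS : EReal)
    - (log2 (mutualInfo P rvXS rvT + ENNReal.ofReal 5.51) + ((1.06 : ℝ) : EReal))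

/-- `α = r / H(X|S)`, with `0 / 0 = 0`. -/
def alpha (r : NNReal) (P : PMF (S × X × T)) : ENNReal :=
  (r : ENNReal) / condEntropy P rvX rvS

/-- `L₃^r = H(T|X,S) + r - α H(X,S|T) - 1.06
  - log₂((1 - α) I(X,S;T) + α min{H(T), H(X,S)} + 5.51)`. -/
def L3 (r : NNReal) (P : PMF (S × X × T)) : EReal :=
  (condEntropy P rvT rvXS : EReal) + ((r : ENNReal) : EReal)
    - ((alpha r P * condEntropy P rvXS rvT : ENNReal) : EReal) - ((1.06 : ℝ) : EReal)
    - log2 ((1 - alpha r P) * mutualInfo P rvXS rvT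
        + alpha r P * min (entropy P rvT) (entropy P rvXS) + ENNReal.ofReal 5.51)

/-- `L'₁^r = H(T|S) - H(S|T)`. -/
def L1Prime (P : PMF (S × X × T)) : EReal :=
  (condEntropy P rvT rvS : EReal) - (condEntropy P rvS rvT : EReal)

/-- `ℙ_S{P_{T|S}(t|S) ≥ m}`. -/
def levelProb (P : PMF (S × X × T)) (t : T) (m : ℝ) : ℝ :=
  ((P.map rvS).toOuterMeasure {s | m ≤ (condProb P rvT rvS t s).toReal}).toReal

/-- `ℙ_S{P_{T|S}(t|S) ≥ m} log₂ ℙ_S{P_{T|S}(t|S) ≥ m}`. -/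
def levelTerm (P : PMF (S × X × T)) (t : T) (m : ℝ) : ℝ :=
  levelProb P t m * Real.logb 2 (levelProb P t m)

/-- `U₀ = H(T) + ∑ t, ∫₀¹ ℙ_S{P_{T|S}(t|S) ≥ m} log₂ ℙ_S{P_{T|S}(t|S) ≥ m} dm`. -/
def U0 (P : PMF (S × X × T)) : EReal :=
  (entropy P rvT : EReal) + ((∑' t, ∫ m in (0 : ℝ)..1, levelTerm P t m : ℝ) : EReal)

/-- The upper bound `min{H(T|X) + r, H(T|S), U₀}`. -/
def upperBound (r : NNReal) (P : PMF (S × X × T)) : EReal :=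
  min ((condEntropy P rvT rvX : EReal) + ((r : ENNReal) : EReal))
    (min (condEntropy P rvT rvS : EReal) (U0 P))

end Problem

end

end FairRepresentation

namespace FairRepresentation

open scoped ENNReal

noncomputable section

/-! ### Auxiliary facts on sums -/

/-! Upper bounds. The chain rule gives I(Y;T) ≤ I(Y;X,T) = I(Y;X) + I(Y;T|X) ≤ r + H(T|X).
Independence of Y and S gives I(Y;T) ≤ I(Y;S,T) = I(Y;T|S) ≤ H(T|S). For `U0`, independence makes
P(t|y) = ∑ P(s) v(s) with v(s) = P(t|s,y) in [0,1], and v averages over y to P(t|·). With φ(x) = -x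
log x, the contribution of t to H(T|Y) is the mean of φ(∑ P(s) v(s)). The set function A ↦ φ(P(A))
is submodular, and its Lovász extension at P(t|·) is the integral of φ over the level probabilities.
Greedy weights give a linear functional that lies below v ↦ φ(∑ P(s) v(s)) on the cube and takes the
value of that extension at P(t|·) (`exists_supporting_weights`); averaging over y gives H(T|Y) ≥
H(T) - U₀.

Lower bounds. Each comes from an explicit Y. For `L1`, a functional representation
(`exists_functional_representation`) yields V independent of S such that (V,S) determines X, and
then U independent of (X,S,V) such that (U,X,S,V) determines T. For Y = (V,U) one has I(Y;X,S) =
H(X|S) and I(Y;T|X,S) ≥ H(T|X,S), so I(Y;T) = I(Y;X,S) + I(Y;T|X,S) - I(Y;X,S|T) is large enough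
(`frl_bound`). For `L2`, a strong functional representation
(`exists_strong_functional_representation`) yields Y independent of (X,S) with H(T|Y) ≤ I + log₂(I +
4) + 1, I = I(X,S;T). It is an exponential race: letter b has an exponential clock, the winner at
the conditional speeds is T, and Y records the arrival times at the marginal speeds, rounded so as
to be discrete. The winner tends to arrive early, hence is cheap to describe given Y. Time sharing
(`g_timeSharing`) interpolates: between rate 0 and a rate above r for `L1`, and between the two
constructions for `L3`. `L1Prime` is the `L1` bound at rate H(X|S) after cancelling H(X|S,T).

The constructions need finite alphabets for the variable represented; countable ones are reached by
truncation (`condEntropy_le_iSup_quant`). Entropies may be infinite, so inequalities are kept in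
additive form in [0,∞]. Everything is expressed through `cmi`, a sum of nonnegative terms;
`tsum_ofReal_eq_add` turns a termwise identity with a signed summable remainder into an identity in
[0,∞], which gives the chain rules without finiteness assumptions. -/

theorem tsum_ofReal_eq_add {ι : Type*} {x y z e : ι → ℝ} {R : ℝ} (hx : ∀ i, 0 ≤ x i)
    (hy : ∀ i, 0 ≤ y i) (hz : ∀ i, 0 ≤ z i) (he : HasSum e R) (hR : 0 ≤ R)
    (h : ∀ i, x i = y i + z i + e i) :
    ∑' i, ENNReal.ofReal (x i)
      = ∑' i, ENNReal.ofReal (y i) + ∑' i, ENNReal.ofReal (z i) + ENNReal.ofReal R := by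
  have hea : ∑' i, ENNReal.ofReal |e i| ≠ ⊤ := by
    have := he.summable.abs.tsum_ofReal_ne_top
    exact this
  by_cases hxt : ∑' i, ENNReal.ofReal (x i) = ⊤
  · rw [hxt]
    symm
    by_contra hne
    have h1 : ∑' i, ENNReal.ofReal (x i) ≤ ∑' i, ENNReal.ofReal (y i)
        + ∑' i, ENNReal.ofReal (z i) + ∑' i, ENNReal.ofReal |e i| := by
      rw [← ENNReal.tsum_add, ← ENNReal.tsum_add]
      refine ENNReal.tsum_le_tsum fun i => ?_
      rw [← ENNReal.ofReal_add (hy i) (hz i), ← ENNReal.ofReal_add (add_nonneg (hy i) (hz i))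
        (abs_nonneg _)]
      refine ENNReal.ofReal_le_ofReal ?_
      have := le_abs_self (e i)
      have := h i
      linarith
    rw [hxt, top_le_iff] at h1
    simp only [ENNReal.add_eq_top, hea, or_false] at h1
    simp only [ENNReal.add_eq_top, h1, true_or, not_true] at hne
  · have hyz : ∀ f : ι → ℝ, (∀ i, 0 ≤ f i) → (∀ i, f i ≤ y i + z i) → Summable f := by
      intro f hf hfy
      have h1 : ∑' i, ENNReal.ofReal (f i) ≤ ∑' i, ENNReal.ofReal (x i)
          + ∑' i, ENNReal.ofReal |e i| := by
        rw [← ENNReal.tsum_add]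
        refine ENNReal.tsum_le_tsum fun i => ?_
        rw [← ENNReal.ofReal_add (hx i) (abs_nonneg _)]
        refine ENNReal.ofReal_le_ofReal ?_
        have := neg_le_abs (e i)
        have := h i
        have := hfy i
        linarith
      have h2 : ∑' i, ENNReal.ofReal (f i) ≠ ⊤ :=
        ne_top_of_le_ne_top (ENNReal.add_ne_top.2 ⟨hxt, hea⟩) h1
      have := ENNReal.summable_toReal h2
      exact this.congr fun i => (ENNReal.toReal_ofReal (hf i))
    have hys := hyz y hy fun i => by linarith [hz i]
    have hzs := hyz z hz fun i => by linarith [hy i]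
    have hxs : HasSum x (∑' i, y i + ∑' i, z i + R) := by
      rw [show x = fun i => y i + z i + e i from funext h]
      exact (hys.hasSum.add hzs.hasSum).add he
    rw [← ENNReal.ofReal_tsum_of_nonneg hx hxs.summable, ← ENNReal.ofReal_tsum_of_nonneg hy hys,
      ← ENNReal.ofReal_tsum_of_nonneg hz hzs, hxs.tsum_eq,
      ENNReal.ofReal_add (add_nonneg (tsum_nonneg hy) (tsum_nonneg hz)) hR,
      ENNReal.ofReal_add (tsum_nonneg hy) (tsum_nonneg hz)]

theorem ofReal_le_tsum_ofReal {ι : Type*} {r l : ι → ℝ} {R : ℝ} (hr : HasSum r R)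
    (hl : ∀ i, 0 ≤ l i) (h : ∀ i, r i ≤ l i) :
    ENNReal.ofReal R ≤ ∑' i, ENNReal.ofReal (l i) := by
  by_cases ht : ∑' i, ENNReal.ofReal (l i) = ⊤
  · simp [ht]
  have hs : Summable l := (ENNReal.summable_toReal ht).congr fun i => ENNReal.toReal_ofReal (hl i)
  rw [← ENNReal.ofReal_tsum_of_nonneg hl hs]
  exact ENNReal.ofReal_le_ofReal (hasSum_le h hr hs.hasSum)

/-! ### Probabilities of events -/

variable {Ω α β γ δ : Type*}

/-- The probability of an event, as a real number. -/
def pr (P : PMF Ω) (E : Set Ω) : ℝ := (P.toOuterMeasure E).toReal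

theorem outer_ne_top (P : PMF Ω) (E : Set Ω) : P.toOuterMeasure E ≠ ⊤ := by
  rw [PMF.toOuterMeasure_apply]
  exact P.tsum_coe_indicator_ne_top E

theorem outer_univ (P : PMF Ω) : P.toOuterMeasure Set.univ = 1 := by
  rw [PMF.toOuterMeasure_apply]
  simp

theorem outer_eq_tsum (P : PMF Ω) (E : Set Ω) (B : Ω → β) :
    P.toOuterMeasure E = ∑' b, P.toOuterMeasure {w | w ∈ E ∧ B w = b} := by
  simp only [PMF.toOuterMeasure_apply]
  rw [ENNReal.tsum_comm]
  refine tsum_congr fun w => ?_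
  rw [tsum_eq_single (B w)]
  · by_cases h : w ∈ E <;> simp [Set.indicator, h]
  · intro b hb
    simp [Set.indicator, Ne.symm hb]

theorem ofReal_pr (P : PMF Ω) (E : Set Ω) : ENNReal.ofReal (pr P E) = P.toOuterMeasure E :=
  ENNReal.ofReal_toReal (outer_ne_top P E)

theorem pr_nonneg (P : PMF Ω) (E : Set Ω) : 0 ≤ pr P E := ENNReal.toReal_nonneg

theorem pr_univ (P : PMF Ω) : pr P Set.univ = 1 := by simp [pr, outer_univ]

theorem pr_mono (P : PMF Ω) {E F : Set Ω} (h : E ⊆ F) : pr P E ≤ pr P F :=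
  ENNReal.toReal_mono (outer_ne_top P F) (P.toOuterMeasure.mono h)

theorem pr_le_one (P : PMF Ω) (E : Set Ω) : pr P E ≤ 1 := by
  rw [← pr_univ P]
  exact pr_mono P (Set.subset_univ E)

theorem pr_eq_zero_of_subset (P : PMF Ω) {E F : Set Ω} (h : E ⊆ F) (hF : pr P F = 0) :
    pr P E = 0 :=
  le_antisymm (hF ▸ pr_mono P h) (pr_nonneg P E)

theorem hasSum_pr (P : PMF Ω) (E : Set Ω) (B : Ω → β) :
    HasSum (fun b => pr P {w | w ∈ E ∧ B w = b}) (pr P E) := by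
  have h := outer_eq_tsum P E B
  unfold pr
  rw [h, ENNReal.tsum_toReal_eq fun b => outer_ne_top P _]
  exact ENNReal.hasSum_toReal (h ▸ outer_ne_top P E)

theorem map_apply_eq_outer (P : PMF Ω) (A : Ω → α) (a : α) :
    P.map A a = P.toOuterMeasure {w | A w = a} := by
  rw [← PMF.toOuterMeasure_apply_singleton, PMF.toOuterMeasure_map_apply]
  rfl

theorem toReal_map_apply (P : PMF Ω) (A : Ω → α) (a : α) :
    (P.map A a).toReal = pr P {w | A w = a} := by
  rw [map_apply_eq_outer, pr]

theorem pr_map (P : PMF Ω) (F : Ω → α) (E : Set α) : pr (P.map F) E = pr P (F ⁻¹' E) := by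
  rw [pr, pr, PMF.toOuterMeasure_map_apply]

/-! ### Conditional mutual information -/

/-- The contribution of one cell to a relative entropy, in bits. -/
def divTerm (p q : ℝ) : ℝ := (p * Real.log (p / q) + q - p) / Real.log 2

theorem log_two_pos : 0 < Real.log 2 := Real.log_pos one_lt_two

theorem divTerm_eq_klFun {p q : ℝ} (h : q = 0 → p = 0) :
    divTerm p q = q * InformationTheory.klFun (p / q) / Real.log 2 := by
  unfold divTerm InformationTheory.klFun
  by_cases hq : q = 0
  · simp [hq, h hq]
  · congr 1
    field_simp

theorem divTerm_nonneg {p q : ℝ} (hp : 0 ≤ p) (hq : 0 ≤ q) (h : q = 0 → p = 0) :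
    0 ≤ divTerm p q := by
  rw [divTerm_eq_klFun h]
  exact div_nonneg (mul_nonneg hq (InformationTheory.klFun_nonneg (div_nonneg hp hq)))
    log_two_pos.le

theorem divTerm_self (p : ℝ) : divTerm p p = 0 := by
  unfold divTerm
  by_cases h : p = 0 <;> simp [h]

theorem eq_of_divTerm_eq_zero {p q : ℝ} (hp : 0 ≤ p) (hq : 0 ≤ q) (h : q = 0 → p = 0)
    (h0 : divTerm p q = 0) : p = q := by
  by_cases hq0 : q = 0
  · rw [hq0, h hq0]
  rw [divTerm_eq_klFun h, div_eq_zero_iff, mul_eq_zero] at h0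
  rcases h0 with (h0 | h0) | h0
  · exact absurd h0 hq0
  · rw [InformationTheory.klFun_eq_zero_iff (div_nonneg hp hq)] at h0
    field_simp at h0
    exact h0
  · exact absurd h0 log_two_pos.ne'

theorem divTerm_mul (c p q : ℝ) : divTerm (c * p) (c * q) = c * divTerm p q := by
  unfold divTerm
  by_cases hc : c = 0
  · simp [hc]
  rw [mul_div_mul_left _ _ hc]
  ring

/-- Conditional mutual information `I(A;B|C)` in bits. -/
def cmi (P : PMF Ω) (A : Ω → α) (B : Ω → β) (C : Ω → γ) : ℝ≥0∞ :=
  ∑' c, ∑' a, ∑' b, ENNReal.ofReal (divTerm (pr P {w | A w = a ∧ B w = b ∧ C w = c})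
    (pr P {w | A w = a ∧ C w = c} * pr P {w | B w = b ∧ C w = c} / pr P {w | C w = c}))

theorem cell_zero {P : PMF Ω} {E F G H : Set Ω} (h1 : E ⊆ F) (h2 : E ⊆ G) (h3 : E ⊆ H)
    (h : pr P F * pr P G / pr P H = 0) : pr P E = 0 := by
  rw [div_eq_zero_iff, mul_eq_zero] at h
  rcases h with (h | h) | h
  · exact pr_eq_zero_of_subset P h1 h
  · exact pr_eq_zero_of_subset P h2 h
  · exact pr_eq_zero_of_subset P h3 h

theorem cell_nonneg (P : PMF Ω) (F G H : Set Ω) : 0 ≤ pr P F * pr P G / pr P H :=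
  div_nonneg (mul_nonneg (pr_nonneg _ _) (pr_nonneg _ _)) (pr_nonneg _ _)

theorem cmi_comm (P : PMF Ω) (A : Ω → α) (B : Ω → β) (C : Ω → γ) :
    cmi P A B C = cmi P B A C := by
  unfold cmi
  refine tsum_congr fun c => ?_
  rw [ENNReal.tsum_comm]
  refine tsum_congr fun b => tsum_congr fun a => ?_
  rw [mul_comm (pr P {w | A w = a ∧ C w = c})]
  congr 3
  ext w
  simp only [Set.mem_ofPred_eq]
  tauto

theorem cmi_eq_zero {P : PMF Ω} {A : Ω → α} {B : Ω → β} {C : Ω → γ}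
    (h : ∀ a b c, pr P {w | A w = a ∧ B w = b ∧ C w = c} * pr P {w | C w = c}
      = pr P {w | A w = a ∧ C w = c} * pr P {w | B w = b ∧ C w = c}) :
    cmi P A B C = 0 := by
  unfold cmi
  simp only [ENNReal.tsum_eq_zero, ENNReal.ofReal_eq_zero]
  intro c a b
  rw [← h a b c]
  by_cases h0 : pr P {w | C w = c} = 0
  · rw [pr_eq_zero_of_subset P (fun w hw => hw.2.2) h0]
    simp [divTerm]
  · rw [mul_div_cancel_right₀ _ h0, divTerm_self]

theorem pr_mul_eq_of_cmi_eq_zero {P : PMF Ω} {A : Ω → α} {B : Ω → β} {C : Ω → γ}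
    (h : cmi P A B C = 0) (a : α) (b : β) (c : γ) :
    pr P {w | A w = a ∧ B w = b ∧ C w = c} * pr P {w | C w = c}
      = pr P {w | A w = a ∧ C w = c} * pr P {w | B w = b ∧ C w = c} := by
  unfold cmi at h
  simp only [ENNReal.tsum_eq_zero, ENNReal.ofReal_eq_zero] at h
  have hz := @cell_zero _ P {w | A w = a ∧ B w = b ∧ C w = c} {w | A w = a ∧ C w = c}
    {w | B w = b ∧ C w = c} {w | C w = c} (fun w hw => ⟨hw.1, hw.2.2⟩) (fun w hw => hw.2)
    (fun w hw => hw.2.2)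
  have h1 := eq_of_divTerm_eq_zero (pr_nonneg _ _) (cell_nonneg _ _ _ _) hz
    (le_antisymm (h c a b) (divTerm_nonneg (pr_nonneg _ _) (cell_nonneg _ _ _ _) hz))
  by_cases h0 : pr P {w | C w = c} = 0
  · rw [h0, mul_zero, pr_eq_zero_of_subset P (fun w hw => hw.2) h0, zero_mul]
  · rw [h1, div_mul_cancel₀ _ h0]

/-- The cellwise chain rule: p, p', cb, cd, ad, d stand for the probabilities of (a,b,c,d), (a,c,d),
(b,c,d), (c,d), (a,d), d. Summed over b, the last summand becomes `divTerm p' q`, the cell of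
I(A;C|D). The summand 0 fits the shape of `tsum_ofReal_eq_add`. -/
theorem divTerm_chain {p p' q cb cd ad d : ℝ} (hp : 0 ≤ p)
    (hpp : p' = 0 → p = 0) (h1 : cb = 0 → p = 0) (h2 : cd = 0 → p = 0) (h3 : ad = 0 → p = 0)
    (h4 : d = 0 → p = 0) (hq : q = ad * cd / d) :
    divTerm p (ad * cb / d) = divTerm p (p' * cb / cd) + 0
      + (p * Real.log (p' / q) + ad * cb / d - p' * cb / cd) / Real.log 2 := by
  unfold divTerm
  rw [add_zero, ← add_div]
  congr 1
  rcases hp.eq_or_lt with h0 | h0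
  · simp [← h0]
  have hpp := mt hpp h0.ne'
  have h1 := mt h1 h0.ne'
  have h2 := mt h2 h0.ne'
  have h3 := mt h3 h0.ne'
  have h4 := mt h4 h0.ne'
  have : Real.log (p / (ad * cb / d)) = Real.log (p / (p' * cb / cd)) + Real.log (p' / q) := by
    rw [← Real.log_mul]
    · congr 1
      rw [hq]
      field_simp
    · exact div_ne_zero h0.ne' (div_ne_zero (mul_ne_zero hpp h1) h2)
    · rw [hq]
      exact div_ne_zero hpp (div_ne_zero (mul_ne_zero h3 h2) h4)
  rw [this]
  ring

/-- Chain rule `I(A;C,B|D) = I(A;C|D) + I(A;B|C,D)`. -/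
theorem cmi_chain (P : PMF Ω) (A : Ω → α) (B : Ω → β) (C : Ω → γ) (D : Ω → δ) :
    cmi P A (fun w => (C w, B w)) D
      = cmi P A C D + cmi P A B (fun w => (C w, D w)) := by
  have key : ∀ d a c, ∑' b, ENNReal.ofReal (divTerm
      (pr P {w | A w = a ∧ (C w, B w) = (c, b) ∧ D w = d})
      (pr P {w | A w = a ∧ D w = d} * pr P {w | (C w, B w) = (c, b) ∧ D w = d}
        / pr P {w | D w = d}))
      = ENNReal.ofReal (divTerm (pr P {w | A w = a ∧ C w = c ∧ D w = d})
          (pr P {w | A w = a ∧ D w = d} * pr P {w | C w = c ∧ D w = d} / pr P {w | D w = d}))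
        + ∑' b, ENNReal.ofReal (divTerm (pr P {w | A w = a ∧ B w = b ∧ (C w, D w) = (c, d)})
          (pr P {w | A w = a ∧ (C w, D w) = (c, d)} * pr P {w | B w = b ∧ (C w, D w) = (c, d)}
            / pr P {w | (C w, D w) = (c, d)})) := by
    intro d a c
    have e1 : ∀ b, {w | A w = a ∧ B w = b ∧ (C w, D w) = (c, d)}
        = {w | A w = a ∧ (C w, B w) = (c, b) ∧ D w = d} := by
      intro b
      ext w
      simp only [Set.mem_ofPred_eq, Prod.mk.injEq]
      tauto
    have e2 : ∀ b, {w | B w = b ∧ (C w, D w) = (c, d)}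
        = {w | (C w, B w) = (c, b) ∧ D w = d} := by
      intro b
      ext w
      simp only [Set.mem_ofPred_eq, Prod.mk.injEq]
      tauto
    have e3 : {w | A w = a ∧ (C w, D w) = (c, d)} = {w | A w = a ∧ C w = c ∧ D w = d} := by
      ext w
      simp only [Set.mem_ofPred_eq, Prod.mk.injEq]
    have e4 : {w | (C w, D w) = (c, d)} = {w | C w = c ∧ D w = d} := by
      ext w
      simp only [Set.mem_ofPred_eq, Prod.mk.injEq]
    simp only [e1, e2, e3, e4]
    have s1 : HasSum (fun b => pr P {w | A w = a ∧ (C w, B w) = (c, b) ∧ D w = d})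
        (pr P {w | A w = a ∧ C w = c ∧ D w = d}) := by
      convert hasSum_pr P {w | A w = a ∧ C w = c ∧ D w = d} B using 3
      ext w
      simp only [Set.mem_ofPred_eq, Prod.mk.injEq]
      tauto
    have s2 : HasSum (fun b => pr P {w | (C w, B w) = (c, b) ∧ D w = d})
        (pr P {w | C w = c ∧ D w = d}) := by
      convert hasSum_pr P {w | C w = c ∧ D w = d} B using 3
      ext w
      simp only [Set.mem_ofPred_eq, Prod.mk.injEq]
      tauto
    have sub1 : ∀ b, {w | A w = a ∧ (C w, B w) = (c, b) ∧ D w = d} ⊆ {w | A w = a ∧ D w = d} :=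
      fun b w hw => ⟨hw.1, hw.2.2⟩
    have sub2 : ∀ b, {w | A w = a ∧ (C w, B w) = (c, b) ∧ D w = d} ⊆
      {w | (C w, B w) = (c, b) ∧ D w = d} := fun b w hw => hw.2
    have sub3 : ∀ b, {w | A w = a ∧ (C w, B w) = (c, b) ∧ D w = d} ⊆ {w | D w = d} :=
      fun b w hw => hw.2.2
    have sub4 : ∀ b, {w | A w = a ∧ (C w, B w) = (c, b) ∧ D w = d} ⊆
        {w | A w = a ∧ C w = c ∧ D w = d} := fun b w hw => ⟨hw.1, congrArg Prod.fst hw.2.1, hw.2.2⟩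
    have sub5 : ∀ b, {w | A w = a ∧ (C w, B w) = (c, b) ∧ D w = d} ⊆
        {w | C w = c ∧ D w = d} := fun b w hw => ⟨congrArg Prod.fst hw.2.1, hw.2.2⟩
    have hR := divTerm_nonneg (pr_nonneg P {w | A w = a ∧ C w = c ∧ D w = d})
      (cell_nonneg P {w | A w = a ∧ D w = d} {w | C w = c ∧ D w = d} {w | D w = d})
      (cell_zero (fun w hw => ⟨hw.1, hw.2.2⟩) (fun w hw => hw.2) (fun w hw => hw.2.2))
    rw [tsum_ofReal_eq_add (fun b => divTerm_nonneg (pr_nonneg _ _) (cell_nonneg _ _ _ _)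
        (cell_zero (sub1 b) (sub2 b) (sub3 b)))
      (fun b => divTerm_nonneg (pr_nonneg _ _) (cell_nonneg P {w | A w = a ∧ C w = c ∧ D w = d}
        {w | (C w, B w) = (c, b) ∧ D w = d} {w | C w = c ∧ D w = d})
        (cell_zero (sub4 b) (sub2 b) (sub5 b)))
      (z := fun _ => 0) (fun _ => le_rfl) (R := divTerm (pr P {w | A w = a ∧ C w = c ∧ D w = d})
          (pr P {w | A w = a ∧ D w = d} * pr P {w | C w = c ∧ D w = d} / pr P {w | D w = d}))
      ?_ hR (fun b => divTerm_chain (q := pr P {w | A w = a ∧ D w = d} *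
        pr P {w | C w = c ∧ D w = d} / pr P {w | D w = d}) (pr_nonneg _ _)
        (pr_eq_zero_of_subset P (sub4 b)) (pr_eq_zero_of_subset P (sub2 b))
        (pr_eq_zero_of_subset P (sub5 b)) (pr_eq_zero_of_subset P (sub1 b))
        (pr_eq_zero_of_subset P (sub3 b)) rfl)]
    · simp [add_comm]
    · have := (((s1.mul_right (Real.log (pr P {w | A w = a ∧ C w = c ∧ D w = d} /
        (pr P {w | A w = a ∧ D w = d} * pr P {w | C w = c ∧ D w = d} / pr P {w | D w = d})))).add
        ((s2.mul_left (pr P {w | A w = a ∧ D w = d})).div_const (pr P {w | D w = d}))).sub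
        ((s2.mul_left (pr P {w | A w = a ∧ C w = c ∧ D w = d})).div_const
          (pr P {w | C w = c ∧ D w = d}))).div_const (Real.log 2)
      convert this using 1
      · rfl
      rw [divTerm]
      by_cases h0 : pr P {w | C w = c ∧ D w = d} = 0
      · have : pr P {w | A w = a ∧ C w = c ∧ D w = d} = 0 :=
          pr_eq_zero_of_subset P (fun w hw => hw.2) h0
        simp [h0, this]
      · rw [mul_div_cancel_right₀ _ h0]
  unfold cmi
  rw [ENNReal.tsum_prod' (α := γ) (β := δ), ENNReal.tsum_comm (α := γ) (β := δ),
    ← ENNReal.tsum_add]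
  refine tsum_congr fun d => ?_
  rw [ENNReal.tsum_comm (α := γ) (β := α), ← ENNReal.tsum_add]
  refine tsum_congr fun a => ?_
  rw [ENNReal.tsum_prod', ← ENNReal.tsum_add]
  exact tsum_congr fun c => key d a c


/-! ### Data processing -/

theorem pr_congr (P : PMF Ω) {E F : Set Ω} (h : ∀ w, w ∈ E ↔ w ∈ F) : pr P E = pr P F :=
  congrArg (pr P) (Set.ext h)

theorem cmi_comp_zero (P : PMF Ω) (A : Ω → α) (B : Ω → β) (C : Ω → γ) (D : Ω → δ)
    (f : γ → α) (h : ∀ w, A w = f (C w)) : cmi P A B (fun w => (C w, D w)) = 0 := by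
  refine cmi_eq_zero fun a b c => ?_
  obtain ⟨c, d⟩ := c
  by_cases hf : a = f c
  · rw [mul_comm]
    congr 1 <;> refine pr_congr P fun w => ?_ <;>
    · simp only [Set.mem_ofPred_eq, Prod.mk.injEq]
      constructor <;> intro hw <;> simp_all
  · rw [pr_eq_zero_of_subset P (F := ∅), pr_eq_zero_of_subset P (E := {w | A w = a ∧ _}) (F := ∅)]
    · simp
    · intro w hw
      simp only [Set.mem_ofPred_eq, Prod.mk.injEq] at hw
      exact absurd (by rw [← hw.1, h, hw.2.1]) hf
    · simp [pr]
    · intro w hw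
      simp only [Set.mem_ofPred_eq, Prod.mk.injEq] at hw
      exact absurd (by rw [← hw.1, h, hw.2.2.1]) hf
    · simp [pr]

/-- Conditional mutual information does not depend on the labels of the condition. -/
theorem cmi_cond_equiv (P : PMF Ω) (A : Ω → α) (B : Ω → β) (C : Ω → γ) (e : γ ≃ δ) :
    cmi P A B (fun w => e (C w)) = cmi P A B C := by
  unfold cmi
  rw [← e.tsum_eq]
  simp only [EmbeddingLike.apply_eq_iff_eq]

theorem cmi_cond_swap (P : PMF Ω) (A : Ω → α) (B : Ω → β) (C : Ω → γ) (D : Ω → δ) :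
    cmi P A B (fun w => (C w, D w)) = cmi P A B (fun w => (D w, C w)) :=
  cmi_cond_equiv P A B (fun w => (D w, C w)) (Equiv.prodComm δ γ)

theorem cmi_cond_unit (P : PMF Ω) (A : Ω → α) (B : Ω → β) (C : Ω → γ) :
    cmi P A B (fun w => (C w, ())) = cmi P A B C :=
  cmi_cond_equiv P A B C (Equiv.prodPUnit γ).symm

theorem cmi_snd_le (P : PMF Ω) (A : Ω → α) (B : Ω → β) (C : Ω → γ) (D : Ω → δ) :
    cmi P A C D ≤ cmi P A (fun w => (C w, B w)) D := by
  rw [cmi_chain]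
  exact le_self_add

theorem cmi_pair_swap (P : PMF Ω) (A : Ω → α) (B : Ω → β) (C : Ω → γ) (D : Ω → δ) :
    cmi P A (fun w => (B w, C w)) D = cmi P A (fun w => (C w, B w)) D := by
  unfold cmi
  refine tsum_congr fun d => tsum_congr fun a => ?_
  rw [← (Equiv.prodComm γ β).tsum_eq]
  refine tsum_congr fun b => ?_
  congr 3
  · ext w
    simp only [Set.mem_ofPred_eq, Prod.ext_iff, Equiv.prodComm_apply, Prod.fst_swap,
      Prod.snd_swap]
    tauto
  · congr 2
    ext w
    simp only [Set.mem_ofPred_eq, Prod.ext_iff, Equiv.prodComm_apply, Prod.fst_swap,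
      Prod.snd_swap]
    tauto

/-- Chain rule with the pair in the other order. -/
theorem cmi_chain' (P : PMF Ω) (A : Ω → α) (B : Ω → β) (C : Ω → γ) (D : Ω → δ) :
    cmi P A (fun w => (B w, C w)) D
      = cmi P A C D + cmi P A B (fun w => (C w, D w)) := by
  rw [cmi_pair_swap, cmi_chain]

/-- Data processing in the second argument. -/
theorem cmi_comp_right_le (P : PMF Ω) (A : Ω → α) {B : Ω → β} {B' : Ω → δ} (C : Ω → γ)
    (f : δ → β) (h : ∀ w, B w = f (B' w)) : cmi P A B C ≤ cmi P A B' C := by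
  refine (cmi_snd_le P A B' B C).trans (le_of_eq ?_)
  rw [cmi_chain', cmi_comm P A B, cmi_comp_zero P B A B' C f h, add_zero]

/-- Data processing in the first argument. -/
theorem cmi_comp_left_le (P : PMF Ω) {A : Ω → α} {A' : Ω → δ} (B : Ω → β) (C : Ω → γ)
    (f : δ → α) (h : ∀ w, A w = f (A' w)) : cmi P A B C ≤ cmi P A' B C := by
  rw [cmi_comm P A, cmi_comm P A']
  exact cmi_comp_right_le P B C f h

/-! ### Conditional entropy -/

theorem condEntropy_eq (P : PMF Ω) (A : Ω → α) (C : Ω → γ) :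
    condEntropy P A C = ∑' c, ∑' a, ENNReal.ofReal (pr P {w | A w = a ∧ C w = c} *
      Real.log (pr P {w | C w = c} / pr P {w | A w = a ∧ C w = c}) / Real.log 2) := by
  unfold condEntropy
  refine tsum_congr fun c => ?_
  rw [← ENNReal.tsum_mul_left]
  refine tsum_congr fun a => ?_
  rw [condProb, ENNReal.toReal_div, toReal_map_apply, toReal_map_apply, map_apply_eq_outer,
    ← ofReal_pr, ← ENNReal.ofReal_mul (pr_nonneg _ _)]
  congr 1
  have e : pr P {w | (A w, C w) = (a, c)} = pr P {w | A w = a ∧ C w = c} :=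
    pr_congr P fun w => by simp
  rw [e]
  by_cases h0 : pr P {w | C w = c} = 0
  · rw [h0, pr_eq_zero_of_subset P (fun w hw => hw.2) h0]
    simp
  · rw [Real.logb, ← inv_div (pr P {w | A w = a ∧ C w = c}), Real.log_inv]
    field_simp

theorem entropyTerm_nonneg {p q : ℝ} (hp : 0 ≤ p) (hpq : p ≤ q) :
    0 ≤ p * Real.log (q / p) / Real.log 2 := by
  rcases hp.eq_or_lt with h0 | h0
  · simp [← h0]
  · exact div_nonneg (mul_nonneg hp (Real.log_nonneg ((one_le_div h0).2 hpq))) log_two_pos.le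

/-- `H(A|C) = I(A;B|C) + H(A|B,C)`. -/
theorem condEntropy_eq_add (P : PMF Ω) (A : Ω → α) (B : Ω → β) (C : Ω → γ) :
    condEntropy P A C = cmi P A B C + condEntropy P A (fun w => (B w, C w)) := by
  simp only [condEntropy_eq]
  unfold cmi
  rw [ENNReal.tsum_prod', ENNReal.tsum_comm (α := β), ← ENNReal.tsum_add]
  refine tsum_congr fun c => ?_
  rw [ENNReal.tsum_comm (α := β), ← ENNReal.tsum_add]
  refine tsum_congr fun a => ?_
  have e1 : ∀ b, {w | A w = a ∧ (B w, C w) = (b, c)} = {w | A w = a ∧ B w = b ∧ C w = c} := by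
    intro b
    ext w
    simp only [Set.mem_ofPred_eq, Prod.mk.injEq]
  have e2 : ∀ b, {w | (B w, C w) = (b, c)} = {w | B w = b ∧ C w = c} := by
    intro b
    ext w
    simp only [Set.mem_ofPred_eq, Prod.mk.injEq]
  simp only [e1, e2]
  have s1 : HasSum (fun b => pr P {w | A w = a ∧ B w = b ∧ C w = c})
      (pr P {w | A w = a ∧ C w = c}) := by
    convert hasSum_pr P {w | A w = a ∧ C w = c} B using 3
    ext w
    simp only [Set.mem_ofPred_eq]
    tauto
  have s2 : HasSum (fun b => pr P {w | B w = b ∧ C w = c}) (pr P {w | C w = c}) := by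
    convert hasSum_pr P {w | C w = c} B using 3
    ext w
    simp only [Set.mem_ofPred_eq]
    tauto
  have t1 : ∀ b, {w | A w = a ∧ B w = b ∧ C w = c} ⊆ {w | A w = a ∧ C w = c} :=
    fun b w hw => ⟨hw.1, hw.2.2⟩
  have t2 : ∀ b, {w | A w = a ∧ B w = b ∧ C w = c} ⊆ {w | B w = b ∧ C w = c} :=
    fun b w hw => hw.2
  have t3 : {w | A w = a ∧ C w = c} ⊆ {w | C w = c} := fun w hw => hw.2
  have hpos : ∀ b, 0 ≤ pr P {w | A w = a ∧ B w = b ∧ C w = c} *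
      Real.log (pr P {w | C w = c} / pr P {w | A w = a ∧ C w = c}) / Real.log 2 := by
    intro b
    by_cases h0 : pr P {w | A w = a ∧ C w = c} = 0
    · simp [h0]
    · exact div_nonneg (mul_nonneg (pr_nonneg _ _) (Real.log_nonneg
        ((one_le_div ((pr_nonneg _ _).lt_of_ne' h0)).2 (pr_mono P t3)))) log_two_pos.le
  have hs := (s1.mul_right (Real.log (pr P {w | C w = c} /
    pr P {w | A w = a ∧ C w = c}))).div_const (Real.log 2)
  -- The term of H(A|C) is spread over b; the remainder P(a,b,c) - P(a,c)P(b,c)/P(c) then sums to 0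
  -- over b.
  rw [← hs.tsum_eq, ENNReal.ofReal_tsum_of_nonneg hpos hs.summable,
    tsum_ofReal_eq_add (R := 0) hpos
      (fun b => entropyTerm_nonneg (pr_nonneg _ _) (pr_mono P (t2 b)))
      (fun b => divTerm_nonneg (pr_nonneg _ _) (cell_nonneg P {w | A w = a ∧ C w = c}
        {w | B w = b ∧ C w = c} {w | C w = c}) (cell_zero (t1 b) (t2 b) ((t1 b).trans t3)))
      (e := fun b => (pr P {w | A w = a ∧ B w = b ∧ C w = c} - pr P {w | A w = a ∧ C w = c} *
        pr P {w | B w = b ∧ C w = c} / pr P {w | C w = c}) / Real.log 2) ?_ le_rfl]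
  · rw [ENNReal.ofReal_zero, add_zero, add_comm]
  · intro b
    unfold divTerm
    rcases (pr_nonneg P {w | A w = a ∧ B w = b ∧ C w = c}).eq_or_lt with h0 | h0
    · simp only [← h0]
      ring
    have h1 := h0.trans_le (pr_mono P (t1 b))
    have h2 := h0.trans_le (pr_mono P (t2 b))
    have h3 := h1.trans_le (pr_mono P t3)
    rw [Real.log_div h3.ne' h1.ne', Real.log_div h2.ne' h0.ne', Real.log_div h0.ne' (by positivity),
      Real.log_div (by positivity) h3.ne', Real.log_mul h1.ne' h2.ne']
    ring
  · have := (s1.sub ((s2.mul_left (pr P {w | A w = a ∧ C w = c})).div_const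
      (pr P {w | C w = c}))).div_const (Real.log 2)
    convert this using 1
    · rfl
    by_cases h0 : pr P {w | C w = c} = 0
    · rw [h0, pr_eq_zero_of_subset P t3 h0]
      simp
    · rw [mul_div_cancel_right₀ _ h0, sub_self, zero_div]

/-- Conditional entropy vanishes if the conditional law is deterministic. -/
theorem condEntropy_eq_zero {P : PMF Ω} {A : Ω → α} {C : Ω → γ}
    (h : ∀ a c, pr P {w | A w = a ∧ C w = c} = 0 ∨
      pr P {w | A w = a ∧ C w = c} = pr P {w | C w = c}) : condEntropy P A C = 0 := by
  rw [condEntropy_eq]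
  simp only [ENNReal.tsum_eq_zero]
  intro c a
  rcases h a c with h | h
  · simp [h]
  · rw [h]
    by_cases h0 : pr P {w | C w = c} = 0 <;> simp [h0]

theorem condEntropy_comp_zero (P : PMF Ω) (A : Ω → α) (C : Ω → γ) (f : γ → α)
    (h : ∀ w, A w = f (C w)) : condEntropy P A C = 0 := by
  refine condEntropy_eq_zero fun a c => ?_
  by_cases hf : a = f c
  · right
    refine pr_congr P fun w => ?_
    simp only [Set.mem_ofPred_eq]
    constructor <;> intro hw <;> simp_all
  · left
    refine pr_eq_zero_of_subset P (F := ∅) (fun w hw => ?_) (by simp [pr])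
    simp only [Set.mem_ofPred_eq] at hw
    exact absurd (by rw [← hw.1, h, hw.2]) hf

/-- Entropy as self-information: rules for entropy are inherited from `cmi`. -/
theorem condEntropy_eq_cmi (P : PMF Ω) (A : Ω → α) (C : Ω → γ) :
    condEntropy P A C = cmi P A A C := by
  rw [condEntropy_eq_add P A A C, condEntropy_comp_zero P A _ Prod.fst fun _ => rfl, add_zero]

theorem cmi_le_condEntropy (P : PMF Ω) (A : Ω → α) (B : Ω → β) (C : Ω → γ) :
    cmi P A B C ≤ condEntropy P A C := by
  rw [condEntropy_eq_add P A B C]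
  exact le_self_add

theorem condEntropy_cond_le (P : PMF Ω) (A : Ω → α) (B : Ω → β) (C : Ω → γ) :
    condEntropy P A (fun w => (B w, C w)) ≤ condEntropy P A C := by
  rw [condEntropy_eq_add P A B C]
  exact le_add_self

theorem condEntropy_cond_equiv (P : PMF Ω) (A : Ω → α) (C : Ω → γ) (e : γ ≃ δ) :
    condEntropy P A (fun w => e (C w)) = condEntropy P A C := by
  rw [condEntropy_eq_cmi, condEntropy_eq_cmi, cmi_cond_equiv]

/-- Chain rule `H(A,B|C) = H(A|C) + H(B|A,C)`. -/
theorem condEntropy_pair (P : PMF Ω) (A : Ω → α) (B : Ω → β) (C : Ω → γ) :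
    condEntropy P (fun w => (A w, B w)) C
      = condEntropy P A C + condEntropy P B (fun w => (A w, C w)) := by
  rw [condEntropy_eq_cmi, cmi_chain, condEntropy_eq_cmi P A C, condEntropy_eq_cmi P B]
  congr 1
  · refine le_antisymm ?_ (cmi_comp_left_le P _ _ Prod.fst fun _ => rfl)
    rw [cmi_comm, ← condEntropy_eq_cmi]
    exact cmi_le_condEntropy _ _ _ _
  · refine le_antisymm ?_ (cmi_comp_left_le P _ _ Prod.snd fun _ => rfl)
    rw [cmi_comm, ← condEntropy_eq_cmi]
    exact cmi_le_condEntropy _ _ _ _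

theorem condEntropy_comp_le (P : PMF Ω) {A : Ω → α} {A' : Ω → δ} (C : Ω → γ)
    (f : δ → α) (h : ∀ w, A w = f (A' w)) : condEntropy P A C ≤ condEntropy P A' C := by
  rw [condEntropy_eq_cmi, condEntropy_eq_cmi]
  exact (cmi_comp_left_le P _ _ f h).trans (cmi_comp_right_le P _ _ f h)

/-! ### Unconditional quantities -/

/-- Unconditional mutual information in bits. -/
def mi (P : PMF Ω) (A : Ω → α) (B : Ω → β) : ℝ≥0∞ := cmi P A B (fun _ => ())

theorem entropy_eq_condEntropy (P : PMF Ω) (A : Ω → α) :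
    entropy P A = condEntropy P A (fun _ => ()) := by
  rw [condEntropy_eq]
  simp only [tsum_fintype, Finset.univ_unique, Finset.sum_singleton, and_true]
  unfold entropy
  refine tsum_congr fun a => ?_
  rw [toReal_map_apply]
  have : pr P {w : Ω | True} = 1 := by
    rw [← pr_univ P]
    rfl
  rw [this, one_div, Real.log_inv, Real.logb]
  congr 1
  ring

theorem mi_comm (P : PMF Ω) (A : Ω → α) (B : Ω → β) : mi P A B = mi P B A := cmi_comm P A B _

theorem mi_chain (P : PMF Ω) (A : Ω → α) (B : Ω → β) (C : Ω → γ) :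
    mi P A (fun w => (B w, C w)) = mi P A B + cmi P A C B := by
  rw [mi, cmi_chain, cmi_cond_unit, mi]

theorem mi_chain' (P : PMF Ω) (A : Ω → α) (B : Ω → β) (C : Ω → γ) :
    mi P A (fun w => (B w, C w)) = mi P A C + cmi P A B C := by
  rw [mi, cmi_chain', cmi_cond_unit, mi]

theorem mi_comp_right_le (P : PMF Ω) (A : Ω → α) {B : Ω → β} {B' : Ω → δ}
    (f : δ → β) (h : ∀ w, B w = f (B' w)) : mi P A B ≤ mi P A B' := cmi_comp_right_le P A _ f h

theorem mi_comp_left_le (P : PMF Ω) {A : Ω → α} {A' : Ω → δ} (B : Ω → β)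
    (f : δ → α) (h : ∀ w, A w = f (A' w)) : mi P A B ≤ mi P A' B := cmi_comp_left_le P B _ f h

theorem entropy_eq_add (P : PMF Ω) (A : Ω → α) (B : Ω → β) :
    entropy P A = mi P A B + condEntropy P A B := by
  rw [entropy_eq_condEntropy, condEntropy_eq_add P A B, mi]
  congr 1
  exact condEntropy_cond_equiv P A B (Equiv.prodPUnit β).symm

theorem mi_eq_tsum (P : PMF Ω) (A : Ω → α) (B : Ω → β) :
    mi P A B = ∑' a, ∑' b, ENNReal.ofReal (divTerm (pr P {w | A w = a ∧ B w = b})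
      (pr P {w | A w = a} * pr P {w | B w = b})) := by
  have : pr P {w : Ω | True} = 1 := by
    rw [← pr_univ P]
    rfl
  unfold mi cmi
  simp only [tsum_fintype, Finset.univ_unique, Finset.sum_singleton, and_true, this, div_one]

theorem mi_eq_zero {P : PMF Ω} {A : Ω → α} {B : Ω → β}
    (h : ∀ a b, pr P {w | A w = a ∧ B w = b} = pr P {w | A w = a} * pr P {w | B w = b}) :
    mi P A B = 0 := by
  rw [mi_eq_tsum]
  simp [h, divTerm_self]

theorem pr_eq_mul_of_mi_eq_zero {P : PMF Ω} {A : Ω → α} {B : Ω → β} (h : mi P A B = 0)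
    (a : α) (b : β) :
    pr P {w | A w = a ∧ B w = b} = pr P {w | A w = a} * pr P {w | B w = b} := by
  have h1 := pr_mul_eq_of_cmi_eq_zero h a b ()
  have : pr P {w : Ω | True} = 1 := by
    rw [← pr_univ P]
    rfl
  simpa only [and_true, this, mul_one] using h1

theorem prodPMF_apply (p : PMF α) (q : PMF β) (a : α) (b : β) :
    prodPMF p q (a, b) = p a * q b := by
  unfold prodPMF
  rw [PMF.bind_apply, tsum_eq_single a]
  · congr 1
    rw [PMF.map_apply, tsum_eq_single b]
    · simp
    · intro b' hb
      simp [Ne.symm hb]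
  · intro a' ha
    rw [mul_eq_zero]
    right
    rw [PMF.map_apply]
    simp [Ne.symm ha]

/-- On a countable space p has density p/q with respect to q, so the divergence is the integral of
`klFun (p/q)` against q, which is a sum. -/
theorem klDiv_toMeasure [Countable α] [MeasurableSpace α] [MeasurableSingletonClass α]
    (p q : PMF α) (h : ∀ a, q a = 0 → p a = 0) :
    InformationTheory.klDiv p.toMeasure q.toMeasure
      = ∑' a, ENNReal.ofReal (InformationTheory.klFun ((p a).toReal / (q a).toReal)) * q a := by
  have hm : ∀ f : α → ℝ≥0∞, Measurable f := fun f => .of_discrete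
  have hd : p.toMeasure = q.toMeasure.withDensity (fun a => p a / q a) := by
    refine MeasureTheory.Measure.ext_of_singleton fun a => ?_
    rw [MeasureTheory.withDensity_apply _ (measurableSet_singleton a),
      MeasureTheory.lintegral_singleton, PMF.toMeasure_apply_singleton _ _
      (measurableSet_singleton a), PMF.toMeasure_apply_singleton _ _ (measurableSet_singleton a)]
    by_cases h0 : q a = 0
    · simp [h0, h a h0]
    · rw [ENNReal.div_mul_cancel h0 (q.apply_ne_top a)]
  have hac : p.toMeasure.AbsolutelyContinuous q.toMeasure := by
    rw [hd]
    exact MeasureTheory.withDensity_absolutelyContinuous _ _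
  rw [InformationTheory.klDiv_eq_lintegral_klFun_of_ac hac]
  have hr : p.toMeasure.rnDeriv q.toMeasure =ᵐ[q.toMeasure] fun a => p a / q a := by
    rw [hd]
    exact MeasureTheory.Measure.rnDeriv_withDensity _ (hm _)
  rw [MeasureTheory.lintegral_congr_ae (g := fun a =>
    ENNReal.ofReal (InformationTheory.klFun (p a / q a).toReal))
    (hr.mono fun a ha => by simp only [ha]), MeasureTheory.lintegral_countable']
  refine tsum_congr fun a => ?_
  rw [PMF.toMeasure_apply_singleton _ _ (measurableSet_singleton a), ENNReal.toReal_div]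

theorem mutualInfo_eq_mi [Countable α] [Countable β] (P : PMF Ω) (A : Ω → α) (B : Ω → β) :
    mutualInfo P A B = mi P A B := by
  have hm : ∀ a b, P.map (fun w => (A w, B w)) (a, b)
      = P.toOuterMeasure {w | A w = a ∧ B w = b} := by
    intro a b
    rw [map_apply_eq_outer]
    simp only [Prod.mk.injEq]
  unfold mutualInfo
  let : MeasurableSpace (α × β) := ⊤
  rw [klDiv_toMeasure, mi_eq_tsum, div_eq_mul_inv, ENNReal.tsum_prod', ← ENNReal.tsum_mul_right]
  · refine tsum_congr fun a => ?_
    rw [← ENNReal.tsum_mul_right]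
    refine tsum_congr fun b => ?_
    have hz : pr P {w | A w = a} * pr P {w | B w = b} = 0 → pr P {w | A w = a ∧ B w = b} = 0 := by
      intro h
      rcases mul_eq_zero.1 h with h | h
      · exact pr_eq_zero_of_subset P (fun w hw => hw.1) h
      · exact pr_eq_zero_of_subset P (fun w hw => hw.2) h
    have hq := mul_nonneg (pr_nonneg P {w | A w = a}) (pr_nonneg P {w | B w = b})
    rw [prodPMF_apply, hm, ENNReal.toReal_mul, toReal_map_apply, toReal_map_apply,
      divTerm_eq_klFun hz, ← div_eq_mul_inv, ENNReal.ofReal_div_of_pos log_two_pos,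
      ENNReal.ofReal_mul hq, mul_comm (ENNReal.ofReal _), ENNReal.ofReal_mul (pr_nonneg _ _),
      ofReal_pr, ofReal_pr, map_apply_eq_outer, map_apply_eq_outer]
    rfl
  · rintro ⟨a, b⟩ h
    rw [prodPMF_apply, map_apply_eq_outer, map_apply_eq_outer, mul_eq_zero] at h
    rw [hm]
    rcases h with h | h
    · exact le_antisymm (h ▸ P.toOuterMeasure.mono fun w hw => hw.1) zero_le
    · exact le_antisymm (h ▸ P.toOuterMeasure.mono fun w hw => hw.2) zero_le

theorem cmi_map (P : PMF δ) (F : δ → Ω) (A : Ω → α) (B : Ω → β) (C : Ω → γ) :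
    cmi (P.map F) A B C = cmi P (A ∘ F) (B ∘ F) (C ∘ F) := by
  unfold cmi
  simp only [pr_map]
  rfl

theorem mi_map (P : PMF δ) (F : δ → Ω) (A : Ω → α) (B : Ω → β) :
    mi (P.map F) A B = mi P (A ∘ F) (B ∘ F) := cmi_map P F A B _

theorem condEntropy_map (P : PMF δ) (F : δ → Ω) (A : Ω → α) (C : Ω → γ) :
    condEntropy (P.map F) A C = condEntropy P (A ∘ F) (C ∘ F) := by
  rw [condEntropy_eq_cmi, condEntropy_eq_cmi, cmi_map]

end

noncomputable section

variable {Ω α β γ δ ζ 𝒴 : Type*}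

/-! ### Extending a probability space by a kernel -/

theorem bind_map_pair_apply (P : PMF Ω) (κ : Ω → PMF 𝒴) (w : Ω) (y : 𝒴) :
    (P.bind fun w => (κ w).map fun y => (w, y)) (w, y) = P w * κ w y := by
  rw [PMF.bind_apply, tsum_eq_single w]
  · congr 1
    rw [PMF.map_apply, tsum_eq_single y]
    · simp
    · intro b' hb
      simp [Ne.symm hb]
  · intro a' ha
    rw [mul_eq_zero]
    right
    rw [PMF.map_apply]
    simp [Ne.symm ha]

theorem map_fst_bind (P : PMF Ω) (κ : Ω → PMF 𝒴) :
    (P.bind fun w => (κ w).map fun y => (w, y)).map Prod.fst = P := by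
  rw [PMF.map_bind]
  have : ∀ w, ((κ w).map fun y => (w, y)).map Prod.fst = PMF.pure w := by
    intro w
    rw [PMF.map_comp]
    exact PMF.map_const _ _
  simp only [this, PMF.bind_pure]

theorem outer_bind_map_pair (P : PMF Ω) (κ : Ω → PMF 𝒴) (E : Set Ω) (y : 𝒴) :
    (P.bind fun w => (κ w).map fun y => (w, y)).toOuterMeasure {v | v.1 ∈ E ∧ v.2 = y}
      = ∑' w, E.indicator (fun w => P w * κ w y) w := by
  rw [PMF.toOuterMeasure_apply, ENNReal.tsum_prod']
  refine tsum_congr fun w => ?_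
  rw [tsum_eq_single y]
  · by_cases h : w ∈ E
    · simp only [Set.indicator, h, Set.mem_ofPred_eq, and_self, if_true, bind_map_pair_apply]
    · simp [Set.indicator, h]
  · intro b hb
    simp [Set.indicator, hb]

/-- The probability mass function proportional to `f`, or an arbitrary one if that makes no
sense. -/
def normalized [Nonempty 𝒴] (f : 𝒴 → ℝ≥0∞) : PMF 𝒴 :=
  open Classical in
  if h : ∑' y, f y ≠ 0 ∧ ∑' y, f y ≠ ⊤ then PMF.normalize f h.1 h.2
  else PMF.pure (Classical.arbitrary 𝒴)

/-- The arbitrary branch of `normalized` does no harm: a zero sum makes both sides vanish, and an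
infinite one forces c = 0 because d is finite. -/
theorem mul_normalized [Nonempty 𝒴] {f : 𝒴 → ℝ≥0∞} {c d : ℝ≥0∞} (hd : d ≠ ⊤)
    (h : c * ∑' y, f y = d) (y : 𝒴) : d * normalized f y = c * f y := by
  unfold normalized
  split_ifs with h0
  · rw [PMF.normalize_apply, ← h, mul_assoc, mul_left_comm (∑' y, f y),
      ENNReal.mul_inv_cancel h0.1 h0.2, mul_one]
  · rw [not_and_or, not_not, not_not] at h0
    rcases h0 with h0 | h0
    · rw [← h, h0, ENNReal.tsum_eq_zero.1 h0 y]
      simp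
    · have hc : c = 0 := by
        by_contra hc
        rw [h0, ENNReal.mul_top hc] at h
        exact hd h.symm
      rw [← h, hc]
      simp

/-- A coupling that extends `P` by a random variable `Y` with prescribed joint law with `(Z, A)`,
conditionally independent of everything else given `(Z, A)`. -/
theorem exists_coupling [Nonempty 𝒴] (P : PMF Ω) (Z : Ω → ζ) (A : Ω → α) (R : ζ → α → 𝒴 → ℝ≥0∞)
    (hR : ∀ z a, P.toOuterMeasure {w | Z w = z} * ∑' y, R z a y
      = P.toOuterMeasure {w | Z w = z ∧ A w = a}) :
    ∃ P' : PMF (Ω × 𝒴), P'.map Prod.fst = P ∧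
      (∀ z a y, P'.toOuterMeasure {v | (Z v.1 = z ∧ A v.1 = a) ∧ v.2 = y}
        = P.toOuterMeasure {w | Z w = z} * R z a y) ∧
      cmi P' Prod.snd Prod.fst (fun v => (Z v.1, A v.1)) = 0 := by
  have hfst := map_fst_bind P fun w => normalized (R (Z w) (A w))
  have hout : ∀ z a y (E : Set Ω), (∀ w ∈ E, Z w = z ∧ A w = a) →
      (P.bind fun w => (normalized (R (Z w) (A w))).map fun y => (w, y)).toOuterMeasure
        {v | v.1 ∈ E ∧ v.2 = y} = P.toOuterMeasure E * normalized (R z a) y := by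
    intro z a y E hE
    rw [outer_bind_map_pair, PMF.toOuterMeasure_apply, ← ENNReal.tsum_mul_right]
    refine tsum_congr fun w => ?_
    by_cases h : w ∈ E
    · simp only [Set.indicator, h, if_true]
      rw [(hE w h).1, (hE w h).2]
    · simp [Set.indicator, h]
  refine ⟨_, hfst, ?_, ?_⟩
  · intro z a y
    have := hout z a y {w | Z w = z ∧ A w = a} fun w hw => hw
    rw [← mul_normalized (outer_ne_top P _) (hR z a) y]
    exact this
  · refine cmi_eq_zero ?_
    rintro y w ⟨z, a⟩
    have hm : ∀ E : Set Ω, pr (P.bind fun w => (normalized (R (Z w) (A w))).map fun y => (w, y))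
        (Prod.fst ⁻¹' E) = pr P E := by
      intro E
      rw [← pr_map, hfst]
    have hp : ∀ E : Set Ω, (∀ w ∈ E, Z w = z ∧ A w = a) →
        pr (P.bind fun w => (normalized (R (Z w) (A w))).map fun y => (w, y))
          {v | v.1 ∈ E ∧ v.2 = y} = pr P E * (normalized (R z a) y).toReal := by
      intro E hE
      rw [pr, hout z a y E hE, ENNReal.toReal_mul, pr]
    have e1 := hp {w' | w' = w ∧ (Z w', A w') = (z, a)} fun w hw => by simpa using hw.2
    have e2 := hp {w' | (Z w', A w') = (z, a)} fun w hw => by simpa using hw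
    have e3 := hm {w' | w' = w ∧ (Z w', A w') = (z, a)}
    have e4 := hm {w' | (Z w', A w') = (z, a)}
    have f1 : {v : Ω × 𝒴 | v.2 = y ∧ v.1 = w ∧ (Z v.1, A v.1) = (z, a)}
        = {v | v.1 ∈ {w' | w' = w ∧ (Z w', A w') = (z, a)} ∧ v.2 = y} := by
      ext v
      simp only [Set.mem_ofPred_eq]
      tauto
    have f2 : {v : Ω × 𝒴 | v.2 = y ∧ (Z v.1, A v.1) = (z, a)}
        = {v | v.1 ∈ {w' | (Z w', A w') = (z, a)} ∧ v.2 = y} := by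
      ext v
      simp only [Set.mem_ofPred_eq]
      tauto
    rw [f1, f2, e1, e2]
    change _ * pr _ (Prod.fst ⁻¹' {w' | (Z w', A w') = (z, a)})
      = _ * pr _ (Prod.fst ⁻¹' {w' | w' = w ∧ (Z w', A w') = (z, a)})
    rw [e3, e4]
    ring

/-- If the law of `Y` prescribed given `z` is the same for all `z`, then `Y` is independent of
`Z`. -/
theorem mi_eq_zero_of_coupling {P : PMF Ω} {Z : Ω → ζ} {A : Ω → α} {R : ζ → α → 𝒴 → ℝ≥0∞}
    {P' : PMF (Ω × 𝒴)} (h : ∀ z a y, P'.toOuterMeasure {v | (Z v.1 = z ∧ A v.1 = a) ∧ v.2 = y}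
        = P.toOuterMeasure {w | Z w = z} * R z a y) {ρ : 𝒴 → ℝ≥0∞}
    (hρ : ∀ z y, P.toOuterMeasure {w | Z w = z} ≠ 0 → ∑' a, R z a y = ρ y) :
    (∀ z y, P'.toOuterMeasure {v | Z v.1 = z ∧ v.2 = y} = P.toOuterMeasure {w | Z w = z} * ρ y) ∧
    mi P' Prod.snd (Z ∘ Prod.fst) = 0 := by
  have h1 : ∀ z y, P'.toOuterMeasure {v | Z v.1 = z ∧ v.2 = y}
      = P.toOuterMeasure {w | Z w = z} * ρ y := by
    intro z y
    rw [outer_eq_tsum P' _ (fun v => A v.1)]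
    by_cases h0 : P.toOuterMeasure {w | Z w = z} = 0
    · rw [h0, zero_mul, ENNReal.tsum_eq_zero]
      intro a
      have := h z a y
      rw [h0, zero_mul] at this
      rw [← this]
      congr 1
      ext v
      simp only [Set.mem_ofPred_eq]
      tauto
    · rw [← hρ z y h0, ← ENNReal.tsum_mul_left]
      refine tsum_congr fun a => ?_
      rw [← h z a y]
      congr 1
      ext v
      simp only [Set.mem_ofPred_eq]
      tauto
  refine ⟨h1, mi_eq_zero ?_⟩
  have hsum : ∑' z, P.toOuterMeasure {w | Z w = z} = 1 := by
    rw [← outer_univ P, outer_eq_tsum P Set.univ Z]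
    simp
  have h2 : ∀ y, P'.toOuterMeasure {v | v.2 = y} = ρ y := by
    intro y
    rw [outer_eq_tsum P' _ (fun v => Z v.1)]
    have : ∀ z, P'.toOuterMeasure {w | w ∈ {v : Ω × 𝒴 | v.2 = y} ∧ Z w.1 = z}
        = P.toOuterMeasure {w | Z w = z} * ρ y := by
      intro z
      rw [← h1 z y]
      congr 1
      ext v
      simp only [Set.mem_ofPred_eq]
      tauto
    simp only [this]
    rw [ENNReal.tsum_mul_right, hsum, one_mul]
  have hρ1 : ∑' y, ρ y = 1 := by
    simp only [← h2]
    rw [← outer_univ P', outer_eq_tsum P' Set.univ Prod.snd]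
    simp
  have h3 : ∀ z, P'.toOuterMeasure {v | Z v.1 = z} = P.toOuterMeasure {w | Z w = z} := by
    intro z
    rw [outer_eq_tsum P' _ Prod.snd]
    have : ∀ y, P'.toOuterMeasure {w | w ∈ {v : Ω × 𝒴 | Z v.1 = z} ∧ w.2 = y}
        = P.toOuterMeasure {w | Z w = z} * ρ y := fun y => h1 z y
    simp only [this]
    rw [ENNReal.tsum_mul_left, hρ1, mul_one]
  intro y z
  simp only [pr, Function.comp_apply]
  rw [← ENNReal.toReal_mul, h2, h3, mul_comm, ← h1]
  congr 2
  ext v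
  simp only [Set.mem_ofPred_eq]
  tauto

/-! ### Lower bounds on `g` from couplings -/

variable {S X T : Type*}

theorem mi_comp_injective [Nonempty 𝒴] (Q : PMF Ω) (Y : Ω → 𝒴) (B : Ω → β) {e : 𝒴 → γ}
    (he : Function.Injective e) : mi Q (fun w => e (Y w)) B = mi Q Y B :=
  le_antisymm (mi_comp_left_le Q _ e fun _ => rfl)
    (mi_comp_left_le Q _ (Function.invFun e) fun w =>
      (Function.leftInverse_invFun he (Y w)).symm)

/-- Any discrete random variable defined on an extension of the probability space is a competitor
in the definition of `g`. -/
theorem mi_le_g [Countable S] [Countable X] [Countable T] [Countable 𝒴] {P : PMF (S × X × T)}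
    {Q : PMF Ω} {W : Ω → S × X × T} {Y : Ω → 𝒴} (hW : Q.map W = P) {ε r : ℝ≥0∞}
    (hS : mi Q Y (rvS ∘ W) ≤ ε) (hX : mi Q (rvX ∘ W) Y ≤ r) :
    mi Q Y (rvT ∘ W) ≤ g ε r P := by
  obtain ⟨e, he⟩ := exists_injective_nat 𝒴
  obtain ⟨w0, -⟩ := Q.support_nonempty
  have : Nonempty 𝒴 := ⟨Y w0⟩
  let M : PMF ((S × X × T) × ℕ) := Q.map fun v => (W v, e (Y v))
  -- The kernel is the conditional law of the label of Y given W; since W has law P, it reproduces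
  -- the joint law M.
  let K : S × X × T → PMF ℕ := fun w => normalized fun y => M (w, y)
  have hM1 : M.map Prod.fst = P := by
    rw [PMF.map_comp, ← hW]
    rfl
  have hK : jointLaw P K = M := by
    refine PMF.ext ?_
    rintro ⟨w, y⟩
    unfold jointLaw
    rw [bind_map_pair_apply]
    rw [mul_normalized (c := 1) (P.apply_ne_top w), one_mul]
    rw [one_mul, ← hM1, map_apply_eq_outer, PMF.toOuterMeasure_apply, ENNReal.tsum_prod',
      tsum_eq_single w]
    · simp [Set.indicator]
    · intro w' hw
      simp [Set.indicator, hw]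
  unfold g
  refine le_trans ?_ (le_iSup₂_of_le K ?_ (le_iSup_of_le ?_ le_rfl))
  · rw [mutualInfo_eq_mi, hK, mi_map]
    exact (mi_comp_injective Q Y (rvT ∘ W) he).ge
  · rw [mutualInfo_eq_mi, hK, mi_map]
    exact (mi_comp_injective Q Y (rvS ∘ W) he).le.trans hS
  · rw [mutualInfo_eq_mi, hK, mi_comm, mi_map]
    exact (mi_comp_injective Q Y (rvX ∘ W) he).le.trans ((mi_comm _ _ _).le.trans hX)

end

noncomputable section

variable {Ω α β γ δ ζ 𝒴 : Type*}

/-! ### A discrete functional representation -/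

/-- Geometric weights that can be partitioned so as to match any probability vector with `n + 1`
entries. -/
def geomWeight (n i : ℕ) : ℝ := (1 / (n + 1)) * (1 - 1 / (n + 1)) ^ i

theorem one_sub_inv_nonneg (n : ℕ) : (0 : ℝ) ≤ 1 - 1 / (n + 1) := by
  rw [sub_nonneg, div_le_one (by positivity)]
  linarith [(Nat.cast_nonneg n : (0 : ℝ) ≤ n)]

theorem geomWeight_nonneg (n i : ℕ) : 0 ≤ geomWeight n i :=
  mul_nonneg (by positivity) (pow_nonneg (one_sub_inv_nonneg n) i)

/-- Greedy: give weight i to the letter with the largest unfilled mass. The unfilled mass before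
step i is (1 - 1/(n+1))^i, so its largest entry is at least the average, which is exactly weight i.
No entry becomes negative, and the unfilled mass tends to 0. -/
theorem exists_assignment (n : ℕ) (p : Fin (n + 1) → ℝ) (hp : ∀ t, 0 ≤ p t) (h1 : ∑ t, p t = 1) :
    ∃ a : ℕ → Fin (n + 1), ∀ t, HasSum (fun i => if a i = t then geomWeight n i else 0) (p t) := by
  have hpick : ∀ r : Fin (n + 1) → ℝ, ∃ t, ∀ s, r s ≤ r t := fun r => Finite.exists_max r
  choose pick hpick using hpick
  let r : ℕ → Fin (n + 1) → ℝ := fun i => Nat.rec p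
    (fun i r t => r t - if pick r = t then geomWeight n i else 0) i
  have hr0 : r 0 = p := rfl
  have hrs : ∀ i t, r (i + 1) t = r i t - if pick (r i) = t then geomWeight n i else 0 :=
    fun i t => rfl
  have hsum : ∀ i, ∑ t, r i t = (1 - 1 / (n + 1) : ℝ) ^ i := by
    intro i
    induction i with
    | zero => simpa [hr0] using h1
    | succ i ih =>
      simp only [hrs, Finset.sum_sub_distrib, ih, Finset.sum_ite_eq, Finset.mem_univ, if_true]
      unfold geomWeight
      ring
  have hnn : ∀ i t, 0 ≤ r i t := by
    intro i
    induction i with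
    | zero => exact hp
    | succ i ih =>
      intro t
      rw [hrs]
      split_ifs with h
      · rw [sub_nonneg, ← h]
        have : ∑ t, r i t ≤ ∑ _t : Fin (n + 1), r i (pick (r i)) :=
          Finset.sum_le_sum fun t _ => hpick (r i) t
        rw [hsum, Finset.sum_const, Finset.card_univ, Fintype.card_fin, nsmul_eq_mul] at this
        unfold geomWeight
        rw [one_div_mul_eq_div, div_le_iff₀ (by positivity), mul_comm]
        exact_mod_cast this
      · simpa using ih t
  refine ⟨fun i => pick (r i), fun t => ?_⟩
  rw [hasSum_iff_tendsto_nat_of_nonneg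
    (fun i => by split_ifs; exacts [geomWeight_nonneg n i, le_rfl])]
  have hpart : ∀ i, ∑ j ∈ Finset.range i, (if pick (r j) = t then geomWeight n j else 0)
      = p t - r i t := by
    intro i
    induction i with
    | zero => simp [hr0]
    | succ i ih =>
      rw [Finset.sum_range_succ, ih, hrs]
      ring
  simp only [hpart]
  have hlim : Filter.Tendsto (fun i => r i t) Filter.atTop (nhds 0) := by
    refine squeeze_zero (fun i => hnn i t) (fun i => ?_)
      (tendsto_pow_atTop_nhds_zero_of_lt_one (one_sub_inv_nonneg n) (by
        rw [sub_lt_self_iff]; positivity))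
    rw [← hsum i]
    exact Finset.single_le_sum (fun s _ => hnn i s) (Finset.mem_univ t)
  simpa using hlim.const_sub (p t)

/-- Functional representation: a random variable `A` with finitely many values is a function of `Z`
and of a discrete random variable that is independent of `Z`. -/
theorem exists_functional_representation (P : PMF Ω) (Z : Ω → ζ) {n : ℕ} (A : Ω → Fin (n + 1)) :
    ∃ P' : PMF (Ω × ℕ), P'.map Prod.fst = P ∧ mi P' Prod.snd (Z ∘ Prod.fst) = 0 ∧
      condEntropy P' (fun v => A v.1) (fun v => (v.2, Z v.1)) = 0 ∧
      cmi P' Prod.snd Prod.fst (fun v => (Z v.1, A v.1)) = 0 := by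
  have hz : ∀ z, ∃ a : ℕ → Fin (n + 1), pr P {w | Z w = z} ≠ 0 →
      ∀ t, HasSum (fun i => if a i = t then geomWeight n i else 0)
        (pr P {w | Z w = z ∧ A w = t} / pr P {w | Z w = z}) := by
    intro z
    by_cases h0 : pr P {w | Z w = z} = 0
    · exact ⟨fun _ => 0, fun h => absurd h0 h⟩
    · obtain ⟨a, ha⟩ := exists_assignment n
        (fun t => pr P {w | Z w = z ∧ A w = t} / pr P {w | Z w = z})
        (fun t => div_nonneg (pr_nonneg _ _) (pr_nonneg _ _)) (by
          rw [← Finset.sum_div, div_eq_one_iff_eq h0]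
          have := hasSum_pr P {w | Z w = z} A
          exact (hasSum_fintype _).unique this)
      exact ⟨a, fun _ => ha⟩
  choose a ha using hz
  -- Given z, index i has a weight free of z and forces the letter a z i: the first fact makes the
  -- index independent of Z, the second makes A a function of (i, z).
  let R : ζ → Fin (n + 1) → ℕ → ℝ≥0∞ := fun z t i =>
    if a z i = t then ENNReal.ofReal (geomWeight n i) else 0
  have hR : ∀ z t, P.toOuterMeasure {w | Z w = z} * ∑' y, R z t y
      = P.toOuterMeasure {w | Z w = z ∧ A w = t} := by
    intro z t
    by_cases h0 : pr P {w | Z w = z} = 0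
    · have h1 : pr P {w | Z w = z ∧ A w = t} = 0 := pr_eq_zero_of_subset P (fun w hw => hw.1) h0
      rw [← ofReal_pr, ← ofReal_pr, h0, h1]
      simp
    · have hs := ha z h0 t
      have : ∀ i, R z t i = ENNReal.ofReal (if a z i = t then geomWeight n i else 0) := by
        intro i
        simp only [R]
        split_ifs <;> simp
      simp only [this]
      rw [← ENNReal.ofReal_tsum_of_nonneg
        (fun i => by split_ifs; exacts [geomWeight_nonneg n i, le_rfl]) hs.summable, hs.tsum_eq,
        ← ofReal_pr, ← ofReal_pr, ← ENNReal.ofReal_mul (pr_nonneg _ _), mul_div_cancel₀ _ h0]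
  obtain ⟨P', h1, h2, h3⟩ := exists_coupling P Z A R hR
  obtain ⟨h4, h5⟩ := mi_eq_zero_of_coupling h2 (ρ := fun i => ENNReal.ofReal (geomWeight n i))
    (fun z y _ => by
      simp only [R, tsum_fintype, Finset.sum_ite_eq, Finset.mem_univ, if_true])
  refine ⟨P', h1, h5, condEntropy_eq_zero ?_, h3⟩
  rintro t ⟨i, z⟩
  have e1 : {v : Ω × ℕ | A v.1 = t ∧ (v.2, Z v.1) = (i, z)}
      = {v | (Z v.1 = z ∧ A v.1 = t) ∧ v.2 = i} := by
    ext v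
    simp only [Set.mem_ofPred_eq, Prod.mk.injEq]
    tauto
  have e2 : {v : Ω × ℕ | (v.2, Z v.1) = (i, z)} = {v | Z v.1 = z ∧ v.2 = i} := by
    ext v
    simp only [Set.mem_ofPred_eq, Prod.mk.injEq]
    tauto
  rw [e1, e2, pr, pr, h2, h4]
  by_cases h : a z i = t
  · right
    simp [R, h]
  · left
    simp [R, h]

/-! ### The lower bound from functional representations -/

variable {S X T : Type*}

/-- Two functional representations in succession, for the quantized X' = q(X) and T' = τ(T), with Y
= (V,U). Expanding I(Y;T,(X,S)) in both orders gives H(X'|S) + H(T'|X,S) ≤ I(Y;T) + H(X,S|T), and Y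
is admissible at rate H(X'|S). -/
theorem frl_bound [Countable S] [Countable X] [Countable T] (P : PMF (S × X × T)) {m n : ℕ}
    (q : X → Fin (m + 1)) (τ : T → Fin (n + 1)) :
    condEntropy P (fun w => τ (rvT w)) rvXS + condEntropy P (fun w => q (rvX w)) rvS
      ≤ g 0 (condEntropy P (fun w => q (rvX w)) rvS) P + condEntropy P rvXS rvT := by
  obtain ⟨P₁, hP₁, hVS, hXV, hVW⟩ :=
    exists_functional_representation P rvS (fun w => q (rvX w))
  obtain ⟨P₂, hP₂, hU, hT, -⟩ := exists_functional_representation P₁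
    (fun v => (rvXS v.1, v.2)) (fun v => τ (rvT v.1))
  have hW : P₂.map (Prod.fst ∘ Prod.fst) = P := by rw [← PMF.map_comp, hP₂, hP₁]
  rw [← hP₂, mi_map] at hVS
  rw [← hP₂, condEntropy_map] at hXV
  rw [← hP₂, cmi_map] at hVW
  have c1 : condEntropy P (fun w => τ (rvT w)) rvXS
      = condEntropy P₂ (fun v => τ (rvT v.1.1)) (fun v => rvXS v.1.1) := by
    conv_lhs => rw [← hW]
    rw [condEntropy_map]
    rfl
  have c2 : condEntropy P (fun w => q (rvX w)) rvS
      = condEntropy P₂ (fun v => q (rvX v.1.1)) (fun v => rvS v.1.1) := by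
    conv_lhs => rw [← hW]
    rw [condEntropy_map]
    rfl
  have c3 : condEntropy P rvXS rvT
      = condEntropy P₂ (fun v => rvXS v.1.1) (fun v => rvT v.1.1) := by
    conv_lhs => rw [← hW]
    rw [condEntropy_map]
    rfl
  let V : ((S × X × T) × ℕ) × ℕ → ℕ := fun v => v.1.2
  let U : ((S × X × T) × ℕ) × ℕ → ℕ := fun v => v.2
  let s : ((S × X × T) × ℕ) × ℕ → S := fun v => rvS v.1.1
  let x : ((S × X × T) × ℕ) × ℕ → X := fun v => rvX v.1.1
  let t : ((S × X × T) × ℕ) × ℕ → T := fun v => rvT v.1.1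
  let xs : ((S × X × T) × ℕ) × ℕ → X × S := fun v => rvXS v.1.1
  let x' : ((S × X × T) × ℕ) × ℕ → Fin (m + 1) := fun v => q (rvX v.1.1)
  let t' : ((S × X × T) × ℕ) × ℕ → Fin (n + 1) := fun v => τ (rvT v.1.1)
  let Y : ((S × X × T) × ℕ) × ℕ → ℕ × ℕ := fun v => (V v, U v)
  change mi P₂ V s = 0 at hVS
  change condEntropy P₂ x' (fun v => (V v, s v)) = 0 at hXV
  change cmi P₂ V (fun v => v.1.1) (fun v => (s v, x' v)) = 0 at hVW
  change mi P₂ U (fun v => (xs v, V v)) = 0 at hU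
  change condEntropy P₂ t' (fun v => (U v, (xs v, V v))) = 0 at hT
  have hUxs : cmi P₂ U xs V = 0 := by
    rw [mi_chain'] at hU
    exact (add_eq_zero.1 hU).2
  have hYxs : mi P₂ xs Y = condEntropy P₂ x' s := by
    have a1 : mi P₂ xs Y = mi P₂ xs V := by
      change mi P₂ xs (fun v => (V v, U v)) = _
      rw [mi_chain, cmi_comm P₂ xs U V, hUxs, add_zero]
    have a2 : mi P₂ V xs = cmi P₂ V x s := by
      change mi P₂ V (fun v => (x v, s v)) = _
      rw [mi_chain', hVS, zero_add]
    -- V is conditionally independent of the original triple given (S,X'), so it reveals no more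
    -- about X than about X'; without this the rate could exceed H(X'|S).
    have a3 : cmi P₂ V x s = cmi P₂ V x' s := by
      refine le_antisymm ?_ (cmi_comp_right_le P₂ V s q fun _ => rfl)
      refine (cmi_comp_right_le P₂ V (B' := fun v => (x' v, x v)) s Prod.snd fun _ => rfl).trans ?_
      rw [cmi_chain, cmi_cond_swap]
      have : cmi P₂ V x (fun v => (s v, x' v)) = 0 :=
        le_antisymm (hVW ▸ cmi_comp_right_le P₂ V _ rvX fun _ => rfl) zero_le
      rw [this, add_zero]
    rw [a1, mi_comm, a2, a3, condEntropy_eq_add P₂ x' V s, hXV, add_zero, cmi_comm]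
  have hYs : mi P₂ Y s = 0 := by
    rw [mi_comm]
    change mi P₂ s (fun v => (V v, U v)) = _
    rw [mi_chain, mi_comm, hVS, zero_add, cmi_comm]
    exact le_antisymm (hUxs ▸ cmi_comp_right_le P₂ U V Prod.snd fun _ => rfl) zero_le
  have hYx : mi P₂ x Y ≤ condEntropy P₂ x' s := by
    rw [← hYxs]
    exact mi_comp_left_le P₂ Y Prod.fst fun _ => rfl
  have hg : mi P₂ Y t ≤ g 0 (condEntropy P₂ x' s) P := mi_le_g hW hYs.le hYx
  have hTY : condEntropy P₂ t' (fun v => (Y v, xs v)) = 0 := by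
    rw [← hT]
    exact condEntropy_cond_equiv P₂ t' (fun v => (U v, (xs v, V v)))
      ⟨fun p => ((p.2.2, p.1), p.2.1), fun p => (p.1.2, (p.2, p.1.1)), fun _ => rfl, fun _ => rfl⟩
  have hT' : condEntropy P₂ t' xs ≤ cmi P₂ Y t xs := by
    rw [condEntropy_eq_add P₂ t' Y xs, hTY, add_zero, cmi_comm]
    exact cmi_comp_right_le P₂ Y xs τ fun _ => rfl
  have hfin : mi P₂ Y xs + cmi P₂ Y t xs = mi P₂ Y t + cmi P₂ Y xs t := by
    rw [← mi_chain' P₂ Y t xs, ← mi_chain P₂ Y t xs]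
  rw [c1, c2, c3, add_comm (condEntropy P₂ _ _)]
  calc condEntropy P₂ x' s + condEntropy P₂ t' xs ≤ mi P₂ Y xs + cmi P₂ Y t xs := by
        rw [mi_comm, hYxs]
        gcongr
    _ = mi P₂ Y t + cmi P₂ Y xs t := hfin
    _ ≤ g 0 (condEntropy P₂ x' s) P + condEntropy P₂ xs t := by
        refine add_le_add hg ?_
        rw [cmi_comm]
        exact cmi_le_condEntropy _ _ _ _

/-! ### Truncation of countable alphabets -/

/-- The injection of a countable alphabet into `ℕ`, truncated at `n`. -/
def quant [Countable α] (n : ℕ) (a : α) : Fin (n + 1) :=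
  ⟨min ((exists_injective_nat α).choose a) n, Nat.lt_succ_of_le (min_le_right _ _)⟩

/-- A finite partial sum of the entropy involves finitely many letters, and a late enough truncation
leaves each of these alone in its class, so the same terms reappear. -/
theorem condEntropy_le_iSup_quant [Countable α] (P : PMF Ω) (A : Ω → α) (C : Ω → γ) :
    condEntropy P A C ≤ ⨆ n, condEntropy P (fun w => quant n (A w)) C := by
  classical
  have he := (exists_injective_nat α).choose_spec
  set e := (exists_injective_nat α).choose with hedef
  have heq : ∀ {κ : Type _} (B : Ω → κ), condEntropy P B C = ∑' x : γ × κ,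
      ENNReal.ofReal (pr P {w | B w = x.2 ∧ C w = x.1} *
      Real.log (pr P {w | C w = x.1} / pr P {w | B w = x.2 ∧ C w = x.1}) / Real.log 2) := by
    intro κ B
    rw [condEntropy_eq, ENNReal.tsum_prod']
  have hq : ∀ n a b, e a < n → (quant n b = quant n a ↔ b = a) := by
    intro n a b h
    simp only [quant, Fin.mk.injEq, ← hedef]
    constructor
    · intro h'
      apply he
      rw [min_eq_left h.le] at h'
      rcases min_choice (e b) n with hm | hm <;> omega
    · rintro rfl
      rfl
  rw [heq, ENNReal.tsum_eq_iSup_sum]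
  refine iSup_le fun F => ?_
  -- The `+ 1` keeps the letters of F strictly below n, since the class n collects every letter with
  -- index at least n.
  let n := F.sup (fun x => e x.2) + 1
  have hn : ∀ x ∈ F, e x.2 < n := fun x hx =>
    Nat.lt_succ_of_le (Finset.le_sup (f := fun x : γ × α => e x.2) hx)
  refine le_iSup_of_le n ?_
  rw [condEntropy_eq, ← ENNReal.tsum_prod (f := fun c a => ENNReal.ofReal
    (pr P {w | quant n (A w) = a ∧ C w = c} * Real.log (pr P {w | C w = c} /
      pr P {w | quant n (A w) = a ∧ C w = c}) / Real.log 2))]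
  have hinj : Set.InjOn (fun x : γ × α => (x.1, quant n x.2)) F := by
    intro x hx y hy h
    simp only [Prod.mk.injEq] at h
    exact Prod.ext h.1 ((hq n y.2 x.2 (hn y hy)).1 h.2)
  refine le_trans ?_ (ENNReal.sum_le_tsum (F.image fun x : γ × α => (x.1, quant n x.2)))
  rw [Finset.sum_image hinj]
  refine le_of_eq (Finset.sum_congr rfl fun x hx => ?_)
  simp only [hq n _ _ (hn x hx)]

/-! ### Time sharing -/

theorem tsum_sum_type (f : α ⊕ β → ℝ≥0∞) :
    ∑' x, f x = ∑' a, f (Sum.inl a) + ∑' b, f (Sum.inr b) :=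
  Summable.tsum_sum ENNReal.summable ENNReal.summable

theorem pr_empty (P : PMF Ω) : pr P ∅ = 0 := by simp [pr]

/-- The law that follows `M₁` with probability `a` and `M₀` with probability `1 - a`, the second
coordinate telling which. -/
def mixture (a : ℝ≥0∞) (ha : a ≤ 1) (M₀ M₁ : PMF (Ω × 𝒴)) : PMF (Ω × (𝒴 ⊕ 𝒴)) :=
  (PMF.ofFintype (fun b : Bool => cond b a (1 - a)) (by simp [ha])).bind fun b =>
    cond b (M₁.map (Prod.map id Sum.inr)) (M₀.map (Prod.map id Sum.inl))

theorem pr_mixture {a : ℝ≥0∞} (ha : a ≤ 1) (M₀ M₁ : PMF (Ω × 𝒴)) (E : Set (Ω × (𝒴 ⊕ 𝒴))) :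
    pr (mixture a ha M₀ M₁) E = (1 - a).toReal * pr M₀ (Prod.map id Sum.inl ⁻¹' E)
      + a.toReal * pr M₁ (Prod.map id Sum.inr ⁻¹' E) := by
  have hat : a ≠ ⊤ := ne_top_of_le_ne_top ENNReal.one_ne_top ha
  unfold pr mixture
  rw [PMF.toOuterMeasure_bind_apply, tsum_fintype, Fintype.sum_bool]
  simp only [PMF.ofFintype_apply, cond_true, cond_false, PMF.toOuterMeasure_map_apply]
  rw [ENNReal.toReal_add (ENNReal.mul_ne_top hat (outer_ne_top _ _))
    (ENNReal.mul_ne_top (ENNReal.sub_ne_top ENNReal.one_ne_top) (outer_ne_top _ _)),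
    ENNReal.toReal_mul, ENNReal.toReal_mul, add_comm]

theorem pr_mixture_fst {a : ℝ≥0∞} (ha : a ≤ 1) {M₀ M₁ : PMF (Ω × 𝒴)} {P : PMF Ω}
    (h₀ : M₀.map Prod.fst = P) (h₁ : M₁.map Prod.fst = P) (E : Set Ω) :
    pr (mixture a ha M₀ M₁) (Prod.fst ⁻¹' E) = pr P E := by
  have hat : a ≠ ⊤ := ne_top_of_le_ne_top ENNReal.one_ne_top ha
  have e₀ : pr M₀ (Prod.fst ⁻¹' E) = pr P E := by rw [← pr_map, h₀]
  have e₁ : pr M₁ (Prod.fst ⁻¹' E) = pr P E := by rw [← pr_map, h₁]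
  rw [pr_mixture]
  change _ * pr M₀ (Prod.fst ⁻¹' E) + _ * pr M₁ (Prod.fst ⁻¹' E) = _
  rw [e₀, e₁, ENNReal.toReal_sub_of_le ha ENNReal.one_ne_top, ENNReal.toReal_one]
  ring

/-- The two alphabets are disjoint, so every cell of the mixture is a cell of one component scaled
by its weight. The marginal on Ω is the same in both, so both arguments of `divTerm` scale, and it
is homogeneous. -/
theorem mi_mixture {a : ℝ≥0∞} (ha : a ≤ 1) {M₀ M₁ : PMF (Ω × 𝒴)} {P : PMF Ω}
    (h₀ : M₀.map Prod.fst = P) (h₁ : M₁.map Prod.fst = P) (B : Ω → β) :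
    mi (mixture a ha M₀ M₁) Prod.snd (B ∘ Prod.fst)
      = (1 - a) * mi M₀ Prod.snd (B ∘ Prod.fst) + a * mi M₁ Prod.snd (B ∘ Prod.fst) := by
  have hat : a ≠ ⊤ := ne_top_of_le_ne_top ENNReal.one_ne_top ha
  have hat' : 1 - a ≠ ⊤ := ENNReal.sub_ne_top ENNReal.one_ne_top
  have e₀ : ∀ E : Set Ω, pr M₀ (Prod.fst ⁻¹' E) = pr P E := fun E => by rw [← pr_map, h₀]
  have e₁ : ∀ E : Set Ω, pr M₁ (Prod.fst ⁻¹' E) = pr P E := fun E => by rw [← pr_map, h₁]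
  have e : ∀ E : Set Ω, pr (mixture a ha M₀ M₁) (Prod.fst ⁻¹' E) = pr P E :=
    pr_mixture_fst ha h₀ h₁
  rw [mi_eq_tsum, mi_eq_tsum, mi_eq_tsum, tsum_sum_type, ← ENNReal.tsum_mul_left,
    ← ENNReal.tsum_mul_left]
  congr 1
  · refine tsum_congr fun y => ?_
    rw [← ENNReal.tsum_mul_left]
    refine tsum_congr fun b => ?_
    change ENNReal.ofReal (divTerm _ (_ * pr _ (Prod.fst ⁻¹' {w | B w = b})))
      = _ * ENNReal.ofReal (divTerm _ (_ * pr _ (Prod.fst ⁻¹' {w | B w = b})))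
    rw [e, e₀, pr_mixture, pr_mixture]
    simp only [Set.preimage_ofPred_eq, Prod.map_snd, Prod.map_fst, Function.comp_apply, id_eq,
      Sum.inl.injEq, reduceCtorEq, false_and, Set.ofPred_false, pr_empty, mul_zero,
      add_zero, mul_assoc]
    rw [divTerm_mul, ENNReal.ofReal_mul ENNReal.toReal_nonneg, ENNReal.ofReal_toReal hat']
  · refine tsum_congr fun y => ?_
    rw [← ENNReal.tsum_mul_left]
    refine tsum_congr fun b => ?_
    change ENNReal.ofReal (divTerm _ (_ * pr _ (Prod.fst ⁻¹' {w | B w = b})))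
      = _ * ENNReal.ofReal (divTerm _ (_ * pr _ (Prod.fst ⁻¹' {w | B w = b})))
    rw [e, e₁, pr_mixture, pr_mixture]
    simp only [Set.preimage_ofPred_eq, Prod.map_snd, Prod.map_fst, Function.comp_apply, id_eq,
      Sum.inr.injEq, reduceCtorEq, false_and, Set.ofPred_false, pr_empty, mul_zero,
      zero_add, mul_assoc]
    rw [divTerm_mul, ENNReal.ofReal_mul ENNReal.toReal_nonneg, ENNReal.ofReal_toReal hat]

theorem mi_const (P : PMF Ω) (a : α) (B : Ω → β) : mi P (fun _ => a) B = 0 := by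
  refine le_antisymm (le_trans (cmi_le_condEntropy _ _ _ _) ?_) zero_le
  exact (condEntropy_comp_zero P _ _ (fun _ => a) fun _ => rfl).le

/-- Flip an independent coin to choose between two representations and reveal the outcome in Y; by
`mi_mixture` the objective and both constraints are affine in the coin's bias. -/
theorem g_timeSharing [Countable S] [Countable X] [Countable T] (P : PMF (S × X × T))
    {a : ℝ≥0∞} (ha : a ≤ 1) (r₀ r₁ : ℝ≥0∞) :
    (1 - a) * g 0 r₀ P + a * g 0 r₁ P ≤ g 0 ((1 - a) * r₀ + a * r₁) P := by
  have hex : ∀ r : ℝ≥0∞, g 0 r P = ⨆ K : {K : S × X × T → PMF ℕ //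
      mi (jointLaw P K) Prod.snd (rvS ∘ Prod.fst) ≤ 0 ∧
      mi (jointLaw P K) (rvX ∘ Prod.fst) Prod.snd ≤ r},
      mi (jointLaw P K.1) Prod.snd (rvT ∘ Prod.fst) := by
    intro r
    unfold g
    simp only [mutualInfo_eq_mi, iSup_subtype, iSup_and]
  -- A constant Y is always admissible; a nonempty index set is needed to combine the two suprema.
  have hne : ∀ r : ℝ≥0∞, Nonempty {K : S × X × T → PMF ℕ //
      mi (jointLaw P K) Prod.snd (rvS ∘ Prod.fst) ≤ 0 ∧
      mi (jointLaw P K) (rvX ∘ Prod.fst) Prod.snd ≤ r} := by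
    intro r
    have hj : jointLaw P (fun _ => PMF.pure 0) = P.map fun w => (w, 0) := by
      unfold jointLaw
      simp only [PMF.pure_map]
      rfl
    refine ⟨fun _ => PMF.pure 0, ?_, ?_⟩
    · rw [hj, mi_map]
      exact (mi_const P (0 : ℕ) rvS).le
    · rw [hj, mi_comm, mi_map]
      exact (mi_const P (0 : ℕ) rvX).le.trans zero_le
  have := hne r₀
  have := hne r₁
  rw [hex r₀, hex r₁, ENNReal.mul_iSup, ENNReal.mul_iSup]
  refine ENNReal.iSup_add_iSup_le ?_
  rintro ⟨K₀, hS₀, hX₀⟩ ⟨K₁, hS₁, hX₁⟩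
  have h₀ : (jointLaw P K₀).map Prod.fst = P := map_fst_bind P K₀
  have h₁ : (jointLaw P K₁).map Prod.fst = P := map_fst_bind P K₁
  have hm : (mixture a ha (jointLaw P K₀) (jointLaw P K₁)).map Prod.fst = P := by
    refine PMF.toOuterMeasure_injective (MeasureTheory.OuterMeasure.ext fun E => ?_)
    rw [← ofReal_pr, ← ofReal_pr, pr_map, pr_mixture_fst ha h₀ h₁]
  rw [← mi_mixture ha h₀ h₁ rvT]
  refine mi_le_g hm ?_ ?_
  · rw [mi_mixture ha h₀ h₁, nonpos_iff_eq_zero.1 hS₀, nonpos_iff_eq_zero.1 hS₁]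
    simp
  · rw [mi_comm, mi_mixture ha h₀ h₁, mi_comm, mi_comm _ _ (rvX ∘ Prod.fst)]
    gcongr

end

noncomputable section

/-! ### Exponential races -/

open MeasureTheory

/-- The standard exponential distribution. -/
def expLaw : Measure ℝ :=
  (volume.restrict (Set.Ioi 0)).withDensity fun x => ENNReal.ofReal (Real.exp (-x))

theorem measurable_expDensity : Measurable fun x : ℝ => ENNReal.ofReal (Real.exp (-x)) := by
  fun_prop

theorem expLaw_Ioi {x : ℝ} (hx : 0 ≤ x) :
    expLaw (Set.Ioi x) = ENNReal.ofReal (Real.exp (-x)) := by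
  rw [expLaw, withDensity_apply _ measurableSet_Ioi, Measure.restrict_restrict measurableSet_Ioi,
    Set.inter_eq_left.2 (Set.Ioi_subset_Ioi hx),
    ← ofReal_integral_eq_lintegral_ofReal (integrableOn_exp_neg_Ioi x)
      (Filter.Eventually.of_forall fun _ => (Real.exp_pos _).le), integral_exp_neg_Ioi]

theorem lintegral_expLaw {F : ℝ → ℝ≥0∞} (hF : Measurable F) :
    ∫⁻ x, F x ∂expLaw = ∫⁻ x in Set.Ioi 0, ENNReal.ofReal (Real.exp (-x)) * F x := by
  rw [expLaw, lintegral_withDensity_eq_lintegral_mul _ measurable_expDensity hF]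
  rfl

theorem ae_expLaw_pos : ∀ᵐ x ∂expLaw, 0 < x :=
  (withDensity_absolutelyContinuous _ _).ae_le (ae_restrict_mem measurableSet_Ioi)

instance : IsProbabilityMeasure expLaw := by
  refine ⟨?_⟩
  rw [← measure_inter_add_sdiff Set.univ (measurableSet_Ioi : MeasurableSet (Set.Ioi (0 : ℝ))),
    Set.univ_inter, expLaw_Ioi le_rfl]
  have : expLaw (Set.univ \ Set.Ioi 0) = 0 := by
    have := ae_iff.1 ae_expLaw_pos
    convert this using 2
    ext x
    simp
  simp [this]

theorem expLaw_le_volume : expLaw ≤ volume := by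
  refine Measure.le_iff.2 fun s hs => ?_
  rw [expLaw, withDensity_apply _ hs, Measure.restrict_restrict hs]
  calc ∫⁻ x in s ∩ Set.Ioi 0, ENNReal.ofReal (Real.exp (-x))
      ≤ ∫⁻ x in s ∩ Set.Ioi 0, 1 := by
        refine setLIntegral_mono' (hs.inter measurableSet_Ioi) fun x hx => ?_
        rw [← ENNReal.ofReal_one]
        refine ENNReal.ofReal_le_ofReal (Real.exp_le_one_iff.2 ?_)
        have : (0 : ℝ) < x := hx.2
        linarith
    _ ≤ volume s := by
        rw [setLIntegral_one]
        exact measure_mono Set.inter_subset_left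

/-- The exponentials combine to exp(-x/p), and the substitution x ↦ p x follows. The extra factor is
the probability that all competitors of a racer of speed p, total speed 1, are still running when
its clock shows x. -/
theorem lintegral_expLaw_scale {F : ℝ → ℝ≥0∞} (hF : Measurable F) {p : ℝ} (hp : 0 < p) :
    ∫⁻ x, F x * ENNReal.ofReal (Real.exp (-(x * (1 - p) / p))) ∂expLaw
      = ENNReal.ofReal p * ∫⁻ x, F (p * x) ∂expLaw := by
  have hm : Measurable fun x : ℝ => ENNReal.ofReal (Real.exp (-(x * (1 - p) / p))) := by fun_prop
  rw [lintegral_expLaw (F := fun x => F x * _) (hF.mul hm),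
    lintegral_expLaw (F := fun x => F (p * x)) (hF.comp (measurable_const_mul p))]
  rw [← lintegral_indicator measurableSet_Ioi, ← lintegral_indicator measurableSet_Ioi]
  have hvol : (volume : Measure ℝ) = ENNReal.ofReal p • Measure.map (p * ·) volume := by
    have := Real.smul_map_volume_mul_left hp.ne'
    rw [abs_of_pos hp] at this
    exact this.symm
  conv_lhs => rw [hvol]
  have hm' : Measurable ((Set.Ioi 0).indicator fun x => ENNReal.ofReal (Real.exp (-x)) *
      (F x * ENNReal.ofReal (Real.exp (-(x * (1 - p) / p))))) :=
    (measurable_expDensity.mul (hF.mul hm)).indicator measurableSet_Ioi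
  rw [lintegral_smul_measure, smul_eq_mul, lintegral_map hm' (measurable_const_mul p)]
  congr 1
  refine lintegral_congr fun x => ?_
  by_cases hx : 0 < x
  · rw [Set.indicator_of_mem (show p * x ∈ Set.Ioi 0 from mul_pos hp hx),
      Set.indicator_of_mem (show x ∈ Set.Ioi 0 from hx), mul_left_comm, mul_comm,
      ← ENNReal.ofReal_mul (Real.exp_pos _).le, ← Real.exp_add]
    congr 3
    field_simp
    ring
  · rw [Set.indicator_of_notMem
        (show p * x ∉ Set.Ioi 0 from fun h => hx (pos_of_mul_pos_right (Set.mem_Ioi.1 h) hp.le)),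
      Set.indicator_of_notMem (show x ∉ Set.Ioi 0 from hx)]

variable {n : ℕ}

/-- The law of independent standard exponential clocks. -/
def clocks (n : ℕ) : Measure (Fin (n + 1) → ℝ) := Measure.pi fun _ => expLaw

instance : IsProbabilityMeasure (clocks n) := by
  unfold clocks
  infer_instance

/-- The event that the clock `a` rings first when clock `b` runs at speed `p b`. -/
def race (p : Fin (n + 1) → ℝ) (a : Fin (n + 1)) : Set (Fin (n + 1) → ℝ) :=
  {u | ∀ b, b ≠ a → u a * p b < u b * p a}

theorem measurableSet_race (p : Fin (n + 1) → ℝ) (a : Fin (n + 1)) :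
    MeasurableSet (race p a) := by
  unfold race
  have : {u : Fin (n + 1) → ℝ | ∀ b, b ≠ a → u a * p b < u b * p a}
      = ⋂ b, ⋂ (_ : b ≠ a), {u | u a * p b < u b * p a} := by
    ext u
    simp
  rw [this]
  refine MeasurableSet.iInter fun b => MeasurableSet.iInter fun _ => ?_
  exact measurableSet_lt (by fun_prop) (by fun_prop)

theorem disjoint_race (p : Fin (n + 1) → ℝ) {a b : Fin (n + 1)} (h : a ≠ b) :
    Disjoint (race p a) (race p b) := by
  rw [Set.disjoint_left]
  intro u ha hb
  exact lt_asymm (ha b h.symm) (hb a h)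

/-- Condition on clock a showing e. The others lose independently, with probabilities exp(-e
p_b/p_a) whose product is exp(-e(1 - p_a)/p_a), and rescaling does the rest. Thus a wins with
probability p_a, and its winning time u_a/p_a is then standard exponential. -/
theorem lintegral_race {p : Fin (n + 1) → ℝ} (hp : ∀ b, 0 ≤ p b) (h1 : ∑ b, p b = 1)
    {a : Fin (n + 1)} (ha : 0 < p a) {F : ℝ → ℝ≥0∞} (hF : Measurable F) :
    ∫⁻ u in race p a, F (u a) ∂clocks n = ENNReal.ofReal (p a) * ∫⁻ x, F (p a * x) ∂expLaw := by
  have hD : MeasurableSet {x : ℝ × (Fin n → ℝ) | ∀ j, x.1 * p (a.succAbove j) < x.2 j * p a} := by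
    have : {x : ℝ × (Fin n → ℝ) | ∀ j, x.1 * p (a.succAbove j) < x.2 j * p a}
        = ⋂ j, {x | x.1 * p (a.succAbove j) < x.2 j * p a} := by
      ext x
      simp
    rw [this]
    exact MeasurableSet.iInter fun j => measurableSet_lt (by fun_prop) (by fun_prop)
  set D := {x : ℝ × (Fin n → ℝ) | ∀ j, x.1 * p (a.succAbove j) < x.2 j * p a} with hDdef
  have hmeas : Measurable (D.indicator fun x => F x.1) := (hF.comp measurable_fst).indicator hD
  have hmp := measurePreserving_piFinSuccAbove (fun _ : Fin (n + 1) => expLaw) a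
  rw [← lintegral_indicator (measurableSet_race p a), clocks]
  have heq : ∀ u : Fin (n + 1) → ℝ, (race p a).indicator (fun u => F (u a)) u
      = D.indicator (fun x => F x.1) (MeasurableEquiv.piFinSuccAbove (fun _ => ℝ) a u) := by
    intro u
    have hiff : u ∈ race p a ↔ MeasurableEquiv.piFinSuccAbove (fun _ => ℝ) a u ∈ D := by
      change (∀ b, b ≠ a → u a * p b < u b * p a) ↔
        ∀ j, u a * p (a.succAbove j) < u (a.succAbove j) * p a
      rw [Fin.forall_iff_succAbove a]
      simp [Fin.succAbove_ne]
    by_cases h : u ∈ race p a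
    · rw [Set.indicator_of_mem h, Set.indicator_of_mem (hiff.1 h)]
      rfl
    · rw [Set.indicator_of_notMem h, Set.indicator_of_notMem (fun h' => h (hiff.2 h'))]
  rw [lintegral_congr heq, hmp.lintegral_comp hmeas, lintegral_prod _ hmeas.aemeasurable,
    ← lintegral_expLaw_scale hF ha]
  refine lintegral_congr_ae (ae_expLaw_pos.mono fun e he => ?_)
  have hsec : ∀ v, D.indicator (fun x => F x.1) (e, v)
      = (Set.univ.pi fun j => Set.Ioi (e * p (a.succAbove j) / p a)).indicator (fun _ => F e) v := by
    intro v
    have hiff : (e, v) ∈ D ↔ v ∈ Set.univ.pi fun j => Set.Ioi (e * p (a.succAbove j) / p a) := by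
      simp only [hDdef, Set.mem_ofPred_eq, Set.mem_univ_pi, Set.mem_Ioi, div_lt_iff₀ ha]
    by_cases h : (e, v) ∈ D
    · rw [Set.indicator_of_mem h, Set.indicator_of_mem (hiff.1 h)]
    · rw [Set.indicator_of_notMem h, Set.indicator_of_notMem (fun h' => h (hiff.2 h'))]
  simp only [hsec]
  rw [lintegral_indicator_const (MeasurableSet.univ_pi fun _ => measurableSet_Ioi), Measure.pi_pi]
  congr 1
  have : ∀ j, expLaw (Set.Ioi (e * p (a.succAbove j) / p a))
      = ENNReal.ofReal (Real.exp (-(e * p (a.succAbove j) / p a))) := fun j =>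
    expLaw_Ioi (div_nonneg (mul_nonneg he.le (hp _)) ha.le)
  simp only [this]
  rw [← ENNReal.ofReal_prod_of_nonneg fun _ _ => (Real.exp_pos _).le, ← Real.exp_sum]
  congr 2
  rw [Finset.sum_neg_distrib, ← Finset.sum_div, ← Finset.mul_sum]
  rw [Fin.sum_univ_succAbove _ a] at h1
  rw [← h1]
  ring

theorem clocks_race {p : Fin (n + 1) → ℝ} (hp : ∀ b, 0 ≤ p b) (h1 : ∑ b, p b = 1)
    (a : Fin (n + 1)) : clocks n (race p a) = ENNReal.ofReal (p a) := by
  rcases (hp a).eq_or_lt with h0 | h0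
  · rw [← h0, ENNReal.ofReal_zero]
    -- A letter of speed 0 could only beat b if u_a p_b < 0, which has probability 0.
    obtain ⟨b, hb⟩ : ∃ b, 0 < p b := by
      by_contra! h
      have := Finset.sum_nonpos fun b (_ : b ∈ Finset.univ) => h b
      rw [h1] at this
      linarith
    have hba : b ≠ a := by
      rintro rfl
      exact hb.ne h0
    have hae : ∀ᵐ u ∂clocks n, 0 < u a :=
      (Measure.quasiMeasurePreserving_eval (μ := fun _ : Fin (n + 1) => expLaw) a).ae ae_expLaw_pos
    refine measure_mono_null ?_ (ae_iff.1 hae)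
    intro u hu hpos
    have := hu b hba
    rw [← h0, mul_zero] at this
    exact absurd this (mul_pos hpos hb).le.not_gt
  · have := lintegral_race hp h1 h0 (F := fun _ => 1) measurable_const
    simpa using this

/-- The winning events are disjoint and their probabilities add up to 1, so almost surely there is a
winner. -/
theorem sum_clocks_race_inter {p : Fin (n + 1) → ℝ} (hp : ∀ b, 0 ≤ p b) (h1 : ∑ b, p b = 1)
    {E : Set (Fin (n + 1) → ℝ)} (hE : MeasurableSet E) :
    ∑ a, clocks n (race p a ∩ E) = clocks n E := by
  have hdis : Pairwise (Function.onFun Disjoint fun a => race p a ∩ E) := fun a b h =>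
    (disjoint_race p h).mono Set.inter_subset_left Set.inter_subset_left
  have hU : clocks n (⋃ a, race p a) = 1 := by
    rw [measure_iUnion (fun a b h => disjoint_race p h) (measurableSet_race p), tsum_fintype]
    simp only [clocks_race hp h1]
    rw [← ENNReal.ofReal_sum_of_nonneg fun b _ => hp b, h1, ENNReal.ofReal_one]
  have hcompl : clocks n (⋃ a, race p a)ᶜ = 0 :=
    (prob_compl_eq_zero_iff (MeasurableSet.iUnion (measurableSet_race p))).2 hU
  calc ∑ a, clocks n (race p a ∩ E) = clocks n (⋃ a, race p a ∩ E) := by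
        rw [measure_iUnion hdis fun a => (measurableSet_race p a).inter hE, tsum_fintype]
    _ = clocks n (E ∩ ⋃ a, race p a) := by rw [← Set.iUnion_inter, Set.inter_comm]
    _ = clocks n E := measure_inter_conull hcompl

/-- Completing the square: c(√x + 1/(c√x))² = cx + 2 + 1/(cx) ≥ ⌊cx⌋ + 2. Taking logarithms and
using log y ≤ y - 1 leaves powers x^(±1/2), whose exponential means are values of Γ. -/
theorem log_floor_le {c x : ℝ} (hc : 0 < c) (hx : 0 < x) :
    Real.log (⌊c * x⌋₊ + 2) ≤
      Real.log c + 2 * (x ^ (1 / 2 : ℝ) + x ^ (-(1 / 2) : ℝ) / c - 1) := by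
  have hs : 0 < √x := Real.sqrt_pos.2 hx
  rw [Real.rpow_neg hx.le, ← Real.sqrt_eq_rpow]
  have h1 : (⌊c * x⌋₊ : ℝ) + 2 ≤ c * (√x + (√x)⁻¹ / c) ^ 2 := by
    have hfl := Nat.floor_le (mul_pos hc hx).le
    have : c * (√x + (√x)⁻¹ / c) ^ 2 = c * (√x) ^ 2 + 2 + (√x)⁻¹ ^ 2 / c := by
      field_simp
      ring
    rw [this, Real.sq_sqrt hx.le]
    have : 0 ≤ (√x)⁻¹ ^ 2 / c := by positivity
    linarith
  have hy : 0 < √x + (√x)⁻¹ / c := by positivity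
  calc Real.log (⌊c * x⌋₊ + 2) ≤ Real.log (c * (√x + (√x)⁻¹ / c) ^ 2) :=
        Real.log_le_log (by positivity) h1
    _ = Real.log c + 2 * Real.log (√x + (√x)⁻¹ / c) := by
        rw [Real.log_mul hc.ne' (by positivity), Real.log_pow]
        norm_num
    _ ≤ _ := by
        have := Real.log_le_sub_one_of_pos hy
        linarith

/-- Integrate `log_floor_le`: the means of x^(1/2) and x^(-1/2) are Γ(3/2) = √π/2 and Γ(1/2) = √π.
-/
theorem lintegral_log_floor_expLaw_le {c : ℝ} (hc : 0 < c) :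
    ∫⁻ x, ENNReal.ofReal (Real.log (⌊c * x⌋₊ + 2)) ∂expLaw ≤ ENNReal.ofReal
      (Real.log c + √Real.pi + 2 * √Real.pi / c - 2) := by
  have g0 := Real.GammaIntegral_convergent (s := 1) one_pos
  have g1 := Real.GammaIntegral_convergent (s := 1 / 2) (by norm_num)
  have g3 := Real.GammaIntegral_convergent (s := 3 / 2) (by norm_num)
  have i0 := Real.Gamma_eq_integral (s := 1) one_pos
  have i1 := Real.Gamma_eq_integral (s := 1 / 2) (by norm_num)
  have i3 := Real.Gamma_eq_integral (s := 3 / 2) (by norm_num)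
  have v3 : Real.Gamma (3 / 2) = √Real.pi / 2 := by
    rw [show (3 / 2 : ℝ) = 1 / 2 + 1 by norm_num, Real.Gamma_add_one (by norm_num),
      Real.Gamma_one_half_eq]
    ring
  rw [Real.Gamma_one] at i0
  rw [Real.Gamma_one_half_eq] at i1
  rw [v3] at i3
  norm_num only at g0 g1 g3 i0 i1 i3
  have hint := ((g0.mul_const (Real.log c - 2)).add (g3.mul_const 2)).add (g1.mul_const (2 / c))
  have hval := integral_add ((g0.mul_const (Real.log c - 2)).add (g3.mul_const 2))
    (g1.mul_const (2 / c))
  rw [integral_add' (g0.mul_const (Real.log c - 2)) (g3.mul_const 2), integral_mul_const,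
    integral_mul_const, integral_mul_const, ← i0, ← i1, ← i3] at hval
  have hfun : ∀ x : ℝ, 0 < x → Real.exp (-x) * (Real.log c + 2 * (x ^ (1 / 2 : ℝ) +
      x ^ (-(1 / 2) : ℝ) / c - 1)) = Real.exp (-x) * x ^ (0 : ℝ) * (Real.log c - 2)
      + Real.exp (-x) * x ^ (1 / 2 : ℝ) * 2 + Real.exp (-x) * x ^ (-(1 / 2) : ℝ) * (2 / c) := by
    intro x _
    rw [Real.rpow_zero]
    ring
  have hmeas : Measurable fun x : ℝ => ENNReal.ofReal (Real.log (⌊c * x⌋₊ + 2)) := by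
    refine (Real.measurable_log.comp ?_).ennreal_ofReal
    exact (measurable_from_nat.comp (Nat.measurable_floor.comp (measurable_const_mul c))).add_const 2
  rw [lintegral_expLaw hmeas]
  calc _ ≤ ∫⁻ x in Set.Ioi 0, ENNReal.ofReal (Real.exp (-x) * x ^ (0 : ℝ) * (Real.log c - 2)
      + Real.exp (-x) * x ^ (1 / 2 : ℝ) * 2 + Real.exp (-x) * x ^ (-(1 / 2) : ℝ) * (2 / c)) := by
        refine setLIntegral_mono' measurableSet_Ioi fun x hx => ?_
        rw [← hfun x hx, ← ENNReal.ofReal_mul (Real.exp_pos _).le]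
        exact ENNReal.ofReal_le_ofReal
          (mul_le_mul_of_nonneg_left (log_floor_le hc hx) (Real.exp_pos _).le)
    _ = ENNReal.ofReal (∫ x in Set.Ioi 0, (Real.exp (-x) * x ^ (0 : ℝ) * (Real.log c - 2)
      + Real.exp (-x) * x ^ (1 / 2 : ℝ) * 2 + Real.exp (-x) * x ^ (-(1 / 2) : ℝ) * (2 / c))) := by
        refine (ofReal_integral_eq_lintegral_ofReal hint ?_).symm
        refine (ae_restrict_mem measurableSet_Ioi).mono fun x hx => ?_
        have hx' : (0 : ℝ) < x := hx
        change 0 ≤ Real.exp (-x) * x ^ (0 : ℝ) * (Real.log c - 2)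
          + Real.exp (-x) * x ^ (1 / 2 : ℝ) * 2 + Real.exp (-x) * x ^ (-(1 / 2) : ℝ) * (2 / c)
        rw [← hfun x hx']
        refine mul_nonneg (Real.exp_pos _).le ((Real.log_nonneg ?_).trans (log_floor_le hc hx'))
        linarith [(Nat.cast_nonneg ⌊c * x⌋₊ : (0 : ℝ) ≤ ⌊c * x⌋₊)]
    _ = _ := by
        congr 1
        refine Eq.trans hval ?_
        ring

end

noncomputable section

open MeasureTheory

variable {Ω α ζ 𝒴 : Type*}

/-! ### A strong functional representation -/

theorem exists_hasSum_le {ι : Type*} {f : ι → ℝ} (hf : ∀ i, 0 ≤ f i) {C : ℝ} (hC : 0 ≤ C)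
    (h : ∑' i, ENNReal.ofReal (f i) ≤ ENNReal.ofReal C) : ∃ s, HasSum f s ∧ s ≤ C := by
  have ht : ∑' i, ENNReal.ofReal (f i) ≠ ⊤ := ne_top_of_le_ne_top ENNReal.ofReal_ne_top h
  have hs : Summable f := (ENNReal.summable_toReal ht).congr fun i => ENNReal.toReal_ofReal (hf i)
  refine ⟨_, hs.hasSum, ?_⟩
  rw [← ENNReal.ofReal_tsum_of_nonneg hf hs] at h
  exact (ENNReal.ofReal_le_ofReal_iff hC).1 h

theorem tsum_ofReal_le {ι : Type*} {x g : ι → ℝ} {C : ℝ} (hx : ∀ i, 0 ≤ x i) (hxg : ∀ i, x i ≤ g i)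
    {s : ℝ} (hg : HasSum g s) (hs : s ≤ C) : ∑' i, ENNReal.ofReal (x i) ≤ ENNReal.ofReal C := by
  have hsx : Summable x := hg.summable.of_nonneg_of_le hx hxg
  rw [← ENNReal.ofReal_tsum_of_nonneg hx hsx]
  exact ENNReal.ofReal_le_ofReal ((hasSum_le hxg hsx.hasSum hg).trans hs)

theorem entropy_ne_top [Finite α] (P : PMF Ω) (A : Ω → α) : entropy P A ≠ ⊤ := by
  have := Fintype.ofFinite α
  unfold entropy
  rw [tsum_fintype]
  exact ENNReal.sum_ne_top.2 fun a _ => ENNReal.ofReal_ne_top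

theorem tsum_mul_measure_preimage {U : Type*} [MeasurableSpace U] [Countable 𝒴] [MeasurableSpace 𝒴]
    [MeasurableSingletonClass 𝒴] (ν : Measure U) (D : Set U) {c : U → 𝒴} (hc : Measurable c)
    (G : 𝒴 → ℝ≥0∞) : ∑' y, G y * ν (D ∩ c ⁻¹' {y}) = ∫⁻ u in D, G (c u) ∂ν := by
  have hG : Measurable G := .of_discrete
  rw [← lintegral_map hG hc, lintegral_countable']
  refine tsum_congr fun y => ?_
  rw [Measure.map_apply hc (measurableSet_singleton y),
    Measure.restrict_apply (hc (measurableSet_singleton y)), Set.inter_comm]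

/-- A summable weight on `ℕ` with tail of order `k ^ (-1 - d)`. -/
def zipf (d : ℝ) (k : ℕ) : ℝ := d * ((k : ℝ) + 2) ^ (-(1 + d))

theorem zipf_pos {d : ℝ} (hd : 0 < d) (k : ℕ) : 0 < zipf d k := by
  unfold zipf
  positivity

/-- The weight is minus the slope of x^(-d) at x = k + 2, which by convexity is at most the drop
over [k + 1, k + 2]. Hence the weights telescope to at most 1. -/
theorem zipf_le_sub {d : ℝ} (hd : 0 < d) (k : ℕ) :
    zipf d k ≤ ((k : ℝ) + 1) ^ (-d) - ((k : ℝ) + 2) ^ (-d) := by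
  have h1 : (0 : ℝ) < (k : ℝ) + 1 := by positivity
  have h2 : (0 : ℝ) < (k : ℝ) + 2 := by positivity
  have h3 : ((k : ℝ) + 1) ^ (-d) = ((k : ℝ) + 2) ^ (-d) *
      Real.exp (-d * Real.log (((k : ℝ) + 1) / ((k : ℝ) + 2))) := by
    rw [Real.rpow_def_of_pos h1, Real.rpow_def_of_pos h2, ← Real.exp_add,
      Real.log_div h1.ne' h2.ne']
    congr 1
    ring
  have h4 : Real.log (((k : ℝ) + 1) / ((k : ℝ) + 2)) ≤ -(1 / ((k : ℝ) + 2)) := by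
    refine (Real.log_le_sub_one_of_pos (by positivity)).trans (le_of_eq ?_)
    field_simp
    ring
  have h5 := Real.add_one_le_exp (-d * Real.log (((k : ℝ) + 1) / ((k : ℝ) + 2)))
  have h6 : d / ((k : ℝ) + 2) ≤ -d * Real.log (((k : ℝ) + 1) / ((k : ℝ) + 2)) := by
    have := mul_le_mul_of_nonneg_left h4 hd.le
    rw [mul_neg, mul_one_div] at this
    linarith
  have h7 : zipf d k = ((k : ℝ) + 2) ^ (-d) * (d / ((k : ℝ) + 2)) := by
    unfold zipf
    rw [neg_add, Real.rpow_add h2, Real.rpow_neg_one]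
    ring
  rw [h7, h3]
  have := mul_le_mul_of_nonneg_left (h6.trans (sub_nonneg.1 (by linarith : (0 : ℝ) ≤
    (Real.exp (-d * Real.log (((k : ℝ) + 1) / ((k : ℝ) + 2))) - 1) -
      (-d * Real.log (((k : ℝ) + 1) / ((k : ℝ) + 2)))))) (Real.rpow_nonneg h2.le (-d))
  linarith

theorem tsum_zipf_le {d : ℝ} (hd : 0 < d) : ∑' k, ENNReal.ofReal (zipf d k) ≤ 1 := by
  rw [ENNReal.tsum_eq_iSup_nat]
  refine iSup_le fun N => ?_
  rw [← ENNReal.ofReal_sum_of_nonneg fun k _ => (zipf_pos hd k).le, ← ENNReal.ofReal_one]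
  refine ENNReal.ofReal_le_ofReal ?_
  have : ∀ N : ℕ, ∑ k ∈ Finset.range N, zipf d k ≤ 1 - ((N : ℝ) + 1) ^ (-d) := by
    intro N
    induction N with
    | zero => simp
    | succ N ih =>
      rw [Finset.sum_range_succ]
      have := zipf_le_sub hd N
      push_cast
      rw [add_assoc (N : ℝ), one_add_one_eq_two]
      linarith
  have h0 : (0 : ℝ) ≤ ((N : ℝ) + 1) ^ (-d) := by positivity
  linarith [this N]

/-- The exponential density is at most 1, so each cell of width h has mass at most h, and the
weights sum to at most 1. -/
theorem lintegral_zipf_floor_le {d : ℝ} (hd : 0 < d) {h : ℝ} (hh : 0 < h) :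
    ∫⁻ x, ENNReal.ofReal (zipf d ⌊x / h⌋₊) ∂expLaw ≤ ENNReal.ofReal h := by
  have hc : Measurable fun x : ℝ => ⌊x / h⌋₊ := Nat.measurable_floor.comp (measurable_id.div_const h)
  have := tsum_mul_measure_preimage expLaw Set.univ hc fun k => ENNReal.ofReal (zipf d k)
  rw [Measure.restrict_univ] at this
  rw [← this]
  have hk : ∀ k : ℕ, expLaw (Set.univ ∩ (fun x : ℝ => ⌊x / h⌋₊) ⁻¹' {k}) ≤ ENNReal.ofReal h := by
    intro k
    have hsub : Set.univ ∩ (fun x : ℝ => ⌊x / h⌋₊) ⁻¹' {k} ⊆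
        {x | ¬ 0 < x} ∪ Set.Ico (k * h) (k * h + h) := by
      rintro x ⟨-, hx⟩
      by_cases h0 : 0 < x
      · right
        have hx' : ⌊x / h⌋₊ = k := hx
        rw [Nat.floor_eq_iff (div_pos h0 hh).le, le_div_iff₀ hh, div_lt_iff₀ hh] at hx'
        exact ⟨hx'.1, by linarith [hx'.2]⟩
      · exact Or.inl h0
    refine (measure_mono hsub).trans ((measure_union_le _ _).trans ?_)
    rw [ae_iff.1 ae_expLaw_pos, zero_add]
    refine (expLaw_le_volume _).trans ?_
    rw [Real.volume_Ico, add_sub_cancel_left]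
  calc ∑' k, ENNReal.ofReal (zipf d k) * expLaw (Set.univ ∩ (fun x : ℝ => ⌊x / h⌋₊) ⁻¹' {k})
      ≤ ∑' k, ENNReal.ofReal (zipf d k) * ENNReal.ofReal h :=
        ENNReal.tsum_le_tsum fun k => mul_le_mul_right (hk k) _
    _ ≤ 1 * ENNReal.ofReal h := by
        rw [ENNReal.tsum_mul_right]
        exact mul_le_mul_left (tsum_zipf_le hd) _
    _ = _ := one_mul _

variable {n : ℕ}

/-- The arrival time of letter `b` at speed `q b`, rounded down to a multiple of `1 / 16`. -/
def arrivals (q : Fin (n + 1) → ℝ) (u : Fin (n + 1) → ℝ) (b : Fin (n + 1)) : ℕ :=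
  ⌊u b / (q b / 16)⌋₊

theorem measurable_arrivals (q : Fin (n + 1) → ℝ) : Measurable (arrivals q) :=
  measurable_pi_lambda _ fun b =>
    Nat.measurable_floor.comp (f := fun u : Fin (n + 1) → ℝ => u b / (q b / 16)) (by fun_prop)

/-- The margin that fixes the grid 1/16: with spacing 1/K the argument needs 2√π/K ≤ 2 - √π, and K =
16 is the least integer for which this holds. -/
theorem sqrt_pi_le : √Real.pi ≤ 16 / 9 := by
  rw [Real.sqrt_le_left (by norm_num)]
  have := Real.pi_lt_d2
  norm_num
  linarith

theorem one_le_sqrt_pi : 1 ≤ √Real.pi := by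
  rw [Real.one_le_sqrt]
  linarith [Real.pi_gt_three]

/-- The contribution of the pair `(z, a)` to the expected logarithm of the arrival time. -/
theorem lintegral_log_arrivals_le {p : Fin (n + 1) → ℝ} (hp : ∀ b, 0 ≤ p b) (h1 : ∑ b, p b = 1)
    {q : Fin (n + 1) → ℝ} (hq : ∀ b, 0 ≤ q b) {c : ℝ} (hc : 0 ≤ c)
    (a : Fin (n + 1)) (hpq : c * p a ≤ q a) :
    ENNReal.ofReal c * ∫⁻ u in race p a, ENNReal.ofReal (Real.log (arrivals q u a + 2)) ∂clocks n
      ≤ ENNReal.ofReal (Real.log 2 * divTerm (c * p a) (c * q a)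
        + (c * p a * (Real.log 16 + √Real.pi - 1) - c * q a * (√Real.pi - 1))) ∧
      0 ≤ Real.log 2 * divTerm (c * p a) (c * q a)
        + (c * p a * (Real.log 16 + √Real.pi - 1) - c * q a * (√Real.pi - 1)) := by
  have hpi := sqrt_pi_le
  have hpi1 := one_le_sqrt_pi
  have hl2 := log_two_pos
  rcases (mul_nonneg hc (hp a)).eq_or_lt with h0 | h0
  · constructor
    · rcases mul_eq_zero.1 h0.symm with h | h
      · simp [h]
      · have hnull : clocks n (race p a) = 0 := by rw [clocks_race hp h1, h, ENNReal.ofReal_zero]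
        rw [setLIntegral_measure_zero _ _ hnull, mul_zero]
        exact zero_le
    · rw [← h0]
      unfold divTerm
      have : Real.log 2 * ((0 * Real.log (0 / (c * q a)) + c * q a - 0) / Real.log 2)
        + (0 * (Real.log 16 + √Real.pi - 1) - c * q a * (√Real.pi - 1))
        = c * q a * (2 - √Real.pi) := by
        field_simp
        ring
      rw [this]
      exact mul_nonneg (mul_nonneg hc (hq a)) (by linarith)
  · have hq0 : 0 < q a := h0.trans_le hpq
    have hc0 : 0 < c := pos_of_mul_pos_left h0 (hp a)
    have hp0 : 0 < p a := pos_of_mul_pos_right h0 hc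
    have hk : 0 < p a / (q a / 16) := by positivity
    have hlog : Real.log (p a / (q a / 16)) = Real.log (c * p a / (c * q a)) + Real.log 16 := by
      rw [← Real.log_mul (by positivity) (by norm_num)]
      congr 1
      field_simp
    -- After cancellation this reads c q √π/8 ≤ c q (2 - √π), that is √π ≤ 16/9.
    have hdiff : c * p a * (Real.log (p a / (q a / 16)) + √Real.pi
        + 2 * √Real.pi / (p a / (q a / 16)) - 2)
        ≤ Real.log 2 * divTerm (c * p a) (c * q a)
        + (c * p a * (Real.log 16 + √Real.pi - 1) - c * q a * (√Real.pi - 1)) := by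
      rw [hlog, divTerm, mul_div_cancel₀ _ hl2.ne']
      have h2 : c * p a * (2 * √Real.pi / (p a / (q a / 16))) = c * q a * (√Real.pi / 8) := by
        field_simp
        ring
      have h3 : 0 ≤ c * q a * (16 / 9 - √Real.pi) :=
        mul_nonneg (mul_nonneg hc (hq a)) (by linarith)
      nlinarith
    constructor
    · have hF : Measurable fun x : ℝ => ENNReal.ofReal (Real.log (⌊x / (q a / 16)⌋₊ + 2)) := by
        refine (Real.measurable_log.comp ?_).ennreal_ofReal
        exact (measurable_from_nat.comp
          (Nat.measurable_floor.comp (measurable_id.div_const _))).add_const 2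
      have hrace := lintegral_race hp h1 hp0 hF
      unfold arrivals
      rw [hrace, ← mul_assoc, ← ENNReal.ofReal_mul hc]
      have hint := lintegral_log_floor_expLaw_le hk
      have : ∀ x : ℝ, p a / (q a / 16) * x = p a * x / (q a / 16) := fun x => by ring
      simp only [this] at hint
      refine (mul_le_mul_right hint _).trans ?_
      rw [← ENNReal.ofReal_mul h0.le]
      exact ENNReal.ofReal_le_ofReal hdiff
    · refine le_trans (mul_nonneg h0.le ?_) hdiff
      -- With k = 16 p/q, the bound log k ≥ 1 - 1/k leaves √π - 1 + (2√π - 1)/k ≥ 0.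
      have h4 := Real.one_sub_inv_le_log_of_pos hk
      have h5 : 0 ≤ (2 * √Real.pi - 1) * (p a / (q a / 16))⁻¹ :=
        mul_nonneg (by linarith) (inv_nonneg.2 hk.le)
      rw [div_eq_mul_inv (2 * √Real.pi)]
      linarith

end

noncomputable section

open MeasureTheory

variable {Ω α ζ 𝒴 : Type*} {n : ℕ}

/-! ### Describing the winner of the race from the arrival times -/

theorem pr_prodMk (P : PMF Ω) (A : Ω → α) (Z : Ω → ζ) :
    HasSum (fun x : α × ζ => pr P {w | A w = x.1 ∧ Z w = x.2}) 1 := by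
  have := hasSum_pr P Set.univ fun w => (A w, Z w)
  rw [pr_univ] at this
  convert this using 3 with x
  ext w
  simp [Prod.ext_iff]

theorem hasSum_pr_one (P : PMF Ω) (A : Ω → α) : HasSum (fun a => pr P {w | A w = a}) 1 := by
  have := hasSum_pr P Set.univ A
  rw [pr_univ] at this
  convert this using 3
  simp

theorem hasSum_mul_of_nonneg {f : ζ → ℝ} {g : α → ℝ} {a b : ℝ} (hf : HasSum f a)
    (hg : HasSum g b) (hf0 : ∀ i, 0 ≤ f i) (hg0 : ∀ i, 0 ≤ g i) :
    HasSum (fun x : ζ × α => f x.1 * g x.2) (a * b) :=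
  HasSum.mul hf hg (Summable.mul_of_nonneg hf.summable hg.summable hf0 hg0)

theorem hasSum_mul_pr (P : PMF Ω) (Z : Ω → ζ) (A : Ω → α) :
    HasSum (fun x : ζ × α => pr P {w | Z w = x.1} * pr P {w | A w = x.2}) (1 * 1) :=
  hasSum_mul_of_nonneg (f := fun z => pr P {w | Z w = z}) (g := fun a => pr P {w | A w = a})
    (hasSum_pr_one P Z) (hasSum_pr_one P A) (fun _ => pr_nonneg _ _) fun _ => pr_nonneg _ _

/-- The joint law and the product law both have total mass 1, so the corrections sum to (log 16 + √π
- 1) - (√π - 1) = log 16. -/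
theorem tsum_le_mi_add_log (P : PMF Ω) (Z : Ω → ζ) (A : Ω → α) {G : ζ → α → ℝ≥0∞}
    (key : ∀ z a, G z a ≤ ENNReal.ofReal (Real.log 2 * divTerm (pr P {w | Z w = z ∧ A w = a})
          (pr P {w | Z w = z} * pr P {w | A w = a})
        + (pr P {w | Z w = z ∧ A w = a} * (Real.log 16 + √Real.pi - 1)
          - pr P {w | Z w = z} * pr P {w | A w = a} * (√Real.pi - 1))) ∧
      0 ≤ Real.log 2 * divTerm (pr P {w | Z w = z ∧ A w = a})
          (pr P {w | Z w = z} * pr P {w | A w = a})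
        + (pr P {w | Z w = z ∧ A w = a} * (Real.log 16 + √Real.pi - 1)
          - pr P {w | Z w = z} * pr P {w | A w = a} * (√Real.pi - 1))) :
    ∑' z, ∑' a, G z a
      ≤ ENNReal.ofReal (Real.log 2) * mi P Z A + ENNReal.ofReal (Real.log 16) := by
  have hZA := pr_prodMk P Z A
  have hprod := hasSum_mul_pr P Z A
  let p : ζ × α → ℝ := fun x => pr P {w | Z w = x.1 ∧ A w = x.2}
  let q : ζ × α → ℝ := fun x => pr P {w | Z w = x.1} * pr P {w | A w = x.2}
  have hp : HasSum p 1 := hZA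
  have hq : HasSum q (1 * 1) := hprod
  have he : HasSum (fun x => p x * (Real.log 16 + √Real.pi - 1) - q x * (√Real.pi - 1))
      (Real.log 16) := by
    have he := (hp.mul_right (Real.log 16 + √Real.pi - 1)).sub (hq.mul_right (√Real.pi - 1))
    rwa [show (1 : ℝ) * (Real.log 16 + √Real.pi - 1) - 1 * 1 * (√Real.pi - 1) = Real.log 16 by
      ring] at he
  have hd : ∀ x, 0 ≤ divTerm (p x) (q x) := fun x =>
    divTerm_nonneg (pr_nonneg _ _) (mul_nonneg (pr_nonneg _ _) (pr_nonneg _ _)) (by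
      intro h
      rcases mul_eq_zero.1 h with h | h
      · exact pr_eq_zero_of_subset P (fun w hw => hw.1) h
      · exact pr_eq_zero_of_subset P (fun w hw => hw.2) h)
  have h16 : (0 : ℝ) ≤ Real.log 16 := Real.log_nonneg (by norm_num)
  have hsplit := tsum_ofReal_eq_add
    (x := fun x => Real.log 2 * divTerm (p x) (q x)
      + (p x * (Real.log 16 + √Real.pi - 1) - q x * (√Real.pi - 1)))
    (y := fun x => Real.log 2 * divTerm (p x) (q x))
    (z := fun _ : ζ × α => 0) (fun x => (key x.1 x.2).2)
    (fun x => mul_nonneg log_two_pos.le (hd x)) (fun _ => le_rfl) he h16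
    (fun x => by rw [add_zero])
  have hmi : mi P Z A = ∑' x : ζ × α, ENNReal.ofReal (divTerm (p x) (q x)) := by
    rw [mi_eq_tsum, ENNReal.tsum_prod']
  have hG : ∑' z, ∑' a, G z a = ∑' x : ζ × α, G x.1 x.2 := by rw [ENNReal.tsum_prod']
  rw [hG, hmi, ← ENNReal.tsum_mul_left]
  have hle : ∑' x : ζ × α, G x.1 x.2 ≤ ∑' x, ENNReal.ofReal (Real.log 2 * divTerm (p x) (q x)
      + (p x * (Real.log 16 + √Real.pi - 1) - q x * (√Real.pi - 1))) :=
    ENNReal.tsum_le_tsum fun x => (key x.1 x.2).1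
  refine hle.trans ?_
  rw [hsplit]
  simp only [ENNReal.ofReal_zero, tsum_zero, add_zero, ENNReal.ofReal_mul log_two_pos.le, le_refl]

/-- The mean logarithm of the arrival time of the winner of the race. -/
theorem tsum_log_arrivals_le (P : PMF Ω) (Z : Ω → ζ) (A : Ω → Fin (n + 1)) :
    ∑' z, ∑' a, P.toOuterMeasure {w | Z w = z} *
      ∫⁻ u in race (fun b => pr P {w | Z w = z ∧ A w = b} / pr P {w | Z w = z}) a,
        ENNReal.ofReal (Real.log (arrivals (fun b => pr P {w | A w = b}) u a + 2)) ∂clocks n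
      ≤ ENNReal.ofReal (Real.log 2) * mi P Z A + ENNReal.ofReal (Real.log 16) := by
  have hz1 : ∀ z, pr P {w | Z w = z} ≠ 0 →
      ∑ a, pr P {w | Z w = z ∧ A w = a} / pr P {w | Z w = z} = 1 := by
    intro z h0
    rw [← Finset.sum_div, div_eq_one_iff_eq h0]
    exact (hasSum_fintype _).unique (hasSum_pr P {w | Z w = z} A)
  refine tsum_le_mi_add_log P Z A ?_
  intro z a
  by_cases h0 : pr P {w | Z w = z} = 0
  · have h1 : pr P {w | Z w = z ∧ A w = a} = 0 := pr_eq_zero_of_subset P (fun w hw => hw.1) h0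
    rw [← ofReal_pr, h0, h1]
    simp [divTerm]
  · have := lintegral_log_arrivals_le
      (fun b => div_nonneg (pr_nonneg P {w | Z w = z ∧ A w = b}) (pr_nonneg P {w | Z w = z}))
      (hz1 z h0) (fun b => pr_nonneg P {w | A w = b}) (pr_nonneg P {w | Z w = z}) a (by
        rw [mul_div_cancel₀ _ h0]
        exact pr_mono P fun w hw => hw.2)
    rw [mul_div_cancel₀ _ h0, ofReal_pr] at this
    exact this

/-- An upper bound on `H(A|Y)` obtained from a family of probability vectors depending on `Y`. -/
theorem condEntropy_le_of_weights {Q : PMF Ω} {A : Ω → Fin (n + 1)} {Y : Ω → Fin (n + 1) → ℕ}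
    {d L : ℝ} (hd : 0 < d) (hL : 0 ≤ L) {v : Fin (n + 1) → Prop} [DecidablePred v]
    (hv : ∀ a y, ¬ v a → pr Q {w | A w = a ∧ Y w = y} = 0)
    (hlog : ∑' y, ∑' a, ENNReal.ofReal (pr Q {w | A w = a ∧ Y w = y} * Real.log (y a + 2))
      ≤ ENNReal.ofReal (L + Real.log 16))
    (hN : ∑' y, ENNReal.ofReal (pr Q {w | Y w = y} * ∑ b, if v b then zipf d (y b) else 0)
      ≤ ENNReal.ofReal (1 / 16)) :
    condEntropy Q A Y ≤ ENNReal.ofReal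
      ((-Real.log d + d * Real.log 16 + (1 + d) * L) / Real.log 2) := by
  have hl2 := log_two_pos
  have hl16 : (0 : ℝ) ≤ Real.log 16 := Real.log_nonneg (by norm_num)
  let N : (Fin (n + 1) → ℕ) → ℝ := fun y => ∑ b, if v b then zipf d (y b) else 0
  -- A guess at the law of A given Y = y: Zipf weights of the arrival times, normalized over the
  -- letters in v. Its cross-entropy bounds H(A|Y).
  let q : (Fin (n + 1) → ℕ) → Fin (n + 1) → ℝ := fun y a =>
    (if v a then zipf d (y a) else 0) / N y
  have hv0 : ∀ (y : Fin (n + 1) → ℕ) b, 0 ≤ (if v b then zipf d (y b) else 0 : ℝ) := by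
    intro y b
    split_ifs
    exacts [(zipf_pos hd _).le, le_rfl]
  have hN0 : ∀ y, 0 ≤ N y := fun y => Finset.sum_nonneg fun b _ => hv0 y b
  have hq0 : ∀ y a, 0 ≤ q y a := fun y a => div_nonneg (hv0 y a) (hN0 y)
  have hsum1 : HasSum (fun x : (Fin (n + 1) → ℕ) × Fin (n + 1) =>
      pr Q {w | A w = x.2 ∧ Y w = x.1}) 1 := by
    convert pr_prodMk Q Y A using 3 with x
    exact Set.ext fun w => and_comm
  have hY := hasSum_pr_one Q Y
  have hYA : ∀ y, ∑ a, pr Q {w | A w = a ∧ Y w = y} = pr Q {w | Y w = y} := by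
    intro y
    refine (hasSum_fintype _).unique ?_
    convert hasSum_pr Q {w | Y w = y} A using 3
    exact Set.ext fun w => and_comm
  obtain ⟨s2, h2, h2'⟩ := exists_hasSum_le (f := fun x : (Fin (n + 1) → ℕ) × Fin (n + 1) =>
      pr Q {w | A w = x.2 ∧ Y w = x.1} * N x.1) (fun x => mul_nonneg (pr_nonneg _ _) (hN0 _))
    (C := 1 / 16) (by norm_num) (by
      rw [ENNReal.tsum_prod']
      refine le_trans (ENNReal.tsum_le_tsum fun y => ?_) hN
      rw [tsum_fintype, ← ENNReal.ofReal_sum_of_nonneg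
        fun a _ => mul_nonneg (pr_nonneg _ _) (hN0 _)]
      simp only
      rw [← Finset.sum_mul, hYA])
  obtain ⟨s3, h3, h3'⟩ := exists_hasSum_le (f := fun x : (Fin (n + 1) → ℕ) × Fin (n + 1) =>
      pr Q {w | A w = x.2 ∧ Y w = x.1} * Real.log (x.1 x.2 + 2))
    (fun x => mul_nonneg (pr_nonneg _ _) (Real.log_nonneg (by
      linarith [(Nat.cast_nonneg (x.1 x.2) : (0 : ℝ) ≤ x.1 x.2)])))
    (C := L + Real.log 16) (by linarith) (by rw [ENNReal.tsum_prod']; exact hlog)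
  obtain ⟨s4, h4, h4'⟩ := exists_hasSum_le (f := fun x : (Fin (n + 1) → ℕ) × Fin (n + 1) =>
      pr Q {w | Y w = x.1} * q x.1 x.2) (fun x => mul_nonneg (pr_nonneg _ _) (hq0 _ _))
    (C := 1) zero_le_one (by
      rw [ENNReal.tsum_prod', ← hY.tsum_eq, ENNReal.ofReal_tsum_of_nonneg
        (fun _ => pr_nonneg _ _) hY.summable]
      refine ENNReal.tsum_le_tsum fun y => ?_
      rw [tsum_fintype, ← ENNReal.ofReal_sum_of_nonneg
        fun a _ => mul_nonneg (pr_nonneg _ _) (hq0 _ _)]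
      simp only [q]
      rw [← Finset.mul_sum, ← Finset.sum_div]
      exact ENNReal.ofReal_le_ofReal (mul_le_of_le_one_right (pr_nonneg _ _) (div_self_le_one _)))
  have hG := ((((hsum1.mul_right (-Real.log 16 - 1 - Real.log d)).add (h2.mul_right 16)).add
    (h3.mul_right (1 + d))).add (h4.sub hsum1)).div_const (Real.log 2)
  rw [condEntropy_eq, ← ENNReal.tsum_prod (f := fun y a => ENNReal.ofReal
    (pr Q {w | A w = a ∧ Y w = y} * Real.log (pr Q {w | Y w = y} /
      pr Q {w | A w = a ∧ Y w = y}) / Real.log 2))]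
  refine tsum_ofReal_le (fun x => entropyTerm_nonneg (pr_nonneg _ _) (pr_mono Q fun w hw => hw.2))
    (fun x => ?_) hG ?_
  · refine div_le_div_of_nonneg_right ?_ hl2.le
    obtain ⟨y, a⟩ := x
    simp only
    rcases (pr_nonneg Q {w | A w = a ∧ Y w = y}).eq_or_lt with h0 | h0
    · rw [← h0]
      have := mul_nonneg (pr_nonneg Q {w | Y w = y}) (hq0 y a)
      simp only [zero_mul, zero_add, sub_zero]
      exact this
    · have hva : v a := by
        by_contra h
        exact h0.ne' (hv a y h)
      have hy0 : 0 < pr Q {w | Y w = y} := h0.trans_le (pr_mono Q fun w hw => hw.2)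
      have hz0 := zipf_pos hd (y a)
      have hNpos : 0 < N y := hz0.trans_le (by
        have := Finset.single_le_sum (fun b _ => hv0 y b) (Finset.mem_univ a)
        rwa [if_pos hva] at this)
      have hqa : q y a = zipf d (y a) / N y := by
        simp only [q, if_pos hva]
      have hk : (0 : ℝ) < (y a : ℝ) + 2 := by positivity
      have hz : Real.log (zipf d (y a)) = Real.log d - (1 + d) * Real.log (y a + 2) := by
        unfold zipf
        rw [Real.log_mul hd.ne' (by positivity), Real.log_rpow hk]
        ring
      -- Tangent of the logarithm at 1/16, the bound on the mean of N; on average the last two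
      -- summands are nonpositive, and -log 16 offsets the log 16 lost to rounding.
      have hlN : Real.log (N y) ≤ -Real.log 16 + 16 * N y - 1 := by
        have h1 := Real.log_le_sub_one_of_pos (mul_pos (by norm_num : (0 : ℝ) < 16) hNpos)
        rw [Real.log_mul (by norm_num) hNpos.ne'] at h1
        linarith
      have hqpos : 0 < q y a := hqa ▸ div_pos hz0 hNpos
      -- Gibbs' inequality, cell by cell, through log x ≤ x - 1.
      have hgibbs : Real.log (pr Q {w | Y w = y} / pr Q {w | A w = a ∧ Y w = y})
          ≤ pr Q {w | Y w = y} * q y a / pr Q {w | A w = a ∧ Y w = y} - 1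
            + Real.log (N y) - Real.log (zipf d (y a)) := by
        have h1 := Real.log_le_sub_one_of_pos (div_pos (mul_pos hy0 hqpos) h0)
        rw [Real.log_div (mul_pos hy0 hqpos).ne' h0.ne', Real.log_mul hy0.ne' hqpos.ne', hqa,
          Real.log_div hz0.ne' hNpos.ne'] at h1
        rw [Real.log_div hy0.ne' h0.ne', hqa]
        linarith
      have hfin : Real.log (pr Q {w | Y w = y} / pr Q {w | A w = a ∧ Y w = y})
          ≤ pr Q {w | Y w = y} * q y a / pr Q {w | A w = a ∧ Y w = y} - 1
            + (-Real.log 16 + 16 * N y - 1) - (Real.log d - (1 + d) * Real.log (y a + 2)) := by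
        linarith
      refine (mul_le_mul_of_nonneg_left hfin h0.le).trans (le_of_eq ?_)
      field_simp
      ring
  · refine div_le_div_of_nonneg_right ?_ hl2.le
    have := mul_le_mul_of_nonneg_right h3' (by linarith : 0 ≤ 1 + d)
    nlinarith

/-- Strong functional representation with a discrete random variable. -/
theorem exists_strong_functional_representation (P : PMF Ω) (Z : Ω → ζ) (A : Ω → Fin (n + 1)) :
    ∃ P' : PMF (Ω × (Fin (n + 1) → ℕ)), P'.map Prod.fst = P ∧
      mi P' Prod.snd (Z ∘ Prod.fst) = 0 ∧
      condEntropy P' (fun v => A v.1) Prod.snd ≤ mi P Z A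
        + ENNReal.ofReal (Real.logb 2 ((mi P Z A).toReal + 4) + 1) := by
  classical
  let qA : Fin (n + 1) → ℝ := fun b => pr P {w | A w = b}
  let pz : ζ → Fin (n + 1) → ℝ := fun z b => pr P {w | Z w = z ∧ A w = b} / pr P {w | Z w = z}
  have hc : Measurable (arrivals qA) := measurable_arrivals qA
  have hcell : ∀ y, MeasurableSet (arrivals qA ⁻¹' {y}) := fun y => hc (measurableSet_singleton y)
  have hpz0 : ∀ z b, 0 ≤ pz z b := fun z b => div_nonneg (pr_nonneg _ _) (pr_nonneg _ _)
  have hpz1 : ∀ z, pr P {w | Z w = z} ≠ 0 → ∑ b, pz z b = 1 := by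
    intro z h0
    simp only [pz]
    rw [← Finset.sum_div, div_eq_one_iff_eq h0]
    exact (hasSum_fintype _).unique (hasSum_pr P {w | Z w = z} A)
  -- Given z, A is the winner at the speeds P(·|z), while Y is computed from the clocks with the
  -- marginal speeds only. So the law of Y does not depend on z.
  let R : ζ → Fin (n + 1) → (Fin (n + 1) → ℕ) → ℝ≥0∞ := fun z a y =>
    clocks n (race (pz z) a ∩ arrivals qA ⁻¹' {y})
  have hR : ∀ z a, P.toOuterMeasure {w | Z w = z} * ∑' y, R z a y
      = P.toOuterMeasure {w | Z w = z ∧ A w = a} := by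
    intro z a
    by_cases h0 : pr P {w | Z w = z} = 0
    · have h1 : pr P {w | Z w = z ∧ A w = a} = 0 := pr_eq_zero_of_subset P (fun w hw => hw.1) h0
      rw [← ofReal_pr, ← ofReal_pr, h0, h1]
      simp
    · have := tsum_mul_measure_preimage (clocks n) (race (pz z) a) hc fun _ => 1
      simp only [one_mul, setLIntegral_one] at this
      simp only [R]
      rw [this, clocks_race (hpz0 z) (hpz1 z h0), ← ofReal_pr, ← ofReal_pr,
        ← ENNReal.ofReal_mul (pr_nonneg _ _), mul_div_cancel₀ _ h0]
  obtain ⟨P', h1, h2, -⟩ := exists_coupling P Z A R hR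
  obtain ⟨h4, h5⟩ := mi_eq_zero_of_coupling h2
    (ρ := fun y => clocks n (arrivals qA ⁻¹' {y})) (fun z y h => by
      have h0 : pr P {w | Z w = z} ≠ 0 := by
        intro h0
        rw [← ofReal_pr, h0] at h
        simp at h
      rw [tsum_fintype]
      exact sum_clocks_race_inter (hpz0 z) (hpz1 z h0) (hcell y))
  refine ⟨P', h1, h5, ?_⟩
  have hI : mi P Z A ≠ ⊤ := by
    refine ne_top_of_le_ne_top (entropy_ne_top P A) ?_
    rw [entropy_eq_add P A Z, mi_comm]
    exact le_self_add
  set I := (mi P Z A).toReal with hIdef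
  have hI0 : 0 ≤ I := ENNReal.toReal_nonneg
  have hl2 := log_two_pos
  have hd : 0 < 1 / (I + 4) := by positivity
  have hY : ∀ y, P'.toOuterMeasure {v | v.2 = y} = clocks n (arrivals qA ⁻¹' {y}) := by
    intro y
    rw [outer_eq_tsum P' _ (fun v => Z v.1)]
    have : ∀ z, P'.toOuterMeasure {w | w ∈ {v : Ω × (Fin (n + 1) → ℕ) | v.2 = y} ∧ Z w.1 = z}
        = P.toOuterMeasure {w | Z w = z} * clocks n (arrivals qA ⁻¹' {y}) := by
      intro z
      rw [← h4 z y]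
      congr 1
      ext v
      simp only [Set.mem_ofPred_eq]
      tauto
    simp only [this]
    have hsum : ∑' z, P.toOuterMeasure {w | Z w = z} = 1 := by
      rw [← outer_univ P, outer_eq_tsum P Set.univ Z]
      simp
    rw [ENNReal.tsum_mul_right, hsum, one_mul]
  have hAY : ∀ a y, P'.toOuterMeasure {v | A v.1 = a ∧ v.2 = y}
      = ∑' z, P.toOuterMeasure {w | Z w = z} * R z a y := by
    intro a y
    rw [outer_eq_tsum P' _ (fun v => Z v.1)]
    refine tsum_congr fun z => ?_
    rw [← h2 z a y]
    congr 1
    ext v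
    simp only [Set.mem_ofPred_eq]
    tauto
  -- The exponent d = 1/(I + 4) makes the overhead d (I + log₂ 16) equal to 1, leaving I + log₂(I +
  -- 4) + 1. Letters of probability 0 are excluded: division by zero puts their arrival at 0, where
  -- the Zipf weight is not controlled by the probability of the letter.
  have hmain := condEntropy_le_of_weights (Q := P') (A := fun v => A v.1) (Y := Prod.snd)
    (d := 1 / (I + 4)) (L := Real.log 2 * I) hd (mul_nonneg hl2.le hI0)
    (v := fun a => qA a ≠ 0) ?_ ?_ ?_
  · refine hmain.trans (le_of_eq ?_)
    rw [← ENNReal.ofReal_toReal hI, ← hIdef, ← ENNReal.ofReal_add hI0]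
    · congr 1
      have h16 : Real.log 16 = 4 * Real.log 2 := by
        rw [show (16 : ℝ) = 2 ^ 4 by norm_num, Real.log_pow]
        norm_num
      rw [h16, Real.logb, one_div, Real.log_inv]
      field_simp
      ring
    · have : 0 ≤ Real.logb 2 (I + 4) := Real.logb_nonneg one_lt_two (by linarith)
      linarith
  · intro a y h
    rw [not_not] at h
    refine pr_eq_zero_of_subset P' (F := Prod.fst ⁻¹' {w | A w = a}) (fun v hv => hv.1) ?_
    rw [← pr_map, h1]
    exact h
  · calc _ = ∑' z, ∑' a, P.toOuterMeasure {w | Z w = z} * ∑' y,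
          ENNReal.ofReal (Real.log ((y : Fin (n + 1) → ℕ) a + 2)) * R z a y := by
          have : ∀ (y : Fin (n + 1) → ℕ) a, ENNReal.ofReal (pr P' {w | A w.1 = a ∧ w.2 = y} *
              Real.log (y a + 2)) = ∑' z, P.toOuterMeasure {w | Z w = z} *
                (ENNReal.ofReal (Real.log (y a + 2)) * R z a y) := by
            intro y a
            rw [ENNReal.ofReal_mul (pr_nonneg _ _), ofReal_pr, hAY, ← ENNReal.tsum_mul_right]
            refine tsum_congr fun z => ?_
            ring
          simp only [this, ← ENNReal.tsum_mul_left]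
          rw [ENNReal.tsum_comm]
          rw [ENNReal.tsum_comm (α := ζ)]
          refine tsum_congr fun a => ?_
          rw [ENNReal.tsum_comm]
    _ ≤ ENNReal.ofReal (Real.log 2) * mi P Z A + ENNReal.ofReal (Real.log 16) := by
          refine le_trans (le_of_eq ?_) (tsum_log_arrivals_le P Z A)
          refine tsum_congr fun z => tsum_congr fun a => ?_
          congr 1
          exact tsum_mul_measure_preimage (clocks n) (race (pz z) a) hc
            fun y => ENNReal.ofReal (Real.log (y a + 2))
    _ = _ := by
          rw [ENNReal.ofReal_add (mul_nonneg hl2.le hI0) (Real.log_nonneg (by norm_num)),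
            ENNReal.ofReal_mul hl2.le, hIdef, ENNReal.ofReal_toReal hI]
  · have hsum : ∑ b, ENNReal.ofReal (qA b / 16) = ENNReal.ofReal (1 / 16) := by
      rw [← ENNReal.ofReal_sum_of_nonneg fun b _ => div_nonneg (pr_nonneg _ _) (by norm_num),
        ← Finset.sum_div]
      congr 2
      exact (hasSum_fintype _).unique (hasSum_pr_one P A)
    rw [← hsum]
    calc _ = ∑ b, ∑' y, ENNReal.ofReal (if qA b ≠ 0 then zipf (1 / (I + 4)) (y b) else 0) *
          clocks n (Set.univ ∩ arrivals qA ⁻¹' {y}) := by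
          rw [← tsum_fintype (L := SummationFilter.unconditional _), ENNReal.tsum_comm]
          refine tsum_congr fun y => ?_
          rw [ENNReal.ofReal_mul (pr_nonneg _ _), ofReal_pr, hY, ENNReal.ofReal_sum_of_nonneg,
            tsum_fintype, mul_comm, Finset.sum_mul]
          · simp only [Set.univ_inter]
          · intro b _
            split_ifs
            exacts [(zipf_pos hd _).le, le_rfl]
    _ ≤ ∑ b, ENNReal.ofReal (qA b / 16) := by
          refine Finset.sum_le_sum fun b _ => ?_
          rw [tsum_mul_measure_preimage (clocks n) Set.univ hc fun y =>
            ENNReal.ofReal (if qA b ≠ 0 then zipf (1 / (I + 4)) (y b) else 0),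
            Measure.restrict_univ]
          by_cases hb : qA b = 0
          · simp [hb]
          · simp only [ne_eq, hb, not_false_eq_true, if_true]
            have hb' : 0 < qA b / 16 := div_pos ((pr_nonneg _ _).lt_of_ne' hb) (by norm_num)
            refine le_trans (le_of_eq ?_) (lintegral_zipf_floor_le hd hb')
            have hm : Measurable fun x : ℝ =>
                ENNReal.ofReal (zipf (1 / (I + 4)) ⌊x / (qA b / 16)⌋₊) :=
              (measurable_from_nat (f := fun k => ENNReal.ofReal (zipf (1 / (I + 4)) k))).comp
                (Nat.measurable_floor.comp (measurable_id.div_const _))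
            exact (measurePreserving_eval (fun _ : Fin (n + 1) => expLaw) b).lintegral_comp hm

end

noncomputable section

variable {Ω α β γ 𝒴 : Type*}

/-! ### The rearrangement upper bound -/

/-- Increments of a concave function decrease: C and x + h are convex combinations of x and C + h
with interchanged weights, and the two concavity inequalities add up. -/
theorem negMulLog_increment {x C h : ℝ} (hx : 0 ≤ x) (hxC : x ≤ C) (hh : 0 ≤ h) :
    Real.negMulLog (C + h) - Real.negMulLog C ≤ Real.negMulLog (x + h) - Real.negMulLog x := by
  rcases eq_or_lt_of_le (show x ≤ C + h by linarith) with h0 | h0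
  · have h1 : h = 0 := by linarith
    have h2 : x = C := by linarith
    rw [h1, h2]
  have hd : 0 < C + h - x := by linarith
  have hc := Real.concaveOn_negMulLog
  have hxm : x ∈ Set.Ici (0 : ℝ) := hx
  have hCm : C + h ∈ Set.Ici (0 : ℝ) := Set.mem_Ici.2 (by linarith)
  have w0 : 0 ≤ h / (C + h - x) := div_nonneg hh hd.le
  have w1 : 0 ≤ (C - x) / (C + h - x) := div_nonneg (by linarith) hd.le
  have ws : h / (C + h - x) + (C - x) / (C + h - x) = 1 := by
    field_simp
    ring
  have e1 := hc.2 hxm hCm w0 w1 ws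
  have e2 := hc.2 hxm hCm w1 w0 (by rw [add_comm]; exact ws)
  simp only [smul_eq_mul] at e1 e2
  have p1 : h / (C + h - x) * x + (C - x) / (C + h - x) * (C + h) = C := by
    field_simp
    ring
  have p2 : (C - x) / (C + h - x) * x + h / (C + h - x) * (C + h) = x + h := by
    field_simp
    ring
  rw [p1] at e1
  rw [p2] at e2
  have : (h / (C + h - x) + (C - x) / (C + h - x)) * (Real.negMulLog x + Real.negMulLog (C + h))
      ≤ Real.negMulLog C + Real.negMulLog (x + h) := by linarith
  rw [ws] at this
  linarith

/-- Concavity on [C, C + c] bounds the left side by the increment cv taken at C; decreasing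
increments move it down to x. This is the inductive step for the greedy weights. -/
theorem negMulLog_marginal {x C c v : ℝ} (hx : 0 ≤ x) (hxC : x ≤ C) (hc : 0 ≤ c) (hv0 : 0 ≤ v)
    (hv1 : v ≤ 1) : v * (Real.negMulLog (C + c) - Real.negMulLog C)
      ≤ Real.negMulLog (x + c * v) - Real.negMulLog x := by
  refine le_trans ?_ (negMulLog_increment hx hxC (mul_nonneg hc hv0))
  have := Real.concaveOn_negMulLog.2 (show C ∈ Set.Ici (0 : ℝ) from hx.trans hxC)
    (show C + c ∈ Set.Ici (0 : ℝ) from Set.mem_Ici.2 (by linarith)) (sub_nonneg.2 hv1) hv0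
    (by ring)
  simp only [smul_eq_mul] at this
  rw [show (1 - v) * C + v * (C + c) = C + c * v by ring] at this
  linarith

/-- Supporting functional of the comonotone extension of `A ↦ negMulLog (∑ s ∈ A, c s)`. -/
theorem exists_supporting_weights {S : Type*} [DecidableEq S] (c p : S → ℝ) (hc : ∀ s, 0 ≤ c s)
    (A : Finset S) : ∃ w : S → ℝ,
      (∀ v : S → ℝ, (∀ s, 0 ≤ v s) → (∀ s, v s ≤ 1) →
        ∑ s ∈ A, w s * v s ≤ Real.negMulLog (∑ s ∈ A, c s * v s)) ∧
      ∀ m : ℝ, Real.negMulLog (∑ s ∈ A, if m ≤ p s then c s else 0)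
        = ∑ s ∈ A, if m ≤ p s then w s else 0 := by
  induction A using Finset.induction_on_min_value p with
  | empty => exact ⟨fun _ => 0, by simp, by simp⟩
  | insert a A ha hmin ih =>
    obtain ⟨w, h1, h2⟩ := ih
    let C := ∑ s ∈ A, c s
    -- Letters enter in decreasing order of p, each with weight its increment of φ. A level set that
    -- contains a therefore contains all of A, and the increments telescope.
    let w' := Function.update w a (Real.negMulLog (C + c a) - Real.negMulLog C)
    have hw'a : w' a = Real.negMulLog (C + c a) - Real.negMulLog C := Function.update_self _ _ _
    have hw' : ∀ s ∈ A, w' s = w s := fun s hs =>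
      Function.update_of_ne (fun h : s = a => ha (h ▸ hs)) _ _
    refine ⟨w', ?_, ?_⟩
    · intro v hv0 hv1
      rw [Finset.sum_insert ha, Finset.sum_insert ha, hw'a,
        Finset.sum_congr rfl fun s hs => by rw [hw' s hs]]
      have hle : ∑ s ∈ A, c s * v s ≤ C :=
        Finset.sum_le_sum fun s _ => mul_le_of_le_one_right (hc s) (hv1 s)
      have h3 := negMulLog_marginal (Finset.sum_nonneg fun s (_ : s ∈ A) =>
        mul_nonneg (hc s) (hv0 s)) hle (hc a) (hv0 a) (hv1 a)
      have h4 := h1 v hv0 hv1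
      rw [add_comm (c a * v a)]
      linarith
    · intro m
      have hsum : (∑ s ∈ A, if m ≤ p s then w' s else 0) = ∑ s ∈ A, if m ≤ p s then w s else 0 :=
        Finset.sum_congr rfl fun s hs => by rw [hw' s hs]
      rw [Finset.sum_insert ha, Finset.sum_insert ha, hsum]
      by_cases hm : m ≤ p a
      · have hall : ∀ f : S → ℝ, ∑ s ∈ A, (if m ≤ p s then f s else 0) = ∑ s ∈ A, f s := fun f =>
          Finset.sum_congr rfl fun s hs => if_pos (hm.trans (hmin s hs))
        have h3 := h2 m
        rw [hall, hall] at h3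
        rw [if_pos hm, if_pos hm, hall, hall, hw'a, ← h3, add_comm (c a)]
        ring
      · rw [if_neg hm, if_neg hm, zero_add, zero_add, h2 m]

theorem intervalIntegral_indicator_le {a c : ℝ} (hc0 : 0 ≤ c) (hc1 : c ≤ 1) :
    IntervalIntegrable (fun m : ℝ => if m ≤ c then a else 0) MeasureTheory.volume 0 1 ∧
      ∫ m in (0 : ℝ)..1, (if m ≤ c then a else 0) = a * c := by
  have heq : (fun m : ℝ => if m ≤ c then a else 0) = Set.indicator {m | m ≤ c} fun _ => a := by
    ext m
    simp [Set.indicator]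
  constructor
  · rw [heq, intervalIntegrable_iff]
    exact (MeasureTheory.integrableOn_const (by simp)).indicator measurableSet_Iic
  · rw [heq, intervalIntegral.integral_indicator ⟨hc0, hc1⟩]
    simp [mul_comm]

variable {S X T : Type*}

theorem toReal_condProb (P : PMF Ω) (A : Ω → α) (B : Ω → β) (a : α) (b : β) :
    (condProb P A B a b).toReal = pr P {w | A w = a ∧ B w = b} / pr P {w | B w = b} := by
  rw [condProb, ENNReal.toReal_div, toReal_map_apply, toReal_map_apply]
  congr 1
  exact pr_congr P fun w => by simp

theorem levelProb_eq [Fintype S] (P : PMF (S × X × T)) (t : T) (m : ℝ) :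
    levelProb P t m = ∑ s, if m ≤ (condProb P rvT rvS t s).toReal then pr P {w | rvS w = s}
      else 0 := by
  unfold levelProb
  rw [PMF.toOuterMeasure_apply, tsum_fintype, ENNReal.toReal_sum]
  · refine Finset.sum_congr rfl fun s _ => ?_
    simp only [Set.indicator, Set.mem_ofPred_eq]
    split_ifs
    · exact toReal_map_apply _ _ _
    · rfl
  · intro s _
    exact ne_top_of_le_ne_top (PMF.apply_ne_top _ s) (Set.indicator_le_self _ _ _)

theorem levelProb_nonneg (P : PMF (S × X × T)) (t : T) (m : ℝ) : 0 ≤ levelProb P t m :=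
  ENNReal.toReal_nonneg

theorem levelProb_le_one (P : PMF (S × X × T)) (t : T) (m : ℝ) : levelProb P t m ≤ 1 :=
  pr_le_one (P.map rvS) _

theorem condProb_toReal_le_one (P : PMF Ω) (A : Ω → α) (B : Ω → β) (a : α) (b : β) :
    (condProb P A B a b).toReal ≤ 1 := by
  rw [toReal_condProb]
  exact div_le_one_of_le₀ (pr_mono P fun w hw => hw.2) (pr_nonneg _ _)

theorem negMulLog_le_one {x : ℝ} (hx : 0 ≤ x) : Real.negMulLog x ≤ 1 := by
  have := InformationTheory.klFun_nonneg hx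
  rw [InformationTheory.klFun_apply] at this
  rw [Real.negMulLog]
  linarith

/-- The integral of `levelTerm` as the value of a supporting functional. -/
theorem exists_levelTerm_weights [Fintype S] (P : PMF (S × X × T)) (t : T) :
    ∃ w : S → ℝ,
      (∀ v : S → ℝ, (∀ s, 0 ≤ v s) → (∀ s, v s ≤ 1) →
        ∑ s, w s * v s ≤ Real.negMulLog (∑ s, pr P {x | rvS x = s} * v s)) ∧
      IntervalIntegrable (levelTerm P t) MeasureTheory.volume 0 1 ∧
      -∫ m in (0 : ℝ)..1, levelTerm P t m
        = (∑ s, w s * (condProb P rvT rvS t s).toReal) / Real.log 2 := by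
  classical
  obtain ⟨w, h1, h2⟩ := exists_supporting_weights (fun s => pr P {x | rvS x = s})
    (fun s => (condProb P rvT rvS t s).toReal) (fun s => pr_nonneg _ _) Finset.univ
  have hlt : levelTerm P t = fun m => (-(Real.log 2)⁻¹) *
      ∑ s, if m ≤ (condProb P rvT rvS t s).toReal then w s else 0 := by
    ext m
    rw [← h2 m, ← levelProb_eq, levelTerm, Real.logb, Real.negMulLog]
    ring
  have hi := fun s => intervalIntegral_indicator_le (a := w s)
    (ENNReal.toReal_nonneg (a := condProb P rvT rvS t s)) (condProb_toReal_le_one P rvT rvS t s)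
  refine ⟨w, h1, ?_, ?_⟩
  · rw [hlt]
    refine IntervalIntegrable.const_mul ?_ _
    have := IntervalIntegrable.sum Finset.univ fun s _ => (hi s).1
    rwa [show (∑ s, fun m : ℝ => if m ≤ (condProb P rvT rvS t s).toReal then w s else 0)
      = fun m => ∑ s, if m ≤ (condProb P rvT rvS t s).toReal then w s else 0 from
        funext fun m => Finset.sum_apply _ _ _] at this
  · rw [hlt, intervalIntegral.integral_const_mul,
      intervalIntegral.integral_finsetSum fun s _ => (hi s).1,
      Finset.sum_congr rfl fun s _ => (hi s).2]
    field_simp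

theorem neg_integral_levelTerm_nonneg (P : PMF (S × X × T)) (t : T) :
    0 ≤ -∫ m in (0 : ℝ)..1, levelTerm P t m := by
  rw [← intervalIntegral.integral_neg]
  refine intervalIntegral.integral_nonneg zero_le_one fun m _ => ?_
  rw [neg_nonneg]
  exact mul_nonpos_of_nonneg_of_nonpos (levelProb_nonneg P t m)
    (Real.logb_nonpos one_lt_two (levelProb_nonneg P t m) (levelProb_le_one P t m))

/-- The supporting inequality at the normalized profile p/∑p, together with φ ≤ 1, bounds the
integral linearly in P(t|s), which is summable over t. -/
theorem neg_integral_levelTerm_le [Fintype S] (P : PMF (S × X × T)) (t : T) :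
    -∫ m in (0 : ℝ)..1, levelTerm P t m
      ≤ (∑ s, (condProb P rvT rvS t s).toReal) / Real.log 2 := by
  obtain ⟨w, h1, -, h3⟩ := exists_levelTerm_weights P t
  rw [h3]
  refine div_le_div_of_nonneg_right ?_ log_two_pos.le
  set p : S → ℝ := fun s => (condProb P rvT rvS t s).toReal with hp
  have hp0 : ∀ s, 0 ≤ p s := fun s => ENNReal.toReal_nonneg
  have hM : 0 ≤ ∑ s, p s := Finset.sum_nonneg fun s _ => hp0 s
  rcases hM.eq_or_lt with h0 | h0
  · have hz : ∀ s, p s = 0 := fun s =>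
      (Finset.sum_eq_zero_iff_of_nonneg fun s _ => hp0 s).1 h0.symm s (Finset.mem_univ s)
    simp only [show ∀ s, (condProb P rvT rvS t s).toReal = 0 from hz]
    simpa using hM
  · have h4 := h1 (fun s => p s / ∑ s, p s) (fun s => div_nonneg (hp0 s) hM) fun s =>
      div_le_one_of_le₀ (Finset.single_le_sum (fun s _ => hp0 s) (Finset.mem_univ s)) hM
    have h5 := h4.trans (negMulLog_le_one (Finset.sum_nonneg fun s _ =>
      mul_nonneg (pr_nonneg _ _) (div_nonneg (hp0 s) hM)))
    simp only [← mul_div_assoc] at h5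
    rwa [← Finset.sum_div, div_le_one h0] at h5

theorem summable_integral_levelTerm [Finite S] (P : PMF (S × X × T)) :
    Summable fun t => ∫ m in (0 : ℝ)..1, levelTerm P t m := by
  have := Fintype.ofFinite S
  rw [← summable_neg_iff]
  refine Summable.of_nonneg_of_le (neg_integral_levelTerm_nonneg P) (neg_integral_levelTerm_le P)
    (Summable.div_const (summable_sum fun s _ => ?_) _)
  simp only [toReal_condProb]
  refine Summable.div_const ?_ _
  exact (hasSum_pr P {w | rvS w = s} rvT).summable.congr fun t => pr_congr P fun w => and_comm

/-- Each letter's contribution to `H(T|Y)` dominates the value of the supporting functional. -/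
theorem ofReal_le_of_indep [Fintype S] {Q : PMF Ω} {A : Ω → α} {B : Ω → S} {Y : Ω → 𝒴}
    (hind : mi Q Y B = 0) {w : S → ℝ}
    (hw : ∀ v : S → ℝ, (∀ s, 0 ≤ v s) → (∀ s, v s ≤ 1) →
        ∑ s, w s * v s ≤ Real.negMulLog (∑ s, pr Q {x | B x = s} * v s)) (a : α) :
    ENNReal.ofReal ((∑ s, w s * (pr Q {x | A x = a ∧ B x = s} / pr Q {x | B x = s})) / Real.log 2)
      ≤ ∑' y, ENNReal.ofReal (pr Q {x | A x = a ∧ Y x = y} *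
        Real.log (pr Q {x | Y x = y} / pr Q {x | A x = a ∧ Y x = y}) / Real.log 2) := by
  have hl2 := log_two_pos
  have hs : ∀ s, HasSum (fun y => pr Q {x | (A x = a ∧ B x = s) ∧ Y x = y})
      (pr Q {x | A x = a ∧ B x = s}) := fun s => hasSum_pr Q {x | A x = a ∧ B x = s} Y
  refine ofReal_le_tsum_ofReal (r := fun y => (∑ s, w s *
    (pr Q {x | (A x = a ∧ B x = s) ∧ Y x = y} / pr Q {x | B x = s})) / Real.log 2)
    ((hasSum_sum fun s _ => ((hs s).div_const _).mul_left _).div_const _)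
    (fun y => entropyTerm_nonneg (pr_nonneg _ _) (pr_mono Q fun x hx => hx.2)) fun y => ?_
  refine div_le_div_of_nonneg_right ?_ hl2.le
  have hsub : ∀ s, pr Q {x | (A x = a ∧ B x = s) ∧ Y x = y} ≤ pr Q {x | Y x = y ∧ B x = s} :=
    fun s => pr_mono Q fun x hx => ⟨hx.2, hx.1.2⟩
  have hprod : ∀ s, pr Q {x | Y x = y ∧ B x = s} = pr Q {x | Y x = y} * pr Q {x | B x = s} :=
    fun s => pr_eq_mul_of_mi_eq_zero hind y s
  rcases (pr_nonneg Q {x | Y x = y}).eq_or_lt with h0 | h0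
  · have hz : ∀ s, pr Q {x | (A x = a ∧ B x = s) ∧ Y x = y} = 0 := fun s =>
      pr_eq_zero_of_subset Q (fun x hx => hx.2) h0.symm
    simp [hz, ← h0]
  · have h1 := hw (fun s => pr Q {x | (A x = a ∧ B x = s) ∧ Y x = y} / pr Q {x | B x = s} /
      pr Q {x | Y x = y}) (fun s => div_nonneg (div_nonneg (pr_nonneg _ _) (pr_nonneg _ _)) h0.le)
      (fun s => by
        rw [div_div]
        refine div_le_one_of_le₀ ?_ (mul_nonneg (pr_nonneg _ _) h0.le)
        rw [mul_comm, ← hprod]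
        exact hsub s)
    have h2 : ∑ s, pr Q {x | B x = s} * (pr Q {x | (A x = a ∧ B x = s) ∧ Y x = y} /
        pr Q {x | B x = s} / pr Q {x | Y x = y})
        = pr Q {x | A x = a ∧ Y x = y} / pr Q {x | Y x = y} := by
      have h3 : ∀ s, pr Q {x | B x = s} * (pr Q {x | (A x = a ∧ B x = s) ∧ Y x = y} /
          pr Q {x | B x = s} / pr Q {x | Y x = y})
          = pr Q {x | (A x = a ∧ B x = s) ∧ Y x = y} / pr Q {x | Y x = y} := by
        intro s
        by_cases hb : pr Q {x | B x = s} = 0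
        · rw [hb, pr_eq_zero_of_subset Q (fun x hx => hx.1.2) hb]
          simp
        · field_simp
      simp only [h3]
      rw [← Finset.sum_div]
      congr 1
      refine (hasSum_fintype _).unique ?_
      refine (hasSum_pr Q {x | A x = a ∧ Y x = y} B).congr_fun fun s => ?_
      exact pr_congr Q fun x => and_right_comm
    rw [h2] at h1
    have h4 := mul_le_mul_of_nonneg_left h1 h0.le
    refine le_trans (le_of_eq ?_) (h4.trans (le_of_eq ?_))
    · rw [Finset.mul_sum]
      refine Finset.sum_congr rfl fun s _ => ?_
      field_simp
    · rw [Real.negMulLog, ← inv_div (pr Q {x | A x = a ∧ Y x = y}), Real.log_inv]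
      field_simp

theorem g_le [Countable S] [Countable X] [Countable T] {P : PMF (S × X × T)} {r B : ℝ≥0∞}
    (h : ∀ M : PMF ((S × X × T) × ℕ), M.map Prod.fst = P → mi M Prod.snd (rvS ∘ Prod.fst) = 0 →
      mi M (rvX ∘ Prod.fst) Prod.snd ≤ r → mi M Prod.snd (rvT ∘ Prod.fst) ≤ B) : g 0 r P ≤ B := by
  unfold g
  simp only [mutualInfo_eq_mi]
  exact iSup_le fun K => iSup_le fun hS => iSup_le fun hX =>
    h _ (map_fst_bind P K) (nonpos_iff_eq_zero.1 hS) hX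

theorem entropy_map (P : PMF Ω) (F : Ω → α) (A : α → β) :
    entropy (P.map F) A = entropy P (A ∘ F) := by
  rw [entropy_eq_condEntropy, entropy_eq_condEntropy, condEntropy_map]

theorem neg_integral_levelTerm_le_of_indep [Fintype S] {P : PMF (S × X × T)}
    {M : PMF ((S × X × T) × 𝒴)} (hM : M.map Prod.fst = P)
    (hS : mi M Prod.snd (rvS ∘ Prod.fst) = 0) (t : T) :
    ENNReal.ofReal (-∫ m in (0 : ℝ)..1, levelTerm P t m)
      ≤ ∑' y, ENNReal.ofReal (pr M {x | (rvT ∘ Prod.fst) x = t ∧ x.2 = y} *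
        Real.log (pr M {x | x.2 = y} / pr M {x | (rvT ∘ Prod.fst) x = t ∧ x.2 = y})
          / Real.log 2) := by
  obtain ⟨w, h1, -, h3⟩ := exists_levelTerm_weights P t
  have hP : ∀ E : Set (S × X × T), pr P E = pr M (Prod.fst ⁻¹' E) := fun E => by
    rw [← hM, pr_map]
  rw [h3]
  simp only [toReal_condProb, hP] at h1 ⊢
  exact ofReal_le_of_indep (A := rvT ∘ Prod.fst) (B := rvS ∘ Prod.fst) hS h1 t

/-- Sum over t the lower bounds on the contributions to H(T|Y). The additive form stays meaningful
when H(T) is infinite. -/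
theorem mi_add_le_entropy [Finite S] {P : PMF (S × X × T)}
    {M : PMF ((S × X × T) × 𝒴)} (hM : M.map Prod.fst = P)
    (hS : mi M Prod.snd (rvS ∘ Prod.fst) = 0) :
    mi M Prod.snd (rvT ∘ Prod.fst)
      + ENNReal.ofReal (-∑' t, ∫ m in (0 : ℝ)..1, levelTerm P t m) ≤ entropy P rvT := by
  have := Fintype.ofFinite S
  have hent : entropy P rvT = entropy M (rvT ∘ Prod.fst) := by rw [← hM, entropy_map]
  rw [hent, entropy_eq_add M (rvT ∘ Prod.fst) Prod.snd, mi_comm]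
  gcongr
  rw [condEntropy_eq, ENNReal.tsum_comm, ← tsum_neg, ENNReal.ofReal_tsum_of_nonneg
    (neg_integral_levelTerm_nonneg P) (summable_integral_levelTerm P).neg]
  exact ENNReal.tsum_le_tsum (neg_integral_levelTerm_le_of_indep hM hS)

theorem coe_le_add_of_add_ofReal_le {x y : ℝ≥0∞} {c : ℝ} (hc : 0 ≤ -c)
    (h : x + ENNReal.ofReal (-c) ≤ y) : (x : EReal) ≤ (y : EReal) + (c : EReal) := by
  have h1 := EReal.coe_ennreal_le_coe_ennreal_iff.2 h
  rw [EReal.coe_ennreal_add, EReal.coe_ennreal_ofReal, max_eq_left hc] at h1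
  rw [← neg_neg c, EReal.coe_neg, ← sub_eq_add_neg]
  exact EReal.le_sub_iff_add_le (.inl (EReal.coe_ne_bot _)) (.inl (EReal.coe_ne_top _)) |>.2 h1

theorem g_le_U0 [Finite S] [Countable X] [Countable T] (P : PMF (S × X × T)) (r : ℝ≥0∞) :
    (g 0 r P : EReal) ≤ U0 P := by
  have hneg : 0 ≤ -∑' t, ∫ m in (0 : ℝ)..1, levelTerm P t m := by
    rw [← tsum_neg]
    exact tsum_nonneg (neg_integral_levelTerm_nonneg P)
  -- A constant Y shows that the subtracted quantity is at most H(T), so the truncated subtraction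
  -- below is exact.
  obtain ⟨M, hM, hS⟩ : ∃ M : PMF ((S × X × T) × Unit), M.map Prod.fst = P ∧
      mi M Prod.snd (rvS ∘ Prod.fst) = 0 := by
    refine ⟨P.map fun w => (w, ()), ?_, ?_⟩
    · rw [PMF.map_comp]
      exact PMF.map_id P
    · rw [mi_map]
      exact mi_const _ _ _
  refine coe_le_add_of_add_ofReal_le hneg ?_
  have hle := le_add_self.trans (mi_add_le_entropy hM hS)
  have key := fun (M : PMF ((S × X × T) × ℕ)) hM hS => mi_add_le_entropy (P := P) (M := M) hM hS
  generalize ENNReal.ofReal (-∑' t, ∫ m in (0 : ℝ)..1, levelTerm P t m) = c at *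
  by_cases hc : c = ⊤
  · rw [hc, top_le_iff] at hle
    rw [hle]
    exact le_top
  · rw [← tsub_add_cancel_of_le hle]
    gcongr
    exact g_le fun M hM hS _ => ENNReal.le_sub_of_add_le_right hc (key M hM hS)

end

noncomputable section

variable {S X T : Type*}

/-! ### Monotonicity, the time-sharing weight and extended logarithms -/

theorem mi_le_entropy_left {Ω α β : Type*} (P : PMF Ω) (A : Ω → α) (B : Ω → β) :
    mi P A B ≤ entropy P A := by
  rw [entropy_eq_add P A B]
  exact le_self_add

theorem g_mono (P : PMF (S × X × T)) {r r' : ℝ≥0∞} (h : r ≤ r') :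
    g 0 r P ≤ g 0 r' P := by
  unfold g
  exact iSup_mono fun K => iSup_mono fun _ => iSup_le fun hX => le_iSup_of_le (hX.trans h) le_rfl

theorem alpha_le_one (P : PMF (S × X × T)) {r : NNReal} (hr : (r : ℝ≥0∞) ≤ condEntropy P rvX rvS) :
    alpha r P ≤ 1 :=
  ENNReal.div_le_of_le_mul (by rwa [one_mul])

theorem alpha_mul (P : PMF (S × X × T)) {r : NNReal} (hr : (r : ℝ≥0∞) ≤ condEntropy P rvX rvS)
    (ht : condEntropy P rvX rvS ≠ ⊤) : alpha r P * condEntropy P rvX rvS = r := by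
  by_cases h0 : condEntropy P rvX rvS = 0
  · rw [h0, mul_zero]
    exact (nonpos_iff_eq_zero.1 (h0 ▸ hr)).symm
  · exact ENNReal.div_mul_cancel h0 ht

theorem L1Prime_eq [Finite S] (P : PMF (S × X × T)) :
    L1Prime P = (entropy P rvT : EReal) - (entropy P rvS : EReal) := by
  have hS := entropy_ne_top P (rvS (S := S) (X := X) (T := T))
  have hI : mi P rvT rvS ≠ ⊤ := by
    rw [mi_comm]
    exact ne_top_of_le_ne_top hS (mi_le_entropy_left P _ _)
  have hC : condEntropy P rvS rvT ≠ ⊤ := by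
    refine ne_top_of_le_ne_top hS ?_
    rw [entropy_eq_add P rvS rvT]
    exact le_add_self
  rw [L1Prime, entropy_eq_add P rvT rvS, entropy_eq_add P rvS rvT, mi_comm P rvS rvT]
  generalize mi P rvT rvS = i at *
  generalize condEntropy P rvS rvT = c at *
  generalize condEntropy P rvT rvS = t at *
  lift i to NNReal using hI
  lift c to NNReal using hC
  rw [EReal.coe_ennreal_add, EReal.coe_ennreal_add]
  by_cases h : t = ⊤
  · subst h
    rfl
  · lift t to NNReal using h
    simp only [EReal.coe_nnreal_eq_coe_real, ← EReal.coe_add, ← EReal.coe_sub]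
    congr 1
    ring

theorem log2_mono {x y : ℝ≥0∞} (h : x ≤ y) : log2 x ≤ log2 y :=
  EReal.div_le_div_right_of_nonneg (EReal.coe_nonneg.2 log_two_pos.le) (ENNReal.log_monotone h)

theorem log2_top : log2 ⊤ = ⊤ := by
  rw [log2, ENNReal.log_top]
  exact EReal.top_div_of_pos_ne_top (EReal.coe_pos.2 log_two_pos) (EReal.coe_ne_top _)

theorem log2_add_ofReal {x : ℝ≥0∞} (hx : x ≠ ⊤) {c : ℝ} (hc : 0 < c) :
    log2 (x + ENNReal.ofReal c) = (Real.logb 2 (x.toReal + c) : EReal) := by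
  have h0 : 0 < x.toReal + c := add_pos_of_nonneg_of_pos ENNReal.toReal_nonneg hc
  rw [log2, ← ENNReal.ofReal_toReal hx, ← ENNReal.ofReal_add ENNReal.toReal_nonneg hc.le,
    ENNReal.log_ofReal_of_pos h0, ENNReal.toReal_ofReal ENNReal.toReal_nonneg, Real.logb,
    EReal.coe_div]

/-- The race gives the constants 4 and 1, smaller than the claimed 5.51 and 1.06. -/
theorem coe_ofReal_logb_le {x : ℝ≥0∞} (hx : x ≠ ⊤) :
    ((ENNReal.ofReal (Real.logb 2 (x.toReal + 4) + 1) : ℝ≥0∞) : EReal)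
      ≤ log2 (x + ENNReal.ofReal 5.51) + ((1.06 : ℝ) : EReal) := by
  have h0 : 0 ≤ x.toReal := ENNReal.toReal_nonneg
  have h1 : 0 ≤ Real.logb 2 (x.toReal + 4) := Real.logb_nonneg one_lt_two (by linarith)
  have h2 : Real.logb 2 (x.toReal + 4) ≤ Real.logb 2 (x.toReal + 5.51) :=
    Real.logb_le_logb_of_le one_lt_two (by linarith) (by linarith)
  rw [log2_add_ofReal hx (by norm_num), EReal.coe_ennreal_ofReal, max_eq_left (by linarith),
    ← EReal.coe_add]
  exact EReal.coe_le_coe_iff.2 (by linarith)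

variable [Countable X] [Countable T]

/-! ### Upper bounds by conditional entropies -/

theorem g_le_condEntropy_add [Countable S] (P : PMF (S × X × T)) (r : ℝ≥0∞) :
    g 0 r P ≤ condEntropy P rvT rvX + r := by
  refine g_le fun M hM _ hX => ?_
  have h1 : condEntropy P rvT rvX = condEntropy M (rvT ∘ Prod.fst) (rvX ∘ Prod.fst) := by
    rw [← hM, condEntropy_map]
  have h2 := mi_comp_right_le M Prod.snd (B := rvT ∘ Prod.fst)
    (B' := fun w => ((rvX ∘ Prod.fst) w, (rvT ∘ Prod.fst) w)) Prod.snd fun _ => rfl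
  rw [mi_chain, cmi_comm, mi_comm M _ (rvX ∘ Prod.fst)] at h2
  rw [h1, add_comm]
  exact h2.trans (add_le_add hX (cmi_le_condEntropy _ _ _ _))

theorem g_le_condEntropy [Countable S] (P : PMF (S × X × T)) (r : ℝ≥0∞) :
    g 0 r P ≤ condEntropy P rvT rvS := by
  refine g_le fun M hM hS _ => ?_
  have h1 : condEntropy P rvT rvS = condEntropy M (rvT ∘ Prod.fst) (rvS ∘ Prod.fst) := by
    rw [← hM, condEntropy_map]
  have h2 := mi_comp_right_le M Prod.snd (B := rvT ∘ Prod.fst)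
    (B' := fun w => ((rvS ∘ Prod.fst) w, (rvT ∘ Prod.fst) w)) Prod.snd fun _ => rfl
  rw [mi_chain, cmi_comm, hS, zero_add] at h2
  rw [h1]
  exact h2.trans (cmi_le_condEntropy _ _ _ _)

theorem g_le_upperBound [Finite S] (P : PMF (S × X × T)) (r : NNReal) :
    (g 0 r P : EReal) ≤ upperBound r P := by
  refine le_min ?_ (le_min ?_ (g_le_U0 P r))
  · rw [← EReal.coe_ennreal_add]
    exact EReal.coe_ennreal_le_coe_ennreal_iff.2 (g_le_condEntropy_add P r)
  · exact EReal.coe_ennreal_le_coe_ennreal_iff.2 (g_le_condEntropy P r)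

/-! ### Lower bounds in `[0, ∞]` -/

/-- For T' = quant(T) and J = I(X,S;T'), J + H(T'|X,S) = H(T') = I(T';Y) + H(T'|Y) ≤ g + J + log₂(J
+ 4) + 1. The finite J cancels, and J ≤ I(X,S;T) makes the remaining error uniform in the
truncation. -/
theorem condEntropy_quant_le_g [Countable S] (P : PMF (S × X × T)) (hI : mi P rvXS rvT ≠ ⊤)
    (n : ℕ) : condEntropy P (fun w => quant n (rvT w)) rvXS
      ≤ g 0 0 P + ENNReal.ofReal (Real.logb 2 ((mi P rvXS rvT).toReal + 4) + 1) := by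
  obtain ⟨P', hP', hXS, hH⟩ :=
    exists_strong_functional_representation P rvXS (fun w => quant n (rvT w))
  have hJ : mi P rvXS (fun w => quant n (rvT w)) ≤ mi P rvXS rvT :=
    mi_comp_right_le P _ (quant n) fun _ => rfl
  have hS : mi P' Prod.snd (rvS ∘ Prod.fst) ≤ 0 := hXS ▸
    mi_comp_right_le P' Prod.snd (B := rvS ∘ Prod.fst) (B' := rvXS ∘ Prod.fst) Prod.snd fun _ => rfl
  have hX : mi P' (rvX ∘ Prod.fst) Prod.snd ≤ 0 := by
    rw [mi_comm, ← hXS]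
    exact mi_comp_right_le P' Prod.snd (B := rvX ∘ Prod.fst) (B' := rvXS ∘ Prod.fst) Prod.fst
      fun _ => rfl
  have hg := mi_le_g hP' hS hX
  have h1 : mi P' (fun v => quant n (rvT v.1)) Prod.snd ≤ g 0 0 P := by
    rw [mi_comm]
    exact (mi_comp_right_le P' Prod.snd (B' := rvT ∘ Prod.fst) (quant n) fun _ => rfl).trans hg
  have h2 : entropy P (fun w => quant n (rvT w)) = entropy P' (fun v => quant n (rvT v.1)) := by
    rw [← hP', entropy_map]
    rfl
  rw [entropy_eq_add P _ rvXS, entropy_eq_add P' _ Prod.snd, mi_comm] at h2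
  have h3 : Real.logb 2 ((mi P rvXS fun w => quant n (rvT w)).toReal + 4)
      ≤ Real.logb 2 ((mi P rvXS rvT).toReal + 4) :=
    Real.logb_le_logb_of_le one_lt_two (by positivity)
      (add_le_add_left (ENNReal.toReal_mono hI hJ) 4)
  refine (ENNReal.add_le_add_iff_left (ne_top_of_le_ne_top hI hJ)).1 ?_
  calc mi P rvXS (fun w => quant n (rvT w)) + condEntropy P (fun w => quant n (rvT w)) rvXS
      = _ := h2
    _ ≤ g 0 0 P + (mi P rvXS (fun w => quant n (rvT w))
        + ENNReal.ofReal (Real.logb 2 ((mi P rvXS rvT).toReal + 4) + 1)) := by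
      refine add_le_add h1 (hH.trans ?_)
      gcongr
    _ = _ := by ring

/-- The lower bound given by the strong functional representation lemma. -/
theorem condEntropy_le_g_add [Countable S] (P : PMF (S × X × T)) (hI : mi P rvXS rvT ≠ ⊤) :
    condEntropy P rvT rvXS
      ≤ g 0 0 P + ENNReal.ofReal (Real.logb 2 ((mi P rvXS rvT).toReal + 4) + 1) :=
  (condEntropy_le_iSup_quant P rvT rvXS).trans (iSup_le (condEntropy_quant_le_g P hI))

theorem condEntropy_add_comp_le_g [Countable S] (P : PMF (S × X × T)) {m : ℕ}
    (q : X → Fin (m + 1)) :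
    condEntropy P rvT rvXS + condEntropy P (fun w => q (rvX w)) rvS
      ≤ g 0 (condEntropy P (fun w => q (rvX w)) rvS) P + condEntropy P rvXS rvT := by
  refine (add_le_add_left (condEntropy_le_iSup_quant P rvT rvXS) _).trans ?_
  rw [ENNReal.iSup_add]
  exact iSup_le fun n => frl_bound P q (quant n)

theorem condEntropy_add_condEntropy_le_g [Countable S] (P : PMF (S × X × T)) {r : ℝ≥0∞}
    (hr : condEntropy P rvX rvS ≤ r) :
    condEntropy P rvT rvXS + condEntropy P rvX rvS ≤ g 0 r P + condEntropy P rvXS rvT := by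
  refine (add_le_add_right (condEntropy_le_iSup_quant P rvX rvS) _).trans ?_
  rw [ENNReal.add_iSup]
  refine iSup_le fun m => (condEntropy_add_comp_le_g P (quant m)).trans ?_
  gcongr
  exact g_mono P ((condEntropy_comp_le P rvS (quant m) fun _ => rfl).trans hr)

/-- The rate 0 endpoint: a constant quantizer of X has H(X'|S) = 0. -/
theorem condEntropy_le_g_zero_add [Countable S] (P : PMF (S × X × T)) :
    condEntropy P rvT rvXS ≤ g 0 0 P + condEntropy P rvXS rvT := by
  have := condEntropy_add_comp_le_g P (m := 0) (fun _ => 0)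
  rwa [condEntropy_comp_zero P (fun _ => (0 : Fin 1)) rvS (fun _ => 0) fun _ => rfl, add_zero]
    at this

/-- Below H(X|S), some truncation X' has finite ρ = H(X'|S) > r. Time sharing between the rates 0
and ρ with weight r/ρ gives the claim, even when H(X|S) is infinite. -/
theorem condEntropy_add_le_g [Countable S] (P : PMF (S × X × T)) {r : ℝ≥0∞}
    (hr : r ≤ condEntropy P rvX rvS) :
    condEntropy P rvT rvXS + r ≤ g 0 r P + condEntropy P rvXS rvT := by
  rcases hr.eq_or_lt with h | h
  · exact (add_le_add_right hr _).trans (condEntropy_add_condEntropy_le_g P h.ge)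
  obtain ⟨m, hm⟩ := lt_iSup_iff.1 (h.trans_le (condEntropy_le_iSup_quant P rvX rvS))
  have hρ := condEntropy_add_comp_le_g P (quant (α := X) m)
  have hρt : condEntropy P (fun w => quant m (rvX w)) rvS ≠ ⊤ := by
    refine ne_top_of_le_ne_top (entropy_ne_top P fun w => quant m (rvX w)) ?_
    rw [entropy_eq_add P _ rvS]
    exact le_add_self
  generalize condEntropy P (fun w => quant m (rvX w)) rvS = ρ at *
  have hρ0 : ρ ≠ 0 := (bot_le.trans_lt hm).ne'
  have ha : r / ρ ≤ 1 := ENNReal.div_le_of_le_mul (by rw [one_mul]; exact hm.le)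
  have har : r / ρ * ρ = r := ENNReal.div_mul_cancel hρ0 hρt
  have hts := g_timeSharing P ha 0 ρ
  have h1 : 1 - r / ρ + r / ρ = 1 := tsub_add_cancel_of_le ha
  rw [mul_zero, zero_add, har] at hts
  generalize r / ρ = a at *
  calc condEntropy P rvT rvXS + r
      = (1 - a) * condEntropy P rvT rvXS + a * (condEntropy P rvT rvXS + ρ) := by
        rw [mul_add, har, ← add_assoc, ← add_mul, h1, one_mul]
    _ ≤ (1 - a) * (g 0 0 P + condEntropy P rvXS rvT)
        + a * (g 0 ρ P + condEntropy P rvXS rvT) := by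
        gcongr
        exact condEntropy_le_g_zero_add P
    _ = (1 - a) * g 0 0 P + a * g 0 ρ P + (1 - a + a) * condEntropy P rvXS rvT := by ring
    _ ≤ g 0 r P + condEntropy P rvXS rvT := by
        rw [h1, one_mul]
        gcongr

/-- Time sharing with weight α between the race at rate 0 and the pair (V,U) at rate H(X|S): the
loss H(X,S|T) is paid only with weight α. -/
theorem condEntropy_add_le_g_interpolation [Countable S] (P : PMF (S × X × T)) {r : NNReal}
    (hr : (r : ℝ≥0∞) ≤ condEntropy P rvX rvS) (ht : condEntropy P rvX rvS ≠ ⊤)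
    (hI : mi P rvXS rvT ≠ ⊤) :
    condEntropy P rvT rvXS + r ≤ g 0 r P
      + ENNReal.ofReal (Real.logb 2 ((mi P rvXS rvT).toReal + 4) + 1)
      + alpha r P * condEntropy P rvXS rvT := by
  have ha := alpha_le_one P hr
  have har := alpha_mul P hr ht
  have hts := g_timeSharing P ha 0 (condEntropy P rvX rvS)
  have h1 : 1 - alpha r P + alpha r P = 1 := tsub_add_cancel_of_le ha
  have h2 := condEntropy_le_g_add P hI
  have h3 := condEntropy_add_condEntropy_le_g P (le_refl (condEntropy P rvX rvS))
  rw [mul_zero, zero_add, har] at hts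
  generalize alpha r P = a at *
  generalize ENNReal.ofReal (Real.logb 2 ((mi P rvXS rvT).toReal + 4) + 1) = c at *
  calc condEntropy P rvT rvXS + r
      = (1 - a) * condEntropy P rvT rvXS
        + a * (condEntropy P rvT rvXS + condEntropy P rvX rvS) := by
        rw [mul_add, har, ← add_assoc, ← add_mul, h1, one_mul]
    _ ≤ (1 - a) * (g 0 0 P + c)
        + a * (g 0 (condEntropy P rvX rvS) P + condEntropy P rvXS rvT) := by
        gcongr
    _ = (1 - a) * g 0 0 P + a * g 0 (condEntropy P rvX rvS) P + (1 - a) * c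
        + a * condEntropy P rvXS rvT := by ring
    _ ≤ g 0 r P + 1 * c + a * condEntropy P rvXS rvT := by
        gcongr
        exact tsub_le_self
    _ = _ := by rw [one_mul]

/-- H(T|S) + H(X|S,T) = H(X|S) + H(T|X,S) ≤ g + H(X,S|T) = g + H(S|T) + H(X|S,T). The common term is
at most r, hence finite, and cancels. -/
theorem condEntropy_le_g_add_condEntropy [Countable S] (P : PMF (S × X × T)) {r : NNReal}
    (hr : condEntropy P rvX rvS ≤ r) :
    condEntropy P rvT rvS ≤ g 0 r P + condEntropy P rvS rvT := by
  have h1 := condEntropy_add_condEntropy_le_g P hr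
  have h2 : condEntropy P (fun w => (rvT w, rvX w)) rvS
      ≤ condEntropy P (fun w => (rvX w, rvT w)) rvS :=
    condEntropy_comp_le P rvS Prod.swap fun _ => rfl
  have h3 : condEntropy P rvXS rvT ≤ condEntropy P (fun w => (rvS w, rvX w)) rvT :=
    condEntropy_comp_le P rvT Prod.swap fun _ => rfl
  have h6 := h3.trans_eq (condEntropy_pair P rvS rvX rvT)
  rw [condEntropy_pair, condEntropy_pair, add_comm (condEntropy P rvX rvS)] at h2
  have h4 : condEntropy P rvX (fun w => (rvT w, rvS w))
      = condEntropy P rvX (fun w => (rvS w, rvT w)) :=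
    condEntropy_cond_equiv P rvX (fun w => (rvS w, rvT w)) (Equiv.prodComm S T)
  have h5 : condEntropy P rvX (fun w => (rvS w, rvT w)) ≠ ⊤ := by
    rw [← h4]
    exact ne_top_of_le_ne_top ENNReal.coe_ne_top ((condEntropy_cond_le P rvX rvT rvS).trans hr)
  rw [h4] at h2
  refine (ENNReal.add_le_add_iff_right h5).1 ?_
  rw [add_assoc]
  exact (h2.trans h1).trans (add_le_add_right h6 _)

/-! ### The bounds as extended reals -/

theorem L1_le_g [Countable S] (P : PMF (S × X × T)) {r : NNReal}
    (hr : (r : ℝ≥0∞) ≤ condEntropy P rvX rvS) : L1 r P ≤ (g 0 r P : EReal) := by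
  refine EReal.sub_le_of_le_add ?_
  rw [← EReal.coe_ennreal_add, ← EReal.coe_ennreal_add]
  exact EReal.coe_ennreal_le_coe_ennreal_iff.2 (condEntropy_add_le_g P hr)

theorem L1Prime_le_g [Countable S] (P : PMF (S × X × T)) {r : NNReal}
    (hr : condEntropy P rvX rvS ≤ r) : L1Prime P ≤ (g 0 r P : EReal) := by
  refine EReal.sub_le_of_le_add ?_
  rw [← EReal.coe_ennreal_add]
  exact EReal.coe_ennreal_le_coe_ennreal_iff.2 (condEntropy_le_g_add_condEntropy P hr)

theorem L2_le_g [Countable S] (P : PMF (S × X × T)) (r : ℝ≥0∞) : L2 P ≤ (g 0 r P : EReal) := by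
  rw [L2, mutualInfo_eq_mi]
  by_cases hI : mi P rvXS rvT = ⊤
  -- With infinite mutual information the bound is -∞.
  · rw [hI, top_add, log2_top, EReal.top_add_coe, EReal.sub_top]
    exact bot_le
  · refine EReal.sub_le_of_le_add ?_
    have h := (condEntropy_le_g_add P hI).trans (add_le_add_left (g_mono P (zero_le (a := r))) _)
    have h' := EReal.coe_ennreal_le_coe_ennreal_iff.2 h
    rw [EReal.coe_ennreal_add] at h'
    exact h'.trans (add_le_add_right (coe_ofReal_logb_le hI) _)

theorem L3_le_g [Countable S] (P : PMF (S × X × T)) {r : NNReal}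
    (hr : (r : ℝ≥0∞) ≤ condEntropy P rvX rvS) (ht : condEntropy P rvX rvS ≠ ⊤) :
    L3 r P ≤ (g 0 r P : EReal) := by
  have hmin : mi P rvXS rvT ≤ min (entropy P rvT) (entropy P rvXS) :=
    le_min ((mi_comm P _ _).trans_le (mi_le_entropy_left P _ _)) (mi_le_entropy_left P _ _)
  -- The logarithm in `L3` has an argument at least I + 5.51, since I ≤ min{H(T), H(X,S)}; so the
  -- interpolated bound, which has I alone, is stronger.
  have hJ : mi P rvXS rvT + ENNReal.ofReal 5.51
      ≤ (1 - alpha r P) * mi P rvXS rvT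
        + alpha r P * min (entropy P rvT) (entropy P rvXS) + ENNReal.ofReal 5.51 := by
    gcongr
    calc mi P rvXS rvT = (1 - alpha r P) * mi P rvXS rvT + alpha r P * mi P rvXS rvT := by
          rw [← add_mul, tsub_add_cancel_of_le (alpha_le_one P hr), one_mul]
      _ ≤ _ := by gcongr
  rw [L3, mutualInfo_eq_mi]
  have hlog := log2_mono hJ
  by_cases hI : mi P rvXS rvT = ⊤
  · rw [hI, top_add, log2_top, top_le_iff] at hlog
    rw [hI, hlog, EReal.sub_top]
    exact bot_le
  · refine EReal.sub_le_of_le_add (EReal.sub_le_of_le_add (EReal.sub_le_of_le_add ?_))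
    have h := EReal.coe_ennreal_le_coe_ennreal_iff.2 (condEntropy_add_le_g_interpolation P hr ht hI)
    rw [EReal.coe_ennreal_add, EReal.coe_ennreal_add, EReal.coe_ennreal_add] at h
    refine h.trans (add_le_add_left ?_ _)
    rw [add_assoc]
    exact add_le_add_right ((coe_ofReal_logb_le hI).trans (add_le_add_left hlog _)) _

end

end FairRepresentation

theorem theorem1 {S X T : Type*} [Finite S] [Countable X] [Countable T]
    (P : PMF (S × X × T)) :
    -- the integrals and the series in the definition of `U₀` converge
    ((∀ t, IntervalIntegrable (FairRepresentation.levelTerm P t) MeasureTheory.volume 0 1) ∧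
      Summable fun t => ∫ m in (0 : ℝ)..1, FairRepresentation.levelTerm P t m) ∧
    -- the regime `0 ≤ r ≤ H(X|S)`; `L₃` needs `α = r / H(X|S)` with `H(X|S) < ∞`
    (∀ r : NNReal,
      (r : ENNReal) ≤ FairRepresentation.condEntropy P
        FairRepresentation.rvX FairRepresentation.rvS →
      max (FairRepresentation.L1 r P) (FairRepresentation.L2 P)
          ≤ (FairRepresentation.g 0 r P : EReal) ∧
      (FairRepresentation.condEntropy P FairRepresentation.rvX FairRepresentation.rvS < ⊤ →
        max (FairRepresentation.L1 r P) (max (FairRepresentation.L2 P) (FairRepresentation.L3 r P))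
          ≤ (FairRepresentation.g 0 r P : EReal)) ∧
      (FairRepresentation.g 0 r P : EReal) ≤ FairRepresentation.upperBound r P) ∧
    -- the regime `H(X|S) ≤ r < H(X)`
    (∀ r : NNReal,
      FairRepresentation.condEntropy P FairRepresentation.rvX FairRepresentation.rvS
        ≤ (r : ENNReal) →
      (r : ENNReal) < FairRepresentation.entropy P FairRepresentation.rvX →
      max (FairRepresentation.L1Prime P) (FairRepresentation.L2 P)
          ≤ (FairRepresentation.g 0 r P : EReal) ∧
      (FairRepresentation.g 0 r P : EReal) ≤ FairRepresentation.upperBound r P) ∧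
    -- the two expressions for `L'₁`
    FairRepresentation.L1Prime P
      = (FairRepresentation.entropy P FairRepresentation.rvT : EReal)
        - (FairRepresentation.entropy P FairRepresentation.rvS : EReal) := by
  refine ⟨⟨fun t => ?_, FairRepresentation.summable_integral_levelTerm P⟩, fun r hr => ⟨?_, ?_, ?_⟩,
    fun r hr _ => ⟨?_, ?_⟩, FairRepresentation.L1Prime_eq P⟩
  · have := Fintype.ofFinite S
    obtain ⟨-, -, h, -⟩ := FairRepresentation.exists_levelTerm_weights P t
    exact h
  · exact max_le (FairRepresentation.L1_le_g P hr) (FairRepresentation.L2_le_g P r)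
  · exact fun ht => max_le (FairRepresentation.L1_le_g P hr)
      (max_le (FairRepresentation.L2_le_g P r) (FairRepresentation.L3_le_g P hr ht.ne))
  · exact FairRepresentation.g_le_upperBound P r
  · exact max_le (FairRepresentation.L1Prime_le_g P hr) (FairRepresentation.L2_le_g P r)
  · exact FairRepresentation.g_le_upperBound P r
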